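/- Let $V$ be a finite-dimensional real vector space with scalar product $\langle\cdot,\cdot\rangle$ and the corresponding Lebesgue measure, and write $e(x\cdot y)=e^{2\pi i\langle x,y\rangle}$. Let $\mathcal A$ be a (complex, not necessarily unital) Fréchet algebra with a smooth isometric action $\alpha$ of $V$ by automorphisms: the topology of $\mathcal A$ is defined by a sequence of $\alpha$-invariant seminorms, all functions $x\mapsto\alpha_x(a)$ are differentiable, and for every $X\in V$ the partial derivative in the direction $X$ at $x=0$ defines a bounded operator on $\mathcal A$. Let $J$ be a skew-symmetric operator on $V$. Let $S(V;\mathcal A)$ be the Fréchet space of $\mathcal A$-valued Schwartz functions on $V$, and $\hat f(y)=\int_V f(x)e(-x\cdot y)\,dx$. Let $\mathcal A_J$ be the space $\mathcal A$ with Rieffel's deformed product $$a\times_J b=\int_{V\times V}\alpha_{Jx}(a)\alpha_y(b)e(x\cdot y)\,dx\,dy$$ (an oscillatory integral), and let $\alpha^J$ be the action $\alpha$ considered on $\mathcal A_J$. The smooth crossed products $V\ltimes_\alpha\mathcal A$ and $V\ltimes_{\alpha^J}\mathcal A_J$ are the space $S(V;\mathcal A)$ with the product $$(f*g)(x)=\int_V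 f(y)\,\alpha_y(g(x-y))\,dy,$$ where the values of the functions are multiplied in $\mathcal A$ and in $\mathcal A_J$, respectively. For $a\in\mathcal A$ and $\xi\in S(V;\mathcal A)$ put $$(\pi(a)\xi)(x)=\alpha_{-x}(a)\xi(x),\qquad (\pi_J(a)\xi)(x)=\int_{V\times V}\alpha_{Jy-x}(a)\,\xi(x-z)\,e(y\cdot z)\,dy\,dz$$ (the latter integral being oscillatory), and, with $(\lambda_z\xi)(x)=\xi(x-z)$, define for $f,\xi\in S(V;\mathcal A)$ $$(\pi(f)\xi)(x)=\int_V\big(\pi(f(z))\lambda_z\xi\big)(x)\,dz,\qquad (\pi_J(f)\xi)(x)=\int_V\big(\pi_J(f(z))\lambda_z\xi\big)(x)\,dz .$$ Finally put $\Theta_J(f)(x)=\int_V\alpha_{Jy}(\hat f(y))\,e(x\cdot y)\,dy$. Then all these integrals converge, the products of $V\ltimes_\alpha\mathcal A$ and $V\ltimes_{\alpha^J}\mathcal A_J$ and the operators $\pi(f)$, $\pi_J(a)$, $\pi_J(f)$ and $\Theta_J$ take values in $S(V;\mathcal A)$, and $$\pi_J(f)=\pi(\Theta_J(f))\quad\text{for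 every } f\in S(V;\mathcal A).$$ Moreover, $\Theta_J$ is an isomorphism of $V\ltimes_{\alpha^J}\mathcal A_J$ onto $V\ltimes_\alpha\mathcal A$, that is, a multiplicative linear homeomorphism of $S(V;\mathcal A)$ onto itself, and its inverse is $\Theta_{-J}$. -/

import Mathlib

open MeasureTheory Filter Topology
open scoped SchwartzMap

noncomputable section

namespace RieffelCrossed

/-! ### Integrals with values in a locally convex space -/

section Integral

variable {X : Type*} [MeasurableSpace X]
variable {A : Type*} [AddCommGroup A] [Module ℂ A] [TopologicalSpace A]

/-- `v` is the absolutely convergent (weak) integral of `f : X → A`: every continuous seminorm of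
`f` is integrable, and `φ v = ∫ φ (f x) dμ(x)` for every continuous linear functional `φ`.
In a Hausdorff locally convex space such a `v` is unique. -/
def HasVIntegral (μ : Measure X) (f : X → A) (v : A) : Prop :=
  (∀ p : Seminorm ℂ A, Continuous p → Integrable (fun x => p (f x)) μ) ∧
    ∀ φ : A →L[ℂ] ℂ, Integrable (fun x => φ (f x)) μ ∧ ∫ x, φ (f x) ∂μ = φ v

/-- The integral of `f` converges absolutely in `A`. -/
def VIntegrable (μ : Measure X) (f : X → A) : Prop := ∃ v, HasVIntegral μ f v

open Classical in
/-- The integral of an `A`-valued function (with value `0` when it does not converge). -/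
def vIntegral (μ : Measure X) (f : X → A) : A :=
  if h : VIntegrable μ f then h.choose else 0

end Integral

/-! ### Schwartz functions with values in a topological vector space -/

section Schwartz

variable {V : Type*} [NormedAddCommGroup V] [InnerProductSpace ℝ V]
variable {A : Type*} [AddCommGroup A] [Module ℂ A] [TopologicalSpace A]

/-- `d` is the derivative of `f` at `x` in the direction `v`. -/
def HasDirDeriv (f : V → A) (d : A) (x v : V) : Prop :=
  Tendsto (fun t : ℝ => ((t : ℂ)⁻¹) • (f (x + t • v) - f x)) (𝓝[≠] 0) (𝓝 d)

/-- The derivative of `f` in the direction `v`, as a function of the point. -/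
def dirDeriv (v : V) (f : V → A) (x : V) : A :=
  limUnder (𝓝[≠] 0) (fun t : ℝ => ((t : ℂ)⁻¹) • (f (x + t • v) - f x))

/-- Iterated directional derivatives. -/
def iterDirDeriv : List V → (V → A) → V → A
  | [], f => f
  | v :: l, f => dirDeriv v (iterDirDeriv l f)

/-- `f : V → A` is a Schwartz function: all iterated directional derivatives of `f` exist, are
continuous, and decay faster than any power of `‖x‖` in every continuous seminorm. -/
structure IsSchwartz (f : V → A) : Prop where
  continuous : ∀ l : List V, Continuous (iterDirDeriv l f)
  hasDirDeriv : ∀ (l : List V) (x v : V),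
    HasDirDeriv (iterDirDeriv l f) (iterDirDeriv (v :: l) f x) x v
  decay : ∀ (l : List V) (k : ℕ) (p : Seminorm ℂ A), Continuous p →
    ∃ C : ℝ, ∀ x, ‖x‖ ^ k * p (iterDirDeriv l f x) ≤ C

theorem HasDirDeriv.dirDeriv_eq [T2Space A] {f : V → A} {d : A} {x v : V}
    (h : HasDirDeriv f d x v) : dirDeriv v f x = d :=
  Tendsto.limUnder_eq h

theorem HasDirDeriv.add [ContinuousAdd A] {f g : V → A} {d e : A} {x v : V}
    (hf : HasDirDeriv f d x v) (hg : HasDirDeriv g e x v) :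
    HasDirDeriv (f + g) (d + e) x v := by
  refine (Tendsto.add hf hg).congr fun t => ?_
  simp only [Pi.add_apply, ← smul_add]
  congr 1
  abel

theorem HasDirDeriv.const_smul [ContinuousConstSMul ℂ A] {f : V → A} {d : A} {x v : V} (c : ℂ)
    (hf : HasDirDeriv f d x v) : HasDirDeriv (c • f) (c • d) x v := by
  refine (Tendsto.const_smul hf c).congr fun t => ?_
  simp only [Pi.smul_apply, ← smul_sub]
  exact smul_comm _ _ _

theorem hasDirDeriv_zero (x v : V) : HasDirDeriv (0 : V → A) 0 x v := by
  simp only [HasDirDeriv, Pi.zero_apply, sub_self, smul_zero]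
  exact tendsto_const_nhds

theorem iterDirDeriv_zero [T2Space A] (l : List V) : iterDirDeriv l (0 : V → A) = 0 := by
  induction l with
  | nil => rfl
  | cons v l ih =>
    funext x
    simp only [iterDirDeriv, ih]
    exact (hasDirDeriv_zero x v).dirDeriv_eq

theorem IsSchwartz.iterDirDeriv_add [T2Space A] [ContinuousAdd A] {f g : V → A}
    (hf : IsSchwartz f) (hg : IsSchwartz g) (l : List V) :
    iterDirDeriv l (f + g) = iterDirDeriv l f + iterDirDeriv l g := by
  induction l with
  | nil => rfl
  | cons v l ih =>
    funext x
    simp only [iterDirDeriv, ih]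
    exact ((hf.hasDirDeriv l x v).add (hg.hasDirDeriv l x v)).dirDeriv_eq

theorem IsSchwartz.iterDirDeriv_smul [T2Space A] [ContinuousConstSMul ℂ A] {f : V → A}
    (hf : IsSchwartz f) (c : ℂ) (l : List V) :
    iterDirDeriv l (c • f) = c • iterDirDeriv l f := by
  induction l with
  | nil => rfl
  | cons v l ih =>
    funext x
    simp only [iterDirDeriv, ih]
    exact ((hf.hasDirDeriv l x v).const_smul c).dirDeriv_eq

theorem IsSchwartz.zero [T2Space A] : IsSchwartz (0 : V → A) where
  continuous l := by
    rw [iterDirDeriv_zero]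
    exact continuous_zero
  hasDirDeriv l x v := by
    rw [iterDirDeriv_zero, iterDirDeriv_zero]
    exact hasDirDeriv_zero x v
  decay l k p _ := by
    refine ⟨0, fun x => ?_⟩
    simp [iterDirDeriv_zero]

theorem IsSchwartz.add [T2Space A] [ContinuousAdd A] {f g : V → A}
    (hf : IsSchwartz f) (hg : IsSchwartz g) : IsSchwartz (f + g) where
  continuous l := by
    rw [hf.iterDirDeriv_add hg]
    exact (hf.continuous l).add (hg.continuous l)
  hasDirDeriv l x v := by
    rw [hf.iterDirDeriv_add hg, hf.iterDirDeriv_add hg]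
    exact (hf.hasDirDeriv l x v).add (hg.hasDirDeriv l x v)
  decay l k p hp := by
    obtain ⟨C, hC⟩ := hf.decay l k p hp
    obtain ⟨D, hD⟩ := hg.decay l k p hp
    refine ⟨C + D, fun x => ?_⟩
    rw [hf.iterDirDeriv_add hg, Pi.add_apply]
    calc ‖x‖ ^ k * p (iterDirDeriv l f x + iterDirDeriv l g x)
        ≤ ‖x‖ ^ k * (p (iterDirDeriv l f x) + p (iterDirDeriv l g x)) := by
          gcongr
          exact map_add_le_add p _ _
      _ ≤ C + D := by
          rw [mul_add]
          exact add_le_add (hC x) (hD x)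

theorem IsSchwartz.smul [T2Space A] [ContinuousConstSMul ℂ A] {f : V → A} (c : ℂ)
    (hf : IsSchwartz f) : IsSchwartz (c • f) where
  continuous l := by
    rw [hf.iterDirDeriv_smul]
    exact (hf.continuous l).const_smul c
  hasDirDeriv l x v := by
    rw [hf.iterDirDeriv_smul, hf.iterDirDeriv_smul]
    exact (hf.hasDirDeriv l x v).const_smul c
  decay l k p hp := by
    obtain ⟨C, hC⟩ := hf.decay l k p hp
    refine ⟨‖c‖ * C, fun x => ?_⟩
    rw [hf.iterDirDeriv_smul, Pi.smul_apply, map_smul_eq_mul, mul_left_comm]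
    exact mul_le_mul_of_nonneg_left (hC x) (norm_nonneg c)

end Schwartz

/-! ### The space `S(V; A)` and its topology -/

section SchwartzSpace

variable (V : Type*) [NormedAddCommGroup V] [InnerProductSpace ℝ V]
variable (A : Type*) [AddCommGroup A] [Module ℂ A] [TopologicalSpace A] [T2Space A]
  [ContinuousAdd A] [ContinuousConstSMul ℂ A]

/-- The Schwartz functions as a subspace of all functions. -/
def schwartzSubmodule : Submodule ℂ (V → A) where
  carrier := {f | IsSchwartz f}
  add_mem' hf hg := IsSchwartz.add hf hg
  zero_mem' := IsSchwartz.zero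
  smul_mem' c _ hf := IsSchwartz.smul c hf

/-- The space `S(V; A)` of `A`-valued Schwartz functions on `V`. -/
def SchwartzFn : Type _ := schwartzSubmodule V A

instance : AddCommGroup (SchwartzFn V A) := inferInstanceAs (AddCommGroup (schwartzSubmodule V A))

instance : Module ℂ (SchwartzFn V A) := inferInstanceAs (Module ℂ (schwartzSubmodule V A))

instance : CoeFun (SchwartzFn V A) (fun _ => V → A) where
  coe f := f.1

variable {V A}

/-- The seminorm `f ↦ sup_x ‖x‖ ^ k * p (∂_l f x)` on `S(V; A)`. -/
def schwartzSeminorm (p : {p : Seminorm ℂ A // Continuous p}) (k : ℕ) (l : List V) :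
    Seminorm ℂ (SchwartzFn V A) :=
  Seminorm.ofSMulLE (fun f => ⨆ x : V, ‖x‖ ^ k * p.1 (iterDirDeriv l f x))
    (by
      have h : ∀ x : V, iterDirDeriv l (((0 : SchwartzFn V A)) : V → A) x = 0 := fun x =>
        congrFun (iterDirDeriv_zero (A := A) l) x
      simp [h])
    (by
      intro f g
      obtain ⟨C, hC⟩ := f.2.decay l k p.1 p.2
      obtain ⟨D, hD⟩ := g.2.decay l k p.1 p.2
      refine ciSup_le fun x => ?_
      have h : iterDirDeriv l (((f + g : SchwartzFn V A)) : V → A) x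
          = iterDirDeriv l f x + iterDirDeriv l g x :=
        congrFun (IsSchwartz.iterDirDeriv_add f.2 g.2 l) x
      have hf : ‖x‖ ^ k * p.1 (iterDirDeriv l f x)
          ≤ ⨆ x : V, ‖x‖ ^ k * p.1 (iterDirDeriv l f x) :=
        le_ciSup (f := fun x : V => ‖x‖ ^ k * p.1 (iterDirDeriv l f x))
          ⟨C, by rintro _ ⟨y, rfl⟩; exact hC y⟩ x
      have hg : ‖x‖ ^ k * p.1 (iterDirDeriv l g x)
          ≤ ⨆ x : V, ‖x‖ ^ k * p.1 (iterDirDeriv l g x) :=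
        le_ciSup (f := fun x : V => ‖x‖ ^ k * p.1 (iterDirDeriv l g x))
          ⟨D, by rintro _ ⟨y, rfl⟩; exact hD y⟩ x
      rw [h]
      calc ‖x‖ ^ k * p.1 (iterDirDeriv l f x + iterDirDeriv l g x)
          ≤ ‖x‖ ^ k * (p.1 (iterDirDeriv l f x) + p.1 (iterDirDeriv l g x)) := by
            gcongr
            exact map_add_le_add p.1 _ _
        _ ≤ _ := by
            rw [mul_add]
            exact add_le_add hf hg)
    (by
      intro c f
      obtain ⟨C, hC⟩ := f.2.decay l k p.1 p.2
      refine ciSup_le fun x => ?_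
      have h : iterDirDeriv l (((c • f : SchwartzFn V A)) : V → A) x
          = c • iterDirDeriv l f x :=
        congrFun (IsSchwartz.iterDirDeriv_smul f.2 c l) x
      have hf : ‖x‖ ^ k * p.1 (iterDirDeriv l f x)
          ≤ ⨆ x : V, ‖x‖ ^ k * p.1 (iterDirDeriv l f x) :=
        le_ciSup (f := fun x : V => ‖x‖ ^ k * p.1 (iterDirDeriv l f x))
          ⟨C, by rintro _ ⟨y, rfl⟩; exact hC y⟩ x
      rw [h, map_smul_eq_mul, mul_left_comm]
      exact mul_le_mul_of_nonneg_left hf (norm_nonneg c))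

variable (V A)

/-- The family of all the seminorms `f ↦ sup_x ‖x‖ ^ k * p (∂_l f x)`. -/
def schwartzSeminormFamily :
    SeminormFamily ℂ (SchwartzFn V A) ({p : Seminorm ℂ A // Continuous p} × ℕ × List V) :=
  fun i => schwartzSeminorm i.1 i.2.1 i.2.2

/-- The topology of `S(V; A)`. -/
instance : TopologicalSpace (SchwartzFn V A) :=
  (schwartzSeminormFamily V A).moduleFilterBasis.topology

end SchwartzSpace

/-! ### Smooth isometric actions, the deformed product and the crossed products -/

/-- A smooth isometric action of the vector group `V` by automorphisms of the algebra `A`. -/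
structure SmoothIsometricAction (V : Type*) [NormedAddCommGroup V] [InnerProductSpace ℝ V]
    (A : Type*) [NonUnitalRing A] [Module ℂ A] [TopologicalSpace A] where
  /-- the algebra endomorphisms `α_x` -/
  act : V → A →ₙₐ[ℂ] A
  act_zero : ∀ a, act 0 a = a
  act_add : ∀ x y a, act (x + y) a = act x (act y a)
  /-- the topology of `A` is defined by a sequence of `α`-invariant seminorms -/
  isometric : ∃ p : ℕ → Seminorm ℂ A, WithSeminorms p ∧ ∀ n x a, p n (act x a) = p n a
  /-- the orbit maps are differentiable -/
  differentiable : ∀ a, Differentiable ℝ (fun x => act x a)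
  /-- partial differentiation at `0` in any direction is a bounded operator -/
  bounded_deriv : ∀ v : V, ∃ D : A →L[ℂ] A, ∀ a, HasDirDeriv (fun x => act x a) (D a) 0 v

section Constructions

variable {V : Type*} [NormedAddCommGroup V] [InnerProductSpace ℝ V] [FiniteDimensional ℝ V]
  [MeasurableSpace V] [BorelSpace V]

/-- `e (x · y) = exp (2 π i ⟨x, y⟩)`. -/
def e (x y : V) : ℂ := (Real.fourierChar (inner ℝ x y) : ℂ)

section TVS

variable {A : Type*} [AddCommGroup A] [Module ℂ A] [TopologicalSpace A]

/-- `v` is the value of the oscillatory integral `∬ F x y e(x · y) dx dy`: for every Schwartz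
cut-off function `χ` on `V × V` with `χ 0 = 1`, the integrals
`∬ χ (ε x, ε y) F x y e(x · y) dx dy`, `ε > 0`, converge absolutely and tend to `v` as `ε → 0`. -/
def HasOscIntegral (F : V → V → A) (v : A) : Prop :=
  ∀ χ : 𝓢(V × V, ℂ), χ 0 = 1 → ∃ I : ℝ → A,
    (∀ ε > 0, HasVIntegral volume
      (fun q : V × V => (χ (ε • q) * e q.1 q.2) • F q.1 q.2) (I ε)) ∧
    Tendsto I (𝓝[>] 0) (𝓝 v)

/-- The oscillatory integral of `F` converges. -/
def OscIntegrable (F : V → V → A) : Prop := ∃ v, HasOscIntegral F v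

open Classical in
/-- The oscillatory integral `∬ F x y e(x · y) dx dy` (`0` when it does not converge). -/
def oscIntegral (F : V → V → A) : A :=
  if h : OscIntegrable F then h.choose else 0

/-- The Fourier transform `y ↦ ∫ f(x) e(-x · y) dx`. -/
def fourier (f : V → A) (y : V) : A :=
  vIntegral volume (fun x => e (-x) y • f x)

/-- Left translation: `(λ_z ξ)(x) = ξ (x - z)`. -/
def leftTranslate (z : V) (ξ : V → A) (x : V) : A := ξ (x - z)

/-- The integrated form `(ρ(f) ξ)(x) = ∫ (ρ(f(z)) (λ_z ξ))(x) dz` of a family of operators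
`ρ(a)`, `a ∈ A`, together with the translations `λ_z`. -/
def integratedRep (ρ : A → (V → A) → V → A) (f ξ : V → A) (x : V) : A :=
  vIntegral volume (fun z => ρ (f z) (leftTranslate z ξ) x)

end TVS

variable {A : Type*} [NonUnitalRing A] [Module ℂ A] [TopologicalSpace A]

/-- The deformed product `a ×_J b = ∬ α_{Jx}(a) α_y(b) e(x · y) dx dy` of elements of `A`; the
space `A` with this product is the deformed algebra `A_J`. -/
def rieffelMul (α : SmoothIsometricAction V A) (J : V →ₗ[ℝ] V) (a b : A) : A :=
  oscIntegral (fun x y => α.act (J x) a * α.act y b)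

/-- The deformed product of `A`-valued functions on `V`, for the action of `V` by left
translations. -/
def rieffelMulFun (J : V →ₗ[ℝ] V) (F G : V → A) (x : V) : A :=
  oscIntegral (fun y z => leftTranslate (J y) F x * leftTranslate z G x)

/-- The function `α(a)(x) = α_{-x}(a)`. -/
def orbitFun (α : SmoothIsometricAction V A) (a : A) (x : V) : A := α.act (-x) a

/-- The product `(f * g)(x) = ∫ f(y) α_y(g(x - y)) dy` of the smooth crossed product by `α` of
the space `A` with the product `m`. For `m` the product of `A` this is `V ⋉_α A`, and for
`m = ×_J` this is `V ⋉_{α^J} A_J`. -/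
def crossedMul (m : A → A → A) (α : SmoothIsometricAction V A) (f g : V → A) (x : V) : A :=
  vIntegral volume (fun y => m (f y) (α.act y (g (x - y))))

/-- The operators `(π(a) ξ)(x) = α_{-x}(a) ξ(x)`. -/
def piOp (α : SmoothIsometricAction V A) (a : A) (ξ : V → A) (x : V) : A :=
  orbitFun α a x * ξ x

/-- The operators `π_J(a) ξ = α(a) ×_J ξ`. -/
def piOpJ (α : SmoothIsometricAction V A) (J : V →ₗ[ℝ] V) (a : A) (ξ : V → A) : V → A :=
  rieffelMulFun J (orbitFun α a) ξ

/-- `Θ_J(f)(x) = ∫ α_{Jy}(f̂(y)) e(x · y) dy`. -/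
def theta (α : SmoothIsometricAction V A) (J : V →ₗ[ℝ] V) (f : V → A) (x : V) : A :=
  vIntegral volume (fun y => e x y • α.act (J y) (fourier f y))

end Constructions

end RieffelCrossed

end

/-! Write `ξ̂` for the Fourier transform of `ξ`. Carrying out the `z`-integral first in the
oscillatory integral that defines `π_J(a)` gives `π_J(a)ξ(x) = ∫ e(x·y) α_{Jy-x}(a) ξ̂(y) dy`
(`piOpJ_eq_vIntegral`); for `J = 0` this is Fourier inversion for `π(a)ξ`. Translating `ξ` by `z`
multiplies `ξ̂(y)` by `e(-z·y)`, so integrating over `z` replaces the coefficient `f(z)` by `f̂(y)`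
(`vIntegral_orbitKernel_swap`), and `π_J(f)ξ(x) = ∫ e(x·y) α_{Jy-x}(f̂(y)) ξ̂(y) dy`. The Fourier
transform of `Θ_J(f)` is `α_{Jy}(f̂(y))` (`fourier_theta`), so the same integral computes
`π(Θ_J(f))ξ(x)`. On the Fourier side it is also clear that `Θ_{-J}` inverts `Θ_J`.

Multiplicativity is proved directly, without using faithfulness of `π`. Its engine is the identity
`∫ f(y) ×_J α_y(b) dy = ∫ Θ_J(f)(z) α_z(b) dz` (`vIntegral_rieffelMul_act`): replacing `z` by `z -
y` in the oscillatory integral of the left side produces the phase `e(x·z) e(-x·y)`, whose second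
factor turns `f` into `f̂(x)`; the result decays in `x`, and its `x`-integral is `Θ_J(f)(z)`. For
either product, the Fourier transform of `f * g` at `k` is the integral over `y` of the product of
`e(-y·k) f(y)` and `α_y(ĝ(k))` (`fourier_crossedMul`). Applying `α_{Jk}`, which respects `×_J`
(`rieffelMul_act`), then the engine and the compatibility of `Θ_J` with modulations
(`theta_modulate`), one obtains the Fourier transform of `Θ_J(f) * Θ_J(g)` (`theta_crossedMul`).

Two devices carry the analysis. Integrals in `A` are Bochner integrals in the Banach completions for
the continuous seminorms, glued by completeness of `A` (`exists_toCompl_eq_of_compatible`).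
Oscillatory integrals are rewritten as absolutely convergent ones by a partition into translates of
a bump of integral one: near `σ` the quadratic phase is linear with frequency of size `‖σ‖`, up to a
fixed factor, and integration by parts gives an integrable power of `‖σ‖`
(`exists_norm_oscInner_le`). The bound uses only finitely many derivatives of the amplitude, so
cut-offs can be removed by dominated convergence. Membership in `S(V; A)` follows by exhibiting
families of bounded functions stable under derivatives and coordinate multiplications
(`isSchwartz_of_span`). -/

noncomputable section

namespace RieffelCrossed

set_option linter.unusedSectionVars false

/-! ### The Banach space of a seminorm -/

section Completion

variable {A : Type*} [AddCommGroup A] [Module ℂ A]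

/-- The space `A` with the topology of a single seminorm. -/
def SeminormSpace (_p : Seminorm ℂ A) : Type _ := A

instance (p : Seminorm ℂ A) : SeminormedAddCommGroup (SeminormSpace p) :=
  p.toAddGroupSeminorm.toSeminormedAddCommGroup

instance (p : Seminorm ℂ A) : Module ℂ (SeminormSpace p) := inferInstanceAs (Module ℂ A)

instance (p : Seminorm ℂ A) : NormedSpace ℂ (SeminormSpace p) where
  norm_smul_le c a := (map_smul_eq_mul p c a).le

/-- The completion of `A` with respect to a seminorm. -/
def SeminormCompletion (p : Seminorm ℂ A) : Type _ :=
  UniformSpace.Completion (SeminormSpace p)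

instance (p : Seminorm ℂ A) : NormedAddCommGroup (SeminormCompletion p) :=
  inferInstanceAs (NormedAddCommGroup (UniformSpace.Completion (SeminormSpace p)))

instance (p : Seminorm ℂ A) : NormedSpace ℂ (SeminormCompletion p) :=
  inferInstanceAs (NormedSpace ℂ (UniformSpace.Completion (SeminormSpace p)))

instance (p : Seminorm ℂ A) : CompleteSpace (SeminormCompletion p) :=
  inferInstanceAs (CompleteSpace (UniformSpace.Completion (SeminormSpace p)))

/-- The canonical map of `A` to its completion with respect to `p`. -/
def toCompl (p : Seminorm ℂ A) : A →ₗ[ℂ] SeminormCompletion p :=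
  (UniformSpace.Completion.toComplL (𝕜 := ℂ) (E := SeminormSpace p)).toLinearMap

theorem norm_toCompl (p : Seminorm ℂ A) (a : A) : ‖toCompl p a‖ = p a :=
  UniformSpace.Completion.norm_coe (E := SeminormSpace p) a

theorem denseRange_toCompl (p : Seminorm ℂ A) : DenseRange (toCompl p) :=
  UniformSpace.Completion.denseRange_coe (α := SeminormSpace p)

theorem exists_extend_toCompl {F : Type*} [NormedAddCommGroup F] [NormedSpace ℂ F]
    [CompleteSpace F] (p : Seminorm ℂ A) (f : A →ₗ[ℂ] F) (C : ℝ)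
    (h : ∀ a, ‖f a‖ ≤ C * p a) : ∃ g : SeminormCompletion p →L[ℂ] F, ∀ a, g (toCompl p a) = f a :=
  ⟨f.extendOfNorm (toCompl p), fun a =>
    LinearMap.extendOfNorm_eq (denseRange_toCompl p) ⟨C, fun x => by rw [norm_toCompl]; exact h x⟩ a⟩

theorem exists_map_toCompl {B : Type*} [AddCommGroup B] [Module ℂ B] (p : Seminorm ℂ A)
    (q : Seminorm ℂ B) (T : A →ₗ[ℂ] B) (h : ∀ a, q (T a) ≤ p a) :
    ∃ g : SeminormCompletion p →L[ℂ] SeminormCompletion q,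
      ∀ a, g (toCompl p a) = toCompl q (T a) :=
  exists_extend_toCompl p ((toCompl q).comp T) 1 fun a => by
    simpa [norm_toCompl] using h a

variable [TopologicalSpace A] [IsTopologicalAddGroup A]

theorem continuous_toCompl {p : Seminorm ℂ A} (hp : Continuous p) : Continuous (toCompl p) := by
  refine continuous_of_continuousAt_zero (toCompl p) ?_
  rw [ContinuousAt, map_zero, tendsto_zero_iff_norm_tendsto_zero]
  simp only [norm_toCompl]
  simpa using hp.tendsto 0

variable [PolynormableSpace ℂ A]

theorem tendsto_iff_seminorm {ι : Type*} {l : Filter ι} {u : ι → A} {a : A} :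
    Tendsto u l (𝓝 a) ↔
      ∀ p : Seminorm ℂ A, Continuous p → Tendsto (fun i => p (u i - a)) l (𝓝 0) := by
  constructor
  · intro h p hp
    have := (hp.tendsto 0).comp (tendsto_sub_nhds_zero_iff.mpr h)
    rwa [map_zero] at this
  · intro h
    rw [(PolynormableSpace.withSeminorms ℂ A).tendsto_nhds]
    intro p ε hε
    exact (h p.1 p.2).eventually_lt_const hε

/-- The transfer principle: `toCompl p` is isometric for `p` and the continuous seminorms define the
topology, so limits, derivatives and equalities in `A` can be tested in Banach spaces. -/
theorem tendsto_iff_toCompl {ι : Type*} {l : Filter ι} {u : ι → A} {a : A} :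
    Tendsto u l (𝓝 a) ↔ ∀ p : Seminorm ℂ A, Continuous p →
      Tendsto (fun i => toCompl p (u i)) l (𝓝 (toCompl p a)) := by
  rw [tendsto_iff_seminorm]
  refine forall₂_congr fun p _ => ?_
  rw [tendsto_iff_norm_sub_tendsto_zero (b := toCompl p a)]
  refine iff_of_eq (congrArg (fun u => Tendsto u l (𝓝 0)) (funext fun i => ?_))
  rw [← map_sub, norm_toCompl]

theorem eq_of_toCompl_eq [T2Space A] {a b : A}
    (h : ∀ p : Seminorm ℂ A, Continuous p → toCompl p a = toCompl p b) : a = b := by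
  have : Tendsto (fun _ : ℕ => a) atTop (𝓝 b) :=
    tendsto_iff_toCompl.mpr fun p hp => by rw [h p hp]; exact tendsto_const_nhds
  exact tendsto_nhds_unique tendsto_const_nhds this

end Completion

/-! ### Gluing compatible points of the completions -/

section Complete

variable {A : Type*} [AddCommGroup A] [Module ℂ A] [UniformSpace A] [IsUniformAddGroup A]
  [PolynormableSpace ℂ A]

theorem cauchy_of_seminorm {l : Filter A} [l.NeBot]
    (h : ∀ p : Seminorm ℂ A, Continuous p → ∀ ε > 0, ∃ s ∈ l, ∀ x ∈ s, ∀ y ∈ s, p (y - x) < ε) :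
    Cauchy l := by
  refine ⟨‹_›, ?_⟩
  rw [uniformity_eq_comap_nhds_zero A, ← tendsto_iff_comap]
  rw [(tendsto_iff_seminorm (u := fun q : A × A => q.2 - q.1))]
  intro p hp
  rw [Metric.tendsto_nhds]
  intro ε hε
  obtain ⟨s, hs, hsε⟩ := h p hp ε hε
  filter_upwards [prod_mem_prod hs hs] with q hq
  simpa [abs_of_nonneg (apply_nonneg p _)] using hsε _ hq.1 _ hq.2

/-- A complete `A` is the projective limit of its completions. The preimages in `A` of
neighbourhoods of the `v p` generate a filter: compatibility makes the family directed, density of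
`A` in each completion makes it proper, and it is Cauchy for every continuous seminorm. Its limit is
the required point. -/
theorem exists_toCompl_eq_of_compatible [CompleteSpace A]
    (v : ∀ p : Seminorm ℂ A, SeminormCompletion p)
    (hv : ∀ p q : Seminorm ℂ A, Continuous p → Continuous q → p ≤ q →
      ∀ g : SeminormCompletion q →L[ℂ] SeminormCompletion p,
        (∀ a, g (toCompl q a) = toCompl p a) → g (v q) = v p) :
    ∃ a : A, ∀ p : Seminorm ℂ A, Continuous p → toCompl p a = v p := by
  set l : Filter A := ⨅ p : {p : Seminorm ℂ A // Continuous p}, comap (toCompl p.1) (𝓝 (v p.1))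
    with hl
  have hmono : ∀ p q : {p : Seminorm ℂ A // Continuous p}, p.1 ≤ q.1 →
      comap (toCompl q.1) (𝓝 (v q.1)) ≤ comap (toCompl p.1) (𝓝 (v p.1)) := by
    intro p q hpq
    obtain ⟨g, hg⟩ := exists_map_toCompl q.1 p.1 LinearMap.id hpq
    have h1 := hv p.1 q.1 p.2 q.2 hpq g hg
    have h2 : (toCompl p.1 : A → _) = g ∘ toCompl q.1 := funext fun a => (hg a).symm
    rw [h2, ← comap_comap]
    refine comap_mono ?_
    rw [← tendsto_iff_comap, ← h1]
    exact g.continuous.tendsto _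
  have hne : l.NeBot := by
    have : Nonempty {p : Seminorm ℂ A // Continuous p} := ⟨⟨0, continuous_const⟩⟩
    refine iInf_neBot_of_directed ?_ fun p => ?_
    · intro p q
      have hc : Continuous (p.1 ⊔ q.1 : Seminorm ℂ A) := by
        have := p.2.sup q.2
        exact this
      exact ⟨⟨p.1 ⊔ q.1, hc⟩, hmono p _ le_sup_left, hmono q _ le_sup_right⟩
    · rw [comap_neBot_iff]
      intro t ht
      obtain ⟨a, ha⟩ := (denseRange_toCompl p.1).exists_mem_open isOpen_interior
        ⟨_, mem_interior_iff_mem_nhds.mpr ht⟩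
      exact ⟨a, interior_subset ha⟩
  have htend : ∀ p : Seminorm ℂ A, Continuous p → Tendsto (toCompl p) l (𝓝 (v p)) := fun p hp =>
    tendsto_iff_comap.mpr (iInf_le _ (⟨p, hp⟩ : {p : Seminorm ℂ A // Continuous p}))
  have hc : Cauchy l := by
    refine cauchy_of_seminorm fun p hp ε hε => ?_
    refine ⟨_, (Metric.tendsto_nhds.mp (htend p hp)) (ε / 2) (half_pos hε), fun x hx y hy => ?_⟩
    rw [← norm_toCompl, map_sub, ← dist_eq_norm]
    calc _ ≤ dist (toCompl p y) (v p) + dist (toCompl p x) (v p) := dist_triangle_right _ _ _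
      _ < ε / 2 + ε / 2 := add_lt_add hy hx
      _ = ε := add_halves ε
  obtain ⟨a, ha⟩ := CompleteSpace.complete hc
  refine ⟨a, fun p hp => ?_⟩
  exact tendsto_nhds_unique (((continuous_toCompl hp).tendsto a).mono_left ha) (htend p hp)

end Complete

/-! ### Weak integrals and Bochner integrals in the completions -/

section VInt

variable {X : Type*} [MeasurableSpace X] {μ : Measure X}
variable {A : Type*} [AddCommGroup A] [Module ℂ A]

/-- All the functions `toCompl p ∘ f`, `p` a continuous seminorm, are Bochner integrable. -/
def VInt [TopologicalSpace A] (μ : Measure X) (f : X → A) : Prop :=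
  ∀ p : Seminorm ℂ A, Continuous p → Integrable (fun x => toCompl p (f x)) μ

theorem HasVIntegral.unique [TopologicalSpace A] [IsTopologicalAddGroup A] [PolynormableSpace ℂ A]
    [T2Space A] {f : X → A} {v w : A} (hv : HasVIntegral μ f v) (hw : HasVIntegral μ f w) :
    v = w := by
  refine eq_of_toCompl_eq fun p hp => ?_
  by_contra hne
  obtain ⟨ψ, hψ⟩ := SeparatingDual.exists_separating_of_ne (R := ℂ) hne
  let φ : A →L[ℂ] ℂ := ⟨ψ.toLinearMap.comp (toCompl p), ψ.continuous.comp (continuous_toCompl hp)⟩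
  exact hψ (((hv.2 φ).2.symm.trans (hw.2 φ).2))

theorem HasVIntegral.vIntegral_eq [TopologicalSpace A] [IsTopologicalAddGroup A]
    [PolynormableSpace ℂ A] [T2Space A] {f : X → A} {v : A} (h : HasVIntegral μ f v) :
    vIntegral μ f = v := by
  have hf : VIntegrable μ f := ⟨v, h⟩
  rw [vIntegral, dif_pos hf]
  exact hf.choose_spec.unique h

/-- A continuous functional `φ` is bounded for the continuous seminorm `|φ|`, hence factors through
that completion, where it commutes with the Bochner integral. -/
theorem hasVIntegral_of_toCompl [TopologicalSpace A] [ContinuousConstSMul ℂ A]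
    {f : X → A} {v : A} (h : VInt μ f)
    (hv : ∀ p : Seminorm ℂ A, Continuous p → ∫ x, toCompl p (f x) ∂μ = toCompl p v) :
    HasVIntegral μ f v := by
  refine ⟨fun p hp => ?_, fun φ => ?_⟩
  · simpa only [norm_toCompl] using (h p hp).norm
  · let p : Seminorm ℂ A := (normSeminorm ℂ ℂ).comp φ.toLinearMap
    have hp : Continuous p := φ.continuous.norm
    obtain ⟨g, hg⟩ := exists_extend_toCompl p φ.toLinearMap 1 fun a => by
      rw [one_mul]; exact le_rfl
    have hg' : ∀ a, φ a = g (toCompl p a) := fun a => (hg a).symm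
    simp only [hg']
    refine ⟨g.integrable_comp (h p hp), ?_⟩
    rw [g.integral_comp_comm (h p hp), hv p hp]

variable [UniformSpace A] [IsUniformAddGroup A] [PolynormableSpace ℂ A] [CompleteSpace A]

/-- Bounded maps between the completions commute with Bochner integrals, so the integrals in the
various completions are compatible and glue to a point of `A`. -/
theorem VInt.exists_hasVIntegral [ContinuousConstSMul ℂ A] {f : X → A} (h : VInt μ f) :
    ∃ v, (∀ p : Seminorm ℂ A, Continuous p → ∫ x, toCompl p (f x) ∂μ = toCompl p v) ∧
      HasVIntegral μ f v := by
  obtain ⟨v, hv⟩ := exists_toCompl_eq_of_compatible (fun p => ∫ x, toCompl p (f x) ∂μ)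
    (fun p q hp hq hpq g hg => by
      rw [← g.integral_comp_comm (h q hq)]
      simp only [hg])
  exact ⟨v, fun p hp => (hv p hp).symm, hasVIntegral_of_toCompl h fun p hp => (hv p hp).symm⟩

variable [ContinuousConstSMul ℂ A]

theorem VInt.vIntegrable {f : X → A} (h : VInt μ f) : VIntegrable μ f :=
  let ⟨v, hv⟩ := h.exists_hasVIntegral
  ⟨v, hv.2⟩

variable [T2Space A]

theorem VInt.hasVIntegral {f : X → A} (h : VInt μ f) : HasVIntegral μ f (vIntegral μ f) := by
  obtain ⟨v, -, hv⟩ := h.exists_hasVIntegral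
  rwa [hv.vIntegral_eq]

theorem VInt.toCompl_vIntegral {f : X → A} (h : VInt μ f) {p : Seminorm ℂ A} (hp : Continuous p) :
    toCompl p (vIntegral μ f) = ∫ x, toCompl p (f x) ∂μ := by
  obtain ⟨v, hv, hv'⟩ := h.exists_hasVIntegral
  rw [hv'.vIntegral_eq, hv p hp]

theorem VInt.seminorm_vIntegral_le {f : X → A} (h : VInt μ f) {p : Seminorm ℂ A}
    (hp : Continuous p) : p (vIntegral μ f) ≤ ∫ x, p (f x) ∂μ := by
  rw [← norm_toCompl, h.toCompl_vIntegral hp]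
  simpa only [norm_toCompl] using norm_integral_le_integral_norm (μ := μ) fun x => toCompl p (f x)

end VInt

/-! ### Line derivatives -/

section LineDer

variable {W : Type*} [AddCommGroup W] [Module ℝ W]
variable {A : Type*} [AddCommGroup A] [Module ℂ A] [TopologicalSpace A]

/-- `d` is the derivative of `f` at `x` in the direction `u`, for a function on a vector space. -/
def HasLineDer (f : W → A) (d : A) (x u : W) : Prop :=
  Tendsto (fun t : ℝ => ((t : ℂ)⁻¹) • (f (x + t • u) - f x)) (𝓝[≠] 0) (𝓝 d)

theorem hasLineDer_iff_hasLineDerivAt {E : Type*} [NormedAddCommGroup E] [NormedSpace ℂ E]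
    {f : W → E} {d : E} {x u : W} : HasLineDer f d x u ↔ HasLineDerivAt ℝ f d x u := by
  rw [hasLineDerivAt_iff_tendsto_slope_zero, HasLineDer]
  refine iff_of_eq (congrArg (fun g => Tendsto g _ _) (funext fun t => ?_))
  rw [← Complex.ofReal_inv, Complex.coe_smul]

theorem hasLineDer_iff_toCompl [IsTopologicalAddGroup A] [PolynormableSpace ℂ A]
    {f : W → A} {d : A} {x u : W} :
    HasLineDer f d x u ↔ ∀ p : Seminorm ℂ A, Continuous p →
      HasLineDerivAt ℝ (fun x => toCompl p (f x)) (toCompl p d) x u := by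
  rw [HasLineDer, tendsto_iff_toCompl]
  refine forall₂_congr fun p _ => ?_
  rw [← hasLineDer_iff_hasLineDerivAt, HasLineDer]
  simp only [map_smul, map_sub]

theorem HasLineDer.const (a : A) (x u : W) : HasLineDer (fun _ => a) 0 x u := by
  simp only [HasLineDer, sub_self, smul_zero]
  exact tendsto_const_nhds

theorem HasLineDer.add [ContinuousAdd A] {f g : W → A} {d e : A} {x u : W}
    (hf : HasLineDer f d x u) (hg : HasLineDer g e x u) :
    HasLineDer (fun x => f x + g x) (d + e) x u := by
  refine (Tendsto.add hf hg).congr fun t => ?_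
  simp only [← smul_add]
  congr 1
  abel

theorem HasLineDer.const_smul [ContinuousConstSMul ℂ A] {f : W → A} {d : A} {x u : W}
    (hf : HasLineDer f d x u) (c : ℂ) : HasLineDer (fun x => c • f x) (c • d) x u := by
  refine (Tendsto.const_smul hf c).congr fun t => ?_
  simp only [← smul_sub]
  exact smul_comm _ _ _

theorem HasLineDer.smul_direction [ContinuousConstSMul ℂ A] {f : W → A} {d : A} {x u : W}
    (hf : HasLineDer f d x u) {c : ℝ} (hc : c ≠ 0) :
    HasLineDer f ((c : ℂ) • d) x (c • u) := by
  have h0 : Tendsto (fun t : ℝ => t * c) (𝓝[≠] 0) (𝓝[≠] 0) := by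
    refine tendsto_nhdsWithin_iff.mpr ⟨?_, ?_⟩
    · exact ((continuous_mul_const c).tendsto' 0 0 (zero_mul c)).mono_left nhdsWithin_le_nhds
    · filter_upwards [self_mem_nhdsWithin] with t ht using mul_ne_zero ht hc
  refine ((hf.comp h0).const_smul (c : ℂ)).congr fun t => ?_
  simp only [Function.comp, smul_smul, Complex.ofReal_mul, mul_inv_rev]
  rw [mul_inv_cancel_left₀ (Complex.ofReal_ne_zero.mpr hc)]

theorem HasLineDer.clm {B : Type*} [AddCommGroup B] [Module ℂ B] [TopologicalSpace B]
    {f : W → A} {d : A} {x u : W} (hf : HasLineDer f d x u) (T : A →L[ℂ] B) :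
    HasLineDer (fun x => T (f x)) (T d) x u := by
  refine ((T.continuous.tendsto d).comp hf).congr fun t => ?_
  simp only [Function.comp, map_smul, map_sub]

theorem HasLineDer.comp_linear {W' : Type*} [AddCommGroup W'] [Module ℝ W'] {f : W → A} {d : A}
    {x u : W'} (L : W' →ₗ[ℝ] W) (c : W) (hf : HasLineDer f d (L x + c) (L u)) :
    HasLineDer (fun x => f (L x + c)) d x u := by
  refine Tendsto.congr (fun t => ?_) hf
  simp only [map_add, map_smul, add_right_comm]

theorem HasLineDer.comp_add_right {f : W → A} {d : A} {x u : W} (c : W)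
    (hf : HasLineDer f d (x + c) u) : HasLineDer (fun x => f (x + c)) d x u :=
  HasLineDer.comp_linear LinearMap.id c hf

theorem HasLineDer.tendsto [ContinuousSMul ℂ A] [IsTopologicalAddGroup A] {f : W → A} {d : A}
    {x u : W} (hf : HasLineDer f d x u) :
    Tendsto (fun t : ℝ => f (x + t • u)) (𝓝[≠] 0) (𝓝 (f x)) := by
  have h0 : Tendsto (fun t : ℝ => (t : ℂ)) (𝓝[≠] 0) (𝓝 0) :=
    (Complex.continuous_ofReal.tendsto' 0 0 rfl).mono_left nhdsWithin_le_nhds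
  have h1 : Tendsto (fun t : ℝ => (t : ℂ) • ((t : ℂ)⁻¹) • (f (x + t • u) - f x) + f x)
      (𝓝[≠] 0) (𝓝 ((0 : ℂ) • d + f x)) := (h0.smul hf).add tendsto_const_nhds
  rw [zero_smul, zero_add] at h1
  refine h1.congr' ?_
  filter_upwards [self_mem_nhdsWithin] with t ht
  rw [smul_smul, mul_inv_cancel₀ (Complex.ofReal_ne_zero.mpr ht), one_smul, sub_add_cancel]

/-- The Leibniz rule for a jointly continuous bilinear operation. -/
theorem HasLineDer.bilin {B C : Type*} [AddCommGroup B] [Module ℂ B] [TopologicalSpace B]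
    [AddCommGroup C] [Module ℂ C] [TopologicalSpace C] [ContinuousAdd C] [ContinuousSMul ℂ A]
    [IsTopologicalAddGroup A]
    (m : A →ₗ[ℂ] B →ₗ[ℂ] C) (hm : Continuous fun q : A × B => m q.1 q.2)
    {f : W → A} {g : W → B} {d : A} {e : B} {x u : W}
    (hf : HasLineDer f d x u) (hg : HasLineDer g e x u) :
    HasLineDer (fun x => m (f x) (g x)) (m d (g x) + m (f x) e) x u := by
  -- The increment splits as `m(Δf, g(x)) + m(f(x + tu), Δg)`; the second term only needs continuity
  -- of `f` along the line.
  have h1 := (hm.tendsto (d, g x)).comp (hf.prodMk_nhds (tendsto_const_nhds (x := g x)))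
  have h2 := (hm.tendsto (f x, e)).comp (hf.tendsto.prodMk_nhds hg)
  refine (h1.add h2).congr fun t => ?_
  simp only [Function.comp, map_smul, map_sub, LinearMap.smul_apply, LinearMap.sub_apply,
    ← smul_add]
  congr 1
  abel

theorem HasLineDer.unique [T2Space A] {f : W → A} {d e : A} {x u : W}
    (h : HasLineDer f d x u) (h' : HasLineDer f e x u) : d = e :=
  tendsto_nhds_unique h h'

end LineDer

/-! ### Calculus of integrals -/

section Calculus

variable {X : Type*} [MeasurableSpace X] {μ : Measure X}
variable {A : Type*} [AddCommGroup A] [Module ℂ A] [UniformSpace A] [IsUniformAddGroup A]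
  [PolynormableSpace ℂ A]

theorem VInt.of_bound [TopologicalSpace X] [OpensMeasurableSpace X] [SecondCountableTopology X]
    {f : X → A} (hf : Continuous f) (h : ∀ p : Seminorm ℂ A, Continuous p →
      ∃ g : X → ℝ, Integrable g μ ∧ ∀ x, p (f x) ≤ g x) : VInt μ f := by
  intro p hp
  obtain ⟨g, hg, hfg⟩ := h p hp
  refine hg.mono' ((continuous_toCompl hp).comp hf).aestronglyMeasurable (ae_of_all _ fun x => ?_)
  exact (norm_toCompl p (f x)).trans_le (hfg x)

theorem VInt.integrable_seminorm {f : X → A} (hf : VInt μ f) {p : Seminorm ℂ A}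
    (hp : Continuous p) : Integrable (fun x => p (f x)) μ := by
  simpa only [norm_toCompl] using (hf p hp).norm

theorem VInt.add {f g : X → A} (hf : VInt μ f) (hg : VInt μ g) : VInt μ (fun x => f x + g x) := by
  intro p hp
  simp only [map_add]
  exact (hf p hp).add (hg p hp)

section CLM

variable {B : Type*} [AddCommGroup B] [Module ℂ B] [UniformSpace B] [IsUniformAddGroup B]
  [PolynormableSpace ℂ B]

theorem VInt.clm {f : X → A} (hf : VInt μ f) (T : A →L[ℂ] B) : VInt μ (fun x => T (f x)) := by
  intro p hp
  obtain ⟨g, hg⟩ := exists_map_toCompl (p.comp T.toLinearMap) p T.toLinearMap fun a => le_rfl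
  have hg' : ∀ a, toCompl p (T a) = g (toCompl _ a) := fun a => (hg a).symm
  simp only [hg']
  exact g.integrable_comp (hf _ (hp.comp T.continuous))

variable [CompleteSpace A] [CompleteSpace B] [T2Space A] [T2Space B] [ContinuousConstSMul ℂ A]
  [ContinuousConstSMul ℂ B]

theorem VInt.vIntegral_clm {f : X → A} (hf : VInt μ f) (T : A →L[ℂ] B) :
    vIntegral μ (fun x => T (f x)) = T (vIntegral μ f) := by
  refine eq_of_toCompl_eq fun p hp => ?_
  obtain ⟨g, hg⟩ := exists_map_toCompl (p.comp T.toLinearMap) p T.toLinearMap fun a => le_rfl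
  have hg' : ∀ a, toCompl p (T a) = g (toCompl _ a) := fun a => (hg a).symm
  have hq : Continuous (p.comp T.toLinearMap) := hp.comp T.continuous
  rw [(hf.clm T).toCompl_vIntegral hp, hg', hf.toCompl_vIntegral hq]
  simp only [hg']
  exact g.integral_comp_comm (hf _ hq)

end CLM

variable [CompleteSpace A] [T2Space A] [ContinuousConstSMul ℂ A]

theorem VInt.vIntegral_add {f g : X → A} (hf : VInt μ f) (hg : VInt μ g) :
    vIntegral μ (fun x => f x + g x) = vIntegral μ f + vIntegral μ g := by
  refine eq_of_toCompl_eq fun p hp => ?_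
  rw [(hf.add hg).toCompl_vIntegral hp, map_add, hf.toCompl_vIntegral hp, hg.toCompl_vIntegral hp]
  simp only [map_add]
  exact integral_add (hf p hp) (hg p hp)

theorem VInt.smul {f : X → A} (hf : VInt μ f) (c : ℂ) : VInt μ (fun x => c • f x) := by
  intro p hp
  simp only [map_smul]
  exact (hf p hp).smul c

theorem VInt.vIntegral_smul {f : X → A} (hf : VInt μ f) (c : ℂ) :
    vIntegral μ (fun x => c • f x) = c • vIntegral μ f := by
  refine eq_of_toCompl_eq fun p hp => ?_
  rw [(hf.smul c).toCompl_vIntegral hp, map_smul, hf.toCompl_vIntegral hp]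
  simp only [map_smul]
  exact integral_smul c _

theorem tendsto_vIntegral {ι : Type*} {l : Filter ι} [l.IsCountablyGenerated] {F : ι → X → A}
    {f : X → A} (hF : ∀ i, VInt μ (F i)) (hf : VInt μ f)
    (hb : ∀ p : Seminorm ℂ A, Continuous p → ∃ g : X → ℝ, Integrable g μ ∧
      ∀ᶠ i in l, ∀ x, p (F i x) ≤ g x)
    (h : ∀ x, Tendsto (fun i => F i x) l (𝓝 (f x))) :
    Tendsto (fun i => vIntegral μ (F i)) l (𝓝 (vIntegral μ f)) := by
  rw [tendsto_iff_toCompl]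
  intro p hp
  simp only [(hF _).toCompl_vIntegral hp, hf.toCompl_vIntegral hp]
  obtain ⟨g, hg, hgb⟩ := hb p hp
  refine tendsto_integral_filter_of_dominated_convergence g
    (Eventually.of_forall fun i => (hF i p hp).aestronglyMeasurable) ?_ hg
    (ae_of_all _ fun x => ((continuous_toCompl hp).tendsto _).comp (h x))
  filter_upwards [hgb] with i hi
  refine ae_of_all _ fun x => ?_
  rw [norm_toCompl]
  exact hi x

theorem continuous_vIntegral {Y : Type*} [TopologicalSpace Y] [FirstCountableTopology Y]
    {F : Y → X → A} (hF : ∀ y, VInt μ (F y)) (hc : ∀ x, Continuous fun y => F y x)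
    (hb : ∀ p : Seminorm ℂ A, Continuous p → ∃ g : X → ℝ, Integrable g μ ∧ ∀ y x, p (F y x) ≤ g x) :
    Continuous fun y => vIntegral μ (F y) := by
  rw [continuous_iff_continuousAt]
  refine fun y => tendsto_vIntegral hF (hF y) (fun p hp => ?_) fun x => (hc x).tendsto y
  obtain ⟨g, hg, hgb⟩ := hb p hp
  exact ⟨g, hg, Eventually.of_forall hgb⟩

theorem hasLineDer_vIntegral {W : Type*} [AddCommGroup W] [Module ℝ W] {F F' : W → X → A} {u : W}
    (hF : ∀ w, VInt μ (F w)) (hF' : ∀ w, VInt μ (F' w))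
    (hd : ∀ w x, HasLineDer (fun w => F w x) (F' w x) w u)
    (hb : ∀ p : Seminorm ℂ A, Continuous p →
      ∃ g : X → ℝ, Integrable g μ ∧ ∀ w x, p (F' w x) ≤ g x) (w : W) :
    HasLineDer (fun w => vIntegral μ (F w)) (vIntegral μ (F' w)) w u := by
  rw [hasLineDer_iff_toCompl]
  intro p hp
  simp only [(hF _).toCompl_vIntegral hp, (hF' _).toCompl_vIntegral hp]
  obtain ⟨g, hg, hgb⟩ := hb p hp
  -- Differentiation under the integral needs the derivative at every point of the line, not only at
  -- `t = 0`, so the hypothesis is moved to `w + t • u`.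
  have hd' : ∀ x, ∀ t : ℝ, HasDerivAt (fun t : ℝ => toCompl p (F (w + t • u) x))
      (toCompl p (F' (w + t • u) x)) t := by
    intro x t
    have h := hasLineDer_iff_toCompl.mp (hd (w + t • u) x) p hp
    have h' : HasDerivAt (fun s : ℝ => toCompl p (F (w + t • u + s • u) x))
      (toCompl p (F' (w + t • u) x)) (t - t) := by rw [sub_self]; exact h
    have := h'.comp_sub_const t t
    refine this.congr_of_eventuallyEq (Eventually.of_forall fun s => ?_)
    simp only
    rw [add_assoc, ← add_smul, add_sub_cancel]
  have := (hasDerivAt_integral_of_dominated_loc_of_deriv_le (μ := μ) (𝕜 := ℝ) (x₀ := 0)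
    (F := fun t x => toCompl p (F (w + t • u) x)) (F' := fun t x => toCompl p (F' (w + t • u) x))
    (bound := g) (s := Set.univ) Filter.univ_mem
    (Eventually.of_forall fun t => (hF _ p hp).aestronglyMeasurable) (hF _ p hp)
    (hF' _ p hp).aestronglyMeasurable
    (ae_of_all _ fun x t _ => by rw [norm_toCompl]; exact hgb _ x) hg
    (ae_of_all _ fun x t _ => hd' x t)).2
  simp only [zero_smul, add_zero] at this
  exact this

/-- Fubini in each completion. Integrability of every slice, and not just of almost every one, is
required because `vIntegral` takes a default value otherwise. -/
theorem vIntegral_swap {Y : Type*} [MeasurableSpace Y] {ν : Measure Y} [SFinite μ] [SFinite ν]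
    {F : X → Y → A} (hF : VInt (μ.prod ν) fun q : X × Y => F q.1 q.2)
    (h1 : ∀ x, VInt ν (F x)) (h2 : ∀ y, VInt μ fun x => F x y) :
    VInt μ (fun x => vIntegral ν (F x)) ∧ VInt ν (fun y => vIntegral μ fun x => F x y) ∧
    vIntegral μ (fun x => vIntegral ν (F x)) = vIntegral ν fun y => vIntegral μ fun x => F x y := by
  have hx : VInt μ (fun x => vIntegral ν (F x)) := by
    intro p hp
    simp only [(h1 _).toCompl_vIntegral hp]
    exact (hF p hp).integral_prod_left
  have hy : VInt ν (fun y => vIntegral μ fun x => F x y) := by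
    intro p hp
    simp only [(h2 _).toCompl_vIntegral hp]
    exact (hF p hp).integral_prod_right
  refine ⟨hx, hy, eq_of_toCompl_eq fun p hp => ?_⟩
  rw [hx.toCompl_vIntegral hp, hy.toCompl_vIntegral hp]
  simp only [(h2 _).toCompl_vIntegral hp, (h1 _).toCompl_vIntegral hp]
  exact integral_integral_swap (hF p hp)

end Calculus

/-! ### Functions with controlled derivatives along a line -/

section LineBdd

variable {W : Type*} [NormedAddCommGroup W] [NormedSpace ℝ W]
variable {A : Type*} [AddCommGroup A] [Module ℂ A] [TopologicalSpace A]

/-- The function `G` and its first `n` derivatives in the direction `u` exist, are continuous, and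
are bounded by the function `K` in the seminorm `p`. -/
def LineBdd (p : Seminorm ℂ A) (u : W) : ℕ → (W → ℝ) → (W → A) → Prop
  | 0, K, G => Continuous G ∧ ∀ w, p (G w) ≤ K w
  | n + 1, K, G => (Continuous G ∧ ∀ w, p (G w) ≤ K w) ∧
      ∃ G' : W → A, (∀ w, HasLineDer G (G' w) w u) ∧ LineBdd p u n K G'

variable {p : Seminorm ℂ A} {u : W}

theorem LineBdd.base {n : ℕ} {K : W → ℝ} {G : W → A} (h : LineBdd p u n K G) :
    Continuous G ∧ ∀ w, p (G w) ≤ K w := by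
  cases n with
  | zero => exact h
  | succ n => exact h.1

theorem LineBdd.nonneg {n : ℕ} {K : W → ℝ} {G : W → A} (h : LineBdd p u n K G) (w : W) : 0 ≤ K w :=
  (apply_nonneg p _).trans (h.base.2 w)

theorem LineBdd.of_succ {n : ℕ} {K : W → ℝ} {G : W → A} (h : LineBdd p u (n + 1) K G) :
    LineBdd p u n K G := by
  induction n generalizing G with
  | zero => exact h.1
  | succ n ih => exact ⟨h.1, h.2.choose, h.2.choose_spec.1, ih h.2.choose_spec.2⟩

theorem LineBdd.mono {n : ℕ} {K L : W → ℝ} {G : W → A} (h : LineBdd p u n K G)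
    (hKL : ∀ w, K w ≤ L w) : LineBdd p u n L G := by
  induction n generalizing G with
  | zero => exact ⟨h.1, fun w => (h.2 w).trans (hKL w)⟩
  | succ n ih =>
    obtain ⟨h0, G', hG', h1⟩ := h
    exact ⟨⟨h0.1, fun w => (h0.2 w).trans (hKL w)⟩, G', hG', ih h1⟩

theorem LineBdd.toCompl [IsTopologicalAddGroup A] [PolynormableSpace ℂ A] (hp : Continuous p)
    {n : ℕ} {K : W → ℝ} {G : W → A} (h : LineBdd p u n K G) :
    LineBdd (normSeminorm ℂ (SeminormCompletion p)) u n K fun w => toCompl p (G w) := by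
  have key : ∀ {G : W → A}, Continuous G ∧ (∀ w, p (G w) ≤ K w) →
      Continuous (fun w => RieffelCrossed.toCompl p (G w)) ∧
      ∀ w, normSeminorm ℂ (SeminormCompletion p) (RieffelCrossed.toCompl p (G w)) ≤ K w :=
    fun h => ⟨(continuous_toCompl hp).comp h.1, fun w => (norm_toCompl p _).trans_le (h.2 w)⟩
  induction n generalizing G with
  | zero => exact key h
  | succ n ih =>
    obtain ⟨h0, G', hG', h1⟩ := h
    exact ⟨key h0, _, fun w => hasLineDer_iff_hasLineDerivAt.mpr
      (hasLineDer_iff_toCompl.mp (hG' w) p hp), ih h1⟩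

theorem LineBdd.add [ContinuousAdd A] {n : ℕ} {K L : W → ℝ} {F G : W → A} (hF : LineBdd p u n K F)
    (hG : LineBdd p u n L G) : LineBdd p u n (fun w => K w + L w) fun w => F w + G w := by
  have key : ∀ {F G : W → A}, (Continuous F ∧ ∀ w, p (F w) ≤ K w) →
      (Continuous G ∧ ∀ w, p (G w) ≤ L w) →
      Continuous (fun w => F w + G w) ∧ ∀ w, p (F w + G w) ≤ K w + L w :=
    fun hF hG => ⟨hF.1.add hG.1, fun w => (map_add_le_add p _ _).trans (add_le_add (hF.2 w) (hG.2 w))⟩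
  induction n generalizing F G with
  | zero => exact key hF hG
  | succ n ih =>
    obtain ⟨h0, F', hF', h1⟩ := hF
    obtain ⟨k0, G', hG', k1⟩ := hG
    exact ⟨key h0 k0, _, fun w => (hF' w).add (hG' w), ih h1 k1⟩

/-- The Leibniz rule for `LineBdd`. -/
theorem LineBdd.bilin {B C : Type*} [AddCommGroup B] [Module ℂ B] [TopologicalSpace B]
    [AddCommGroup C] [Module ℂ C] [TopologicalSpace C] [ContinuousAdd C] [ContinuousSMul ℂ A]
    [IsTopologicalAddGroup A] {q : Seminorm ℂ B} {r : Seminorm ℂ C}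
    (m : A →ₗ[ℂ] B →ₗ[ℂ] C) (hm : Continuous fun q : A × B => m q.1 q.2)
    (hpqr : ∀ a b, r (m a b) ≤ p a * q b) {n : ℕ} {K L : W → ℝ} {F : W → A} {G : W → B}
    (hF : LineBdd p u n K F) (hG : LineBdd q u n L G) :
    LineBdd r u n (fun w => 2 ^ n * (K w * L w)) fun w => m (F w) (G w) := by
  have key : ∀ {F : W → A} {G : W → B}, (Continuous F ∧ ∀ w, p (F w) ≤ K w) →
      (Continuous G ∧ ∀ w, q (G w) ≤ L w) →
      Continuous (fun w => m (F w) (G w)) ∧ ∀ w, r (m (F w) (G w)) ≤ K w * L w :=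
    fun hF hG => ⟨hm.comp (hF.1.prodMk hG.1), fun w => (hpqr _ _).trans
      (mul_le_mul (hF.2 w) (hG.2 w) (apply_nonneg q _) ((apply_nonneg p _).trans (hF.2 w)))⟩
  induction n generalizing F G with
  | zero => simpa using! key hF hG
  | succ n ih =>
    have h0 := key hF.base hG.base
    refine ⟨⟨h0.1, fun w => (h0.2 w).trans ?_⟩, ?_⟩
    · exact le_mul_of_one_le_left (mul_nonneg (hF.nonneg w) (hG.nonneg w))
        (one_le_pow₀ one_le_two)
    · obtain ⟨F', hF', h1⟩ := hF.2
      obtain ⟨G', hG', k1⟩ := hG.2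
      refine ⟨_, fun w => (hF' w).bilin m hm (hG' w), ?_⟩
      -- Each of the two Leibniz terms contributes `2 ^ n * (K * L)`; this doubling is the source of
      -- the factor `2 ^ n`.
      refine ((ih h1 hG.of_succ).add (ih hF.of_succ k1)).mono fun w => le_of_eq ?_
      ring

theorem LineBdd.const_smul [ContinuousConstSMul ℂ A] {n : ℕ} {K : W → ℝ} {G : W → A}
    (h : LineBdd p u n K G) (c : ℂ) : LineBdd p u n (fun w => ‖c‖ * K w) fun w => c • G w := by
  have key : ∀ {G : W → A}, (Continuous G ∧ ∀ w, p (G w) ≤ K w) →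
      Continuous (fun w => c • G w) ∧ ∀ w, p (c • G w) ≤ ‖c‖ * K w := fun h =>
    ⟨h.1.const_smul c, fun w => by
      rw [map_smul_eq_mul]; exact mul_le_mul_of_nonneg_left (h.2 w) (norm_nonneg c)⟩
  induction n generalizing G with
  | zero => exact key h
  | succ n ih =>
    obtain ⟨h0, G', hG', h1⟩ := h
    exact ⟨key h0, _, fun w => (hG' w).const_smul c, ih h1⟩

theorem LineBdd.comp_affine {W' : Type*} [NormedAddCommGroup W'] [NormedSpace ℝ W']
    (L : W' →L[ℝ] W) (c : W) {v : W'} {n : ℕ} {K : W → ℝ} {G : W → A}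
    (h : LineBdd p (L v) n K G) :
    LineBdd p v n (fun w => K (L w + c)) fun w => G (L w + c) := by
  have key : ∀ {G : W → A}, (Continuous G ∧ ∀ w, p (G w) ≤ K w) →
      Continuous (fun w => G (L w + c)) ∧ ∀ w, p (G (L w + c)) ≤ K (L w + c) :=
    fun h => ⟨h.1.comp (L.continuous.add continuous_const), fun w => h.2 _⟩
  induction n generalizing G with
  | zero => exact key h
  | succ n ih =>
    obtain ⟨h0, G', hG', h1⟩ := h
    exact ⟨key h0, _, fun w => HasLineDer.comp_linear L.toLinearMap c (hG' _), ih h1⟩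

/-- Every derivative along `c • u` carries a further factor `c`, which does not exceed one in
modulus. This is why rescaled cut-offs `χ(ε ·)` with `0 < ε ≤ 1` obey bounds independent of `ε`. -/
theorem LineBdd.smul_direction [ContinuousConstSMul ℂ A] {n : ℕ} {K : W → ℝ} {G : W → A}
    (h : LineBdd p u n K G) {c : ℝ} (hc0 : c ≠ 0) (hc : |c| ≤ 1) : LineBdd p (c • u) n K G := by
  induction n generalizing G with
  | zero => exact h
  | succ n ih =>
    obtain ⟨h0, G', hG', h1⟩ := h
    refine ⟨h0, fun w => (c : ℂ) • G' w, fun w => (hG' w).smul_direction hc0, ih ?_⟩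
    refine (h1.const_smul (c : ℂ)).mono fun w => ?_
    rw [Complex.norm_real]
    exact mul_le_of_le_one_left (h1.nonneg w) hc

end LineBdd

/-! ### Decay of Fourier integrals -/

section Decay

variable {W : Type*} [NormedAddCommGroup W] [NormedSpace ℝ W]

theorem hasLineDerivAt_fourierChar (ℓ : W →L[ℝ] ℝ) (w u : W) :
    HasLineDerivAt ℝ (fun w => (Real.fourierChar (ℓ w) : ℂ))
      (2 * Real.pi * Complex.I * (ℓ u) * (Real.fourierChar (ℓ w) : ℂ)) w u := by
  have h1 : HasDerivAt (fun t : ℝ => ℓ (w + t • u)) (ℓ u) 0 := by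
    simp only [map_add, map_smul, smul_eq_mul]
    simpa using ((hasDerivAt_id (0 : ℝ)).mul_const (ℓ u)).const_add (ℓ w)
  have h2 := (Real.hasDerivAt_fourierChar (ℓ (w + (0 : ℝ) • u))).scomp (0 : ℝ) h1
  rw [HasLineDerivAt]
  rw [zero_smul, add_zero] at h2
  convert! h2 using 1
  rw [Complex.real_smul]
  ring

variable [FiniteDimensional ℝ W] [MeasurableSpace W] [BorelSpace W] {μ : Measure W}
  [μ.IsAddHaarMeasure]
variable {E : Type*} [NormedAddCommGroup E] [NormedSpace ℂ E]

/-- Integration by parts `n` times along `u`: each derivative of the character yields `2πi ℓ(u)`,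
and the factor `|2πi| ≥ 1` is discarded. -/
theorem LineBdd.pow_mul_norm_integral_le (ℓ : W →L[ℝ] ℝ) {u : W} {n : ℕ} {K : W → ℝ} {Ψ : W → E}
    (h : LineBdd (normSeminorm ℂ E) u n K Ψ) (hK : Integrable K μ) :
    |ℓ u| ^ n * ‖∫ w, (Real.fourierChar (ℓ w) : ℂ) • Ψ w ∂μ‖ ≤ ∫ w, K w ∂μ := by
  have hc : Continuous fun w => (Real.fourierChar (ℓ w) : ℂ) :=
    continuous_induced_dom.comp (Real.continuous_fourierChar.comp ℓ.continuous)
  have hint : ∀ {Ψ : W → E}, (Continuous Ψ ∧ ∀ w, ‖Ψ w‖ ≤ K w) →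
      Integrable (fun w => (Real.fourierChar (ℓ w) : ℂ) • Ψ w) μ := fun h =>
    hK.mono' (hc.smul h.1).aestronglyMeasurable (ae_of_all _ fun w => by
      rw [norm_smul, Circle.norm_coe, one_mul]; exact h.2 w)
  induction n generalizing Ψ with
  | zero =>
    rw [pow_zero, one_mul]
    refine (norm_integral_le_integral_norm _).trans ?_
    refine integral_mono (hint h).norm hK fun w => ?_
    rw [norm_smul, Circle.norm_coe, one_mul]
    exact h.2 w
  | succ n ih =>
    obtain ⟨h0, Ψ', hΨ', h1⟩ := h
    have hi := hint h0
    have hi' := hint h1.base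
    have key := integral_bilinear_hasLineDerivAt_right_eq_neg_left_of_integrable (μ := μ)
      (f := fun w => (Real.fourierChar (ℓ w) : ℂ)) (g := Ψ) (g' := Ψ') (v := u)
      (f' := fun w => 2 * Real.pi * Complex.I * (ℓ u) * (Real.fourierChar (ℓ w) : ℂ))
      (B := ContinuousLinearMap.lsmul ℝ ℂ)
      (by simpa only [ContinuousLinearMap.lsmul_apply, mul_smul] using!
            hi.smul (2 * Real.pi * Complex.I * (ℓ u)))
      (by simpa using hi') (by simpa using hi)
      (fun w _ => hasLineDerivAt_fourierChar ℓ w u)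
      (fun w _ => hasLineDer_iff_hasLineDerivAt.mp (hΨ' w))
    simp only [ContinuousLinearMap.lsmul_apply, mul_smul _ (Real.fourierChar _ : ℂ),
      integral_smul] at key
    have hn := congrArg norm key
    rw [norm_neg, norm_smul] at hn
    have h2 : |ℓ u| ≤ ‖(2 * Real.pi * Complex.I * (ℓ u) : ℂ)‖ := by
      simp only [norm_mul, Complex.norm_I, mul_one, Complex.norm_real, Real.norm_eq_abs,
        Complex.norm_ofNat, abs_of_pos Real.pi_pos]
      refine le_mul_of_one_le_left (abs_nonneg _) ?_
      nlinarith [Real.pi_gt_three]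
    calc |ℓ u| ^ (n + 1) * ‖∫ w, (Real.fourierChar (ℓ w) : ℂ) • Ψ w ∂μ‖
        = |ℓ u| ^ n * (|ℓ u| * ‖∫ w, (Real.fourierChar (ℓ w) : ℂ) • Ψ w ∂μ‖) := by ring
      _ ≤ |ℓ u| ^ n * ‖∫ w, (Real.fourierChar (ℓ w) : ℂ) • Ψ' w ∂μ‖ := by
        rw [hn]; gcongr
      _ ≤ _ := ih h1

/-- The majorant is needed in two ways: integrable when `f` is the localizing bump of an oscillatory
integral, bounded when `f` is a cut-off regarded as an amplitude. -/
theorem SchwartzMap.exists_lineBdd (f : 𝓢(W, E)) (u : W) (n : ℕ) :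
    ∃ K : W → ℝ, Integrable K μ ∧ (∃ C, ∀ w, K w ≤ C) ∧
      LineBdd (normSeminorm ℂ E) u n K f := by
  induction n generalizing f with
  | zero =>
    refine ⟨fun w => ‖f w‖, f.integrable.norm, ⟨SchwartzMap.seminorm ℝ 0 0 f, fun w => ?_⟩,
      f.continuous, fun w => le_rfl⟩
    exact SchwartzMap.norm_le_seminorm ℝ f w
  | succ n ih =>
    obtain ⟨K, hK, ⟨C, hC⟩, h⟩ := ih (LineDeriv.lineDerivOp u f)
    refine ⟨fun w => ‖f w‖ + K w, f.integrable.norm.add hK,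
      ⟨SchwartzMap.seminorm ℝ 0 0 f + C, fun w => add_le_add
        (SchwartzMap.norm_le_seminorm ℝ f w) (hC w)⟩,
      ⟨f.continuous, fun w => le_add_of_nonneg_right (h.nonneg w)⟩, _, fun w => ?_,
      h.mono fun w => le_add_of_nonneg_left (norm_nonneg _)⟩
    rw [hasLineDer_iff_hasLineDerivAt, SchwartzMap.lineDerivOp_apply_eq_fderiv]
    exact f.differentiableAt.hasFDerivAt.hasLineDerivAt u

end Decay

/-! ### Oscillatory integrals with values in a Banach space -/

/-- The power mean inequality for the numbers `1` and `a i`. It converts decay in the separate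
coordinate directions into decay in the norm. -/
theorem one_add_pow_le_of_le_sum {ι : Type*} [Fintype ι] {x : ℝ} (hx : 0 ≤ x) {a : ι → ℝ}
    (ha : ∀ i, 0 ≤ a i) (h : x ≤ ∑ i, a i) (n : ℕ) :
    (1 + x) ^ (n + 1) ≤ (Fintype.card ι + 1) ^ n * (1 + ∑ i, a i ^ (n + 1)) := by
  let f : Option ι → ℝ := fun o => o.elim 1 a
  have hf : ∀ o ∈ Finset.univ, 0 ≤ f o := by
    rintro (_ | i) _
    exacts [zero_le_one, ha i]
  have key := pow_sum_div_card_le_sum_pow hf n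
  rw [div_le_iff₀ (by simp; positivity)] at key
  simp only [Fintype.sum_option, Finset.card_univ, Fintype.card_option, f, Option.elim,
    one_pow, Nat.cast_add, Nat.cast_one] at key
  rw [mul_comm]
  exact (pow_le_pow_left₀ (by positivity) (by linarith) _).trans key

section Osc

variable {V : Type*} [NormedAddCommGroup V] [InnerProductSpace ℝ V] [FiniteDimensional ℝ V]

variable (V) in
/-- The number of derivatives needed for the convergence of oscillatory integrals on `V × V`. -/
def phaseOrder : ℕ := Module.finrank ℝ (V × V) + 1

/-- The coordinate directions in `V × V`. -/
def phaseDir (j : Fin (Module.finrank ℝ V) ⊕ Fin (Module.finrank ℝ V)) : V × V :=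
  Sum.elim (fun i => (stdOrthonormalBasis ℝ V i, 0)) (fun i => (0, stdOrthonormalBasis ℝ V i)) j

/-- The polarization of the quadratic form `(x, y) ↦ ⟪x, y⟫` at `σ`. -/
def phaseForm (σ : V × V) : V × V →L[ℝ] ℝ :=
  (innerSL ℝ σ.2).comp (ContinuousLinearMap.fst ℝ V V) +
    (innerSL ℝ σ.1).comp (ContinuousLinearMap.snd ℝ V V)

theorem phaseForm_apply (σ w : V × V) :
    phaseForm σ w = inner ℝ σ.2 w.1 + inner ℝ σ.1 w.2 := rfl

theorem norm_le_sum_abs_inner (x : V) :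
    ‖x‖ ≤ ∑ i, |inner ℝ x (stdOrthonormalBasis ℝ V i)| := by
  conv_lhs => rw [← (stdOrthonormalBasis ℝ V).sum_repr' x]
  refine (norm_sum_le _ _).trans (Finset.sum_le_sum fun i _ => ?_)
  rw [norm_smul, (stdOrthonormalBasis ℝ V).orthonormal.1 i, mul_one, real_inner_comm,
    Real.norm_eq_abs]

/-- Nondegeneracy of the phase: on the coordinate directions `phaseForm σ` takes as values the
coordinates of `σ`, with the two components interchanged. -/
theorem norm_le_sum_abs_phaseForm (σ : V × V) : ‖σ‖ ≤ ∑ j, |phaseForm σ (phaseDir j)| := by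
  rw [Fintype.sum_sum_type]
  simp only [phaseForm_apply, phaseDir, Sum.elim_inl, Sum.elim_inr, inner_zero_right, add_zero,
    zero_add]
  have h1 := norm_le_sum_abs_inner σ.1
  have h2 := norm_le_sum_abs_inner σ.2
  refine max_le (h1.trans ?_) (h2.trans ?_)
  · exact le_add_of_nonneg_left (Finset.sum_nonneg fun i _ => abs_nonneg _)
  · exact le_add_of_nonneg_right (Finset.sum_nonneg fun i _ => abs_nonneg _)

variable [MeasurableSpace V] [BorelSpace V]

instance isAddHaarMeasure_volume_prod : (volume : Measure (V × V)).IsAddHaarMeasure :=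
  Measure.prod.instIsAddHaarMeasure volume volume

theorem norm_e (x y : V) : ‖e x y‖ = 1 := Circle.norm_coe _

theorem e_add_left (x x' y : V) : e (x + x') y = e x y * e x' y := by
  simp only [e, inner_add_left, AddChar.map_add_eq_mul, Circle.coe_mul]

theorem e_add_right (x y y' : V) : e x (y + y') = e x y * e x y' := by
  simp only [e, inner_add_right, AddChar.map_add_eq_mul, Circle.coe_mul]

theorem e_comm (x y : V) : e x y = e y x := by
  simp only [e, real_inner_comm]

theorem e_neg_right (x y : V) : e x (-y) = e (-x) y := by
  simp only [e, inner_neg_left, inner_neg_right]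

theorem continuous_e : Continuous fun w : V × V => e w.1 w.2 :=
  continuous_induced_dom.comp
    (Real.continuous_fourierChar.comp (continuous_fst.inner continuous_snd))

/-- Expansion of the pairing of `σ.1 + w.1` with `σ.2 + w.2`: moving the origin of the quadratic
phase to `σ` changes it by a constant and a linear character, whose frequency grows with `σ`. -/
theorem e_phase_add (σ w : V × V) : e (σ + w).1 (σ + w).2 =
    e σ.1 σ.2 * e w.1 w.2 * (Real.fourierChar (phaseForm σ w) : ℂ) := by
  rw [Prod.fst_add, Prod.snd_add, e_add_left, e_add_right, e_add_right, phaseForm_apply,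
    AddChar.map_add_eq_mul, Circle.coe_mul, e_comm w.1 σ.2]
  simp only [e]
  ring

variable (V) in
/-- A normalized bump function on `V × V`. -/
def phaseBump (w : V × V) : ℂ := ((default : ContDiffBump (0 : V × V)).normed volume w : ℝ)

theorem contDiff_phaseBump : ContDiff ℝ (⊤ : ℕ∞) (phaseBump V) :=
  Complex.ofRealCLM.contDiff.comp (ContDiffBump.contDiff_normed _)

theorem hasCompactSupport_phaseBump : HasCompactSupport (phaseBump V) :=
  (ContDiffBump.hasCompactSupport_normed _).comp_left Complex.ofReal_zero

theorem integral_phaseBump : ∫ w, phaseBump V w = 1 := by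
  simp only [phaseBump]
  rw [integral_complex_ofReal, ContDiffBump.integral_normed, Complex.ofReal_one]

theorem integrable_phaseBump : Integrable (phaseBump V) :=
  contDiff_phaseBump.continuous.integrable_of_hasCompactSupport hasCompactSupport_phaseBump

theorem contDiff_e : ContDiff ℝ (⊤ : ℕ∞) fun w : V × V => e w.1 w.2 := by
  have : (fun w : V × V => e w.1 w.2) =
      fun w => Complex.exp ((2 * Real.pi * inner ℝ w.1 w.2 : ℝ) * Complex.I) := by
    funext w
    rw [e, Real.fourierChar_apply]
  rw [this]
  exact ((Complex.ofRealCLM.contDiff.comp (contDiff_const.mul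
    (contDiff_fst.inner ℝ contDiff_snd))).mul contDiff_const).cexp

variable (V) in
/-- The product of the bump function and the oscillating factor. -/
def phaseBumpSchwartz : 𝓢(V × V, ℂ) :=
  HasCompactSupport.toSchwartzMap (f := fun w : V × V => phaseBump V w * e w.1 w.2)
    hasCompactSupport_phaseBump.mul_right (contDiff_phaseBump.mul contDiff_e)

theorem phaseBumpSchwartz_apply (w : V × V) :
    phaseBumpSchwartz V w = phaseBump V w * e w.1 w.2 := rfl

section AmpBdd

variable {A : Type*} [AddCommGroup A] [Module ℂ A] [TopologicalSpace A]

/-- `G` is an amplitude: it is continuous, and it and its derivatives in the coordinate directions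
are bounded by `K` in the seminorm `p`. -/
structure AmpBdd (p : Seminorm ℂ A) (K : ℝ) (G : V × V → A) : Prop where
  continuous : Continuous G
  bound : ∀ w, p (G w) ≤ K
  line : ∀ j, LineBdd p (phaseDir j) (phaseOrder V) (fun _ => K) G

end AmpBdd

variable {E : Type*} [NormedAddCommGroup E] [NormedSpace ℂ E]

/-- The localization at `σ` of the oscillatory integral of `G`. -/
def oscInner (G : V × V → E) (σ : V × V) : E :=
  ∫ w, (phaseBump V w * e (σ + w).1 (σ + w).2) • G (σ + w)

/-- The oscillatory integral of an amplitude with values in a Banach space. -/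
def osc (G : V × V → E) : E := ∫ σ, oscInner G σ

theorem integrable_phaseBump_smul {G : V × V → E} (hG : Continuous G) (σ : V × V) :
    Integrable fun w => (phaseBump V w * e (σ + w).1 (σ + w).2) • G (σ + w) := by
  refine Continuous.integrable_of_hasCompactSupport ?_ ?_
  · exact (contDiff_phaseBump.continuous.mul (continuous_e.comp (continuous_const.add
      continuous_id))).smul (hG.comp (continuous_const.add continuous_id))
  · exact HasCompactSupport.smul_right hasCompactSupport_phaseBump.mul_right

variable (V E) in
-- Non-stationary phase. Up to a unimodular constant, `oscInner G σ` is the Fourier integral at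
-- frequency `phaseForm σ` of a fixed Schwartz function times a translate of `G`. The trivial
-- estimate and `phaseOrder V` integrations by parts along each coordinate direction combine to the
-- stated decay, with a constant that involves only the bump.
theorem exists_norm_oscInner_le : ∃ C : ℝ, 0 ≤ C ∧ ∀ (K : ℝ) (G : V × V → E),
    AmpBdd (normSeminorm ℂ E) K G → ∀ σ, ‖oscInner G σ‖ ≤ C * K * (1 + ‖σ‖) ^ (-(phaseOrder V : ℝ)) := by
  have hρ := fun j => SchwartzMap.exists_lineBdd (μ := (volume : Measure (V × V)))
    (phaseBumpSchwartz V) (phaseDir (V := V) j) (phaseOrder V)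
  choose Kρ hKρ hKb hρ using hρ
  obtain ⟨n, hn⟩ : ∃ n, phaseOrder V = n + 1 := ⟨_, rfl⟩
  set m : ℝ := (Fintype.card (Fin (Module.finrank ℝ V) ⊕ Fin (Module.finrank ℝ V)) + 1) ^ n
  have hm : 0 ≤ m := by positivity
  have hKnn : ∀ j, 0 ≤ ∫ w, Kρ j w := fun j => integral_nonneg fun w => (hρ j).nonneg w
  have hbnn : 0 ≤ ∫ w, ‖phaseBump V w‖ := integral_nonneg fun w => norm_nonneg _
  -- Here `m` is the power mean constant, the first summand is the estimate without integration by
  -- parts, and the sum collects one estimate per coordinate direction, with the Leibniz factor `2 ^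
  -- phaseOrder V`.
  refine ⟨m * ((∫ w, ‖phaseBump V w‖) + ∑ j, 2 ^ phaseOrder V * ∫ w, Kρ j w), ?_, ?_⟩
  · have := Finset.sum_nonneg fun j (_ : j ∈ Finset.univ) => hKnn j
    refine mul_nonneg hm (add_nonneg hbnn (Finset.sum_nonneg fun j _ => ?_))
    exact mul_nonneg (by positivity) (hKnn j)
  · intro K G hG σ
    have hK : 0 ≤ K := (norm_nonneg _).trans (hG.bound 0)
    have h0 : ‖oscInner G σ‖ ≤ (∫ w, ‖phaseBump V w‖) * K := by
      rw [oscInner, ← integral_mul_const]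
      refine (norm_integral_le_integral_norm _).trans
        (integral_mono (integrable_phaseBump_smul hG.continuous σ).norm
          (integrable_phaseBump.norm.mul_const K) fun w => ?_)
      simp only [norm_smul, norm_mul, norm_e, mul_one]
      exact mul_le_mul_of_nonneg_left (hG.bound _) (norm_nonneg _)
    -- The factor `e w.1 w.2`, whose derivatives are unbounded, is absorbed into the compactly
    -- supported bump; only the linear character oscillates against the amplitude.
    have heq : oscInner G σ = e σ.1 σ.2 • ∫ w, (Real.fourierChar (phaseForm σ w) : ℂ) •
        (phaseBumpSchwartz V w • G (σ + w)) := by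
      rw [oscInner, ← integral_smul]
      refine integral_congr_ae (ae_of_all _ fun w => ?_)
      simp only [smul_smul, e_phase_add, phaseBumpSchwartz_apply]
      congr 1
      ring
    have h1 : ∀ j, |phaseForm σ (phaseDir j)| ^ phaseOrder V * ‖oscInner G σ‖ ≤
        (2 ^ phaseOrder V * ∫ w, Kρ j w) * K := by
      intro j
      have hshift : LineBdd (normSeminorm ℂ E) (phaseDir j) (phaseOrder V) (fun _ => K)
          fun w => G (σ + w) := by
        have := LineBdd.comp_affine (ContinuousLinearMap.id ℝ (V × V)) σ (v := phaseDir j)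
          (hG.line j)
        simpa only [ContinuousLinearMap.id_apply, add_comm] using this
      have hprod := LineBdd.bilin (r := normSeminorm ℂ E) (LinearMap.lsmul ℂ E) continuous_smul
        (fun a b => (norm_smul a b).le) (hρ j) hshift
      have := hprod.pow_mul_norm_integral_le (μ := volume) (phaseForm σ)
        (((hKρ j).mul_const K).const_mul (2 ^ phaseOrder V))
      rw [heq, norm_smul, norm_e, one_mul]
      refine this.trans (le_of_eq ?_)
      rw [integral_const_mul, integral_mul_const, mul_assoc]
    rw [Real.rpow_neg (by positivity), Real.rpow_natCast, ← div_eq_mul_inv,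
      le_div_iff₀ (by positivity)]
    calc ‖oscInner G σ‖ * (1 + ‖σ‖) ^ phaseOrder V
        ≤ ‖oscInner G σ‖ * (m * (1 + ∑ j, |phaseForm σ (phaseDir j)| ^ phaseOrder V)) := by
          refine mul_le_mul_of_nonneg_left ?_ (norm_nonneg _)
          rw [hn]
          exact one_add_pow_le_of_le_sum (norm_nonneg _) (fun _ => abs_nonneg _)
            (norm_le_sum_abs_phaseForm σ) n
      _ = m * (‖oscInner G σ‖ + ∑ j, |phaseForm σ (phaseDir j)| ^ phaseOrder V *
            ‖oscInner G σ‖) := by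
          rw [← Finset.sum_mul]; ring
      _ ≤ m * ((∫ w, ‖phaseBump V w‖) * K + ∑ j, (2 ^ phaseOrder V * ∫ w, Kρ j w) * K) := by
          exact mul_le_mul_of_nonneg_left
            (add_le_add h0 (Finset.sum_le_sum fun j _ => h1 j)) hm
      _ = _ := by rw [← Finset.sum_mul]; ring

end Osc

/-! ### Convergence, stability and regularization of Banach-valued oscillatory integrals -/

section Osc

variable {V : Type*} [NormedAddCommGroup V] [InnerProductSpace ℝ V] [FiniteDimensional ℝ V]
  [MeasurableSpace V] [BorelSpace V]
variable {E : Type*} [NormedAddCommGroup E] [NormedSpace ℂ E]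

variable (V) in
theorem integrable_phaseOrder :
    Integrable fun σ : V × V => (1 + ‖σ‖) ^ (-(phaseOrder V : ℝ)) :=
  integrable_one_add_norm (by rw [phaseOrder]; exact_mod_cast Nat.lt_succ_self _)

theorem continuous_oscInner_integrand {G : V × V → E} (hG : Continuous G) :
    Continuous fun q : (V × V) × (V × V) =>
      (phaseBump V q.2 * e (q.1 + q.2).1 (q.1 + q.2).2) • G (q.1 + q.2) :=
  (((contDiff_phaseBump (V := V)).continuous.comp continuous_snd).mul
    (continuous_e.comp (continuous_fst.add continuous_snd))).smul
    (hG.comp (continuous_fst.add continuous_snd))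

theorem aestronglyMeasurable_oscInner {G : V × V → E} (hG : Continuous G) :
    AEStronglyMeasurable (oscInner G) volume :=
  (continuous_oscInner_integrand hG).aestronglyMeasurable.integral_prod_right'
    (μ := volume) (ν := volume)

theorem AmpBdd.integrable_oscInner {K : ℝ} {G : V × V → E} (hG : AmpBdd (normSeminorm ℂ E) K G) :
    Integrable (oscInner G) := by
  obtain ⟨C, -, hC⟩ := exists_norm_oscInner_le V E
  exact ((integrable_phaseOrder V).const_mul (C * K)).mono'
    (aestronglyMeasurable_oscInner hG.continuous) (ae_of_all _ (hC K G hG))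

theorem osc_add {K L : ℝ} {F G : V × V → E} (hF : AmpBdd (normSeminorm ℂ E) K F)
    (hG : AmpBdd (normSeminorm ℂ E) L G) : osc (fun w => F w + G w) = osc F + osc G := by
  rw [osc, osc, osc, ← integral_add hF.integrable_oscInner hG.integrable_oscInner]
  congr 1
  funext σ
  rw [oscInner, oscInner, oscInner, ← integral_add (integrable_phaseBump_smul hF.continuous σ)
    (integrable_phaseBump_smul hG.continuous σ)]
  simp only [smul_add]

theorem osc_clm {F : Type*} [NormedAddCommGroup F] [NormedSpace ℂ F] [CompleteSpace E]
    [CompleteSpace F] {K : ℝ} {G : V × V → E}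
    (hG : AmpBdd (normSeminorm ℂ E) K G) (T : E →L[ℂ] F) : osc (fun w => T (G w)) = T (osc G) := by
  rw [osc, osc, ← T.integral_comp_comm hG.integrable_oscInner]
  congr 1
  funext σ
  rw [oscInner, oscInner, ← T.integral_comp_comm (integrable_phaseBump_smul hG.continuous σ)]
  simp only [map_smul]

variable (V E) in
theorem exists_norm_osc_le : ∃ C : ℝ, 0 ≤ C ∧ ∀ (K : ℝ) (G : V × V → E),
    AmpBdd (normSeminorm ℂ E) K G → ‖osc G‖ ≤ C * K := by
  obtain ⟨C, hC0, hC⟩ := exists_norm_oscInner_le V E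
  refine ⟨C * ∫ σ : V × V, (1 + ‖σ‖) ^ (-(phaseOrder V : ℝ)),
    mul_nonneg hC0 (integral_nonneg fun σ => by positivity), fun K G hG => ?_⟩
  rw [mul_right_comm, ← integral_const_mul]
  exact norm_integral_le_of_norm_le ((integrable_phaseOrder V).const_mul _)
    (ae_of_all _ (hC K G hG))

/-- Dominated convergence twice, inside the window and over its centres `σ`. The uniform decay is
the majorant, so pointwise convergence of the amplitudes suffices and their derivatives need not
converge. -/
theorem tendsto_osc {ι : Type*} {l : Filter ι} [l.IsCountablyGenerated] {K : ℝ}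
    {F : ι → V × V → E} {G : V × V → E} (hF : ∀ᶠ i in l, AmpBdd (normSeminorm ℂ E) K (F i))
    (h : ∀ w, Tendsto (fun i => F i w) l (𝓝 (G w))) :
    Tendsto (fun i => osc (F i)) l (𝓝 (osc G)) := by
  obtain ⟨C, -, hC⟩ := exists_norm_oscInner_le V E
  refine tendsto_integral_filter_of_dominated_convergence
    (fun σ => C * K * (1 + ‖σ‖) ^ (-(phaseOrder V : ℝ))) ?_ ?_
    ((integrable_phaseOrder V).const_mul _) (ae_of_all _ fun σ => ?_)
  · filter_upwards [hF] with i hi using aestronglyMeasurable_oscInner hi.continuous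
  · filter_upwards [hF] with i hi using ae_of_all _ (hC K _ hi)
  · refine tendsto_integral_filter_of_dominated_convergence (fun w => ‖phaseBump V w‖ * K) ?_ ?_
      (integrable_phaseBump.norm.mul_const K) (ae_of_all _ fun w => (h (σ + w)).const_smul _)
    · filter_upwards [hF] with i hi using
        (integrable_phaseBump_smul hi.continuous σ).aestronglyMeasurable
    · filter_upwards [hF] with i hi
      refine ae_of_all _ fun w => ?_
      simp only [norm_smul, norm_mul, norm_e, mul_one]
      exact mul_le_mul_of_nonneg_left (hi.bound _) (norm_nonneg _)

/-- For an integrable `G` the order of integration may be exchanged; translation invariance then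
separates the bump, whose integral is one, and the localization disappears. -/
theorem osc_eq_integral [CompleteSpace E] {G : V × V → E} (hG : Continuous G)
    (hi : Integrable G) : osc G = ∫ w : V × V, e w.1 w.2 • G w := by
  have hi' : Integrable fun w : V × V => e w.1 w.2 • G w :=
    hi.norm.mono' (continuous_e.smul hG).aestronglyMeasurable
      (ae_of_all _ fun w => by rw [norm_smul, norm_e, one_mul])
  have hprod : Integrable (fun q : (V × V) × (V × V) =>
      (phaseBump V q.2 * e (q.1 + q.2).1 (q.1 + q.2).2) • G (q.1 + q.2))
      ((volume : Measure (V × V)).prod volume) := by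
    rw [integrable_prod_iff' (continuous_oscInner_integrand hG).aestronglyMeasurable]
    have hnorm : ∀ w : V × V, ∫ σ : V × V, ‖(phaseBump V w * e (σ + w).1 (σ + w).2) • G (σ + w)‖ =
        ‖phaseBump V w‖ * ∫ σ, ‖G σ‖ := by
      intro w
      rw [← integral_const_mul]
      simp only [norm_smul, norm_mul, norm_e, mul_one]
      exact integral_add_right_eq_self (fun σ => ‖phaseBump V w‖ * ‖G σ‖) w
    refine ⟨ae_of_all _ fun w => ?_, ?_⟩
    · simp only [mul_smul]
      exact ((hi'.comp_add_right w).smul (phaseBump V w))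
    · simp only [hnorm]
      exact integrable_phaseBump.norm.mul_const _
  rw [osc]
  simp only [oscInner]
  rw [integral_integral_swap hprod]
  have : ∀ w : V × V, ∫ σ : V × V, (phaseBump V w * e (σ + w).1 (σ + w).2) • G (σ + w) =
      phaseBump V w • ∫ w : V × V, e w.1 w.2 • G w := by
    intro w
    simp only [mul_smul]
    rw [integral_smul, integral_add_right_eq_self fun w : V × V => e w.1 w.2 • G w]
  simp only [this]
  rw [integral_smul_const, integral_phaseBump, one_smul]

/-- Multiplication of an amplitude by a regularizing factor. -/
theorem AmpBdd.regularize {A : Type*} [AddCommGroup A] [Module ℂ A] [TopologicalSpace A]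
    [ContinuousAdd A] [ContinuousSMul ℂ A] {p : Seminorm ℂ A} {K L : ℝ} {R : V × V → ℂ}
    {G : V × V → A}
    (hR : AmpBdd (normSeminorm ℂ ℂ) L R) (hG : AmpBdd p K G) {ε : ℝ} (hε : 0 < ε) (hε1 : ε ≤ 1)
    (τ : V × V) : AmpBdd p (2 ^ phaseOrder V * (L * K)) fun w => R (ε • (w + τ)) • G w := by
  have hL : 0 ≤ L := (apply_nonneg _ _).trans (hR.bound 0)
  have hK : 0 ≤ K := (apply_nonneg p _).trans (hG.bound 0)
  have hc : Continuous fun w : V × V => R (ε • (w + τ)) :=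
    hR.continuous.comp ((continuous_id.add continuous_const).const_smul ε)
  refine ⟨hc.smul hG.continuous, fun w => ?_, fun j => ?_⟩
  · rw [map_smul_eq_mul]
    calc _ ≤ L * K := mul_le_mul (hR.bound _) (hG.bound w) (apply_nonneg p _) hL
      _ ≤ _ := le_mul_of_one_le_left (mul_nonneg hL hK) (one_le_pow₀ one_le_two)
  · have h1 : LineBdd (normSeminorm ℂ ℂ) (phaseDir j) (phaseOrder V) (fun _ => L)
        fun w : V × V => R (ε • (w + τ)) := by
      have := LineBdd.comp_affine (ε • ContinuousLinearMap.id ℝ (V × V)) (ε • τ)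
        (v := phaseDir j) ((hR.line j).smul_direction hε.ne' (by rwa [abs_of_pos hε]))
      simpa only [_root_.smul_apply, ContinuousLinearMap.id_apply, ← smul_add]
        using this
    exact LineBdd.bilin (r := p) (LinearMap.lsmul ℂ A) continuous_smul
      (fun a b => (map_smul_eq_mul p a b).le) h1 (hG.line j)

variable [CompleteSpace E]

/-- The functions `R(ε(w + τ)) G(w)` are amplitudes with constants independent of `ε ≤ 1`, and they
tend pointwise to `G`. `R` need not be Schwartz: any amplitude that makes the products integrable is
admissible, such as a cut-off in one variable only, and its centre `-τ` is arbitrary. -/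
theorem tendsto_integral_regularized {K L : ℝ} {R : V × V → ℂ} {G : V × V → E}
    (hR : AmpBdd (normSeminorm ℂ ℂ) L R) (hR0 : R 0 = 1) (hG : AmpBdd (normSeminorm ℂ E) K G)
    (τ : V × V) (hi : ∀ ε : ℝ, 0 < ε → Integrable fun w => R (ε • (w + τ)) • G w) :
    Tendsto (fun ε : ℝ => ∫ w : V × V, (R (ε • (w + τ)) * e w.1 w.2) • G w) (𝓝[>] 0)
      (𝓝 (osc G)) := by
  have h1 : ∀ᶠ ε : ℝ in 𝓝[>] 0, 0 < ε ∧ ε ≤ 1 := by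
    filter_upwards [Ioc_mem_nhdsGT (zero_lt_one' ℝ)] with ε h using h
  have h2 : Tendsto (fun ε : ℝ => osc fun w => R (ε • (w + τ)) • G w) (𝓝[>] 0) (𝓝 (osc G)) := by
    refine tendsto_osc (K := 2 ^ phaseOrder V * (L * K)) ?_ fun w => ?_
    · filter_upwards [h1] with ε hε using hR.regularize hG hε.1 hε.2 τ
    · have : Tendsto (fun ε : ℝ => R (ε • (w + τ)) • G w) (𝓝[>] 0)
          (𝓝 (R ((0 : ℝ) • (w + τ)) • G w)) :=
        (((hR.continuous.comp (continuous_id.smul continuous_const)).smul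
          continuous_const).tendsto (0 : ℝ)).mono_left nhdsWithin_le_nhds
      simpa only [zero_smul, hR0, one_smul] using this
  refine h2.congr' ?_
  filter_upwards [h1] with ε hε
  rw [osc_eq_integral (hR.regularize hG hε.1 hε.2 τ).continuous (hi ε hε.1)]
  simp only [smul_smul, mul_comm]

variable (V E) in
-- Uniformity in both `τ` and `ε` provides the majorant for integrating regularized oscillatory
-- integrals over a family of translates.
theorem exists_norm_integral_regularized_le : ∃ C : ℝ, 0 ≤ C ∧ ∀ {K L : ℝ} {R : V × V → ℂ}
    {G : V × V → E}, AmpBdd (normSeminorm ℂ ℂ) L R → AmpBdd (normSeminorm ℂ E) K G →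
    ∀ (τ : V × V) (ε : ℝ), 0 < ε → ε ≤ 1 → Integrable (fun w => R (ε • (w + τ)) • G w) →
    ‖∫ w : V × V, (R (ε • (w + τ)) * e w.1 w.2) • G w‖ ≤ C * (L * K) := by
  obtain ⟨C, hC0, hC⟩ := exists_norm_osc_le V E
  refine ⟨C * 2 ^ phaseOrder V, by positivity, fun {K L R G} hR hG τ ε hε hε1 hi => ?_⟩
  have := hC _ _ (hR.regularize hG hε hε1 τ)
  rw [osc_eq_integral (hR.regularize hG hε hε1 τ).continuous hi] at this
  simp only [smul_smul] at this
  simpa only [mul_comm (e _ _), mul_assoc] using this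

theorem AmpBdd.exists_of_line {A : Type*} [AddCommGroup A] [Module ℂ A] [TopologicalSpace A]
    {p : Seminorm ℂ A} {G : V × V → A} (hG : Continuous G) (hb : ∃ C, ∀ w, p (G w) ≤ C)
    (h : ∀ j, ∃ C, LineBdd p (phaseDir j) (phaseOrder V) (fun _ => C) G) : ∃ K, AmpBdd p K G := by
  obtain ⟨B, hB⟩ := hb
  choose C hC using h
  have hL : ∀ j, C j ≤ ∑ j, |C j| := fun j => (le_abs_self _).trans
    (Finset.single_le_sum (f := fun j => |C j|) (fun j _ => abs_nonneg _) (Finset.mem_univ j))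
  refine ⟨|B| + ∑ j, |C j|, hG, fun w => ?_, fun j => ?_⟩
  · exact ((hB w).trans (le_abs_self _)).trans
      (le_add_of_nonneg_right (Finset.sum_nonneg fun j _ => abs_nonneg _))
  · exact (hC j).mono fun w => (hL j).trans (le_add_of_nonneg_left (abs_nonneg _))

/-- Schwartz functions of linear coordinates are amplitudes. -/
theorem SchwartzMap.exists_ampBdd {W : Type*} [NormedAddCommGroup W] [NormedSpace ℝ W]
    [FiniteDimensional ℝ W] (χ : 𝓢(W, ℂ)) (L : V × V →L[ℝ] W) :
    ∃ K, AmpBdd (normSeminorm ℂ ℂ) K fun w => χ (L w) := by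
  borelize W
  refine AmpBdd.exists_of_line (χ.continuous.comp L.continuous)
    ⟨SchwartzMap.seminorm ℝ 0 0 χ, fun w => SchwartzMap.norm_le_seminorm ℝ χ _⟩ fun j => ?_
  obtain ⟨K, -, ⟨C, hC⟩, hK⟩ := SchwartzMap.exists_lineBdd (μ := Measure.addHaar) χ
    (L (phaseDir j)) (phaseOrder V)
  refine ⟨C, ?_⟩
  simpa only [add_zero] using (hK.mono hC).comp_affine L 0

/-! ### Oscillatory integrals as iterated integrals -/

section Iterated

theorem exists_schwartzMap_apply_zero (W : Type*) [NormedAddCommGroup W] [NormedSpace ℝ W]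
    [FiniteDimensional ℝ W] : ∃ χ : 𝓢(W, ℂ), χ 0 = 1 := by
  let c : ContDiffBump (0 : W) := default
  refine ⟨HasCompactSupport.toSchwartzMap (f := fun w => (c w : ℂ))
    (c.hasCompactSupport.comp_left Complex.ofReal_zero)
    (Complex.ofRealCLM.contDiff.comp c.contDiff), ?_⟩
  have : c 0 = 1 := c.one_of_mem_closedBall (Metric.mem_closedBall_self c.rIn_pos.le)
  change ((c 0 : ℝ) : ℂ) = 1
  rw [this, Complex.ofReal_one]

theorem tendsto_integral_schwartzMap_smul (χ : 𝓢(V, ℂ)) (hχ : χ 0 = 1) {H : V → E}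
    (hH : Integrable H) :
    Tendsto (fun ε : ℝ => ∫ y, χ (ε • y) • H y) (𝓝[>] 0) (𝓝 (∫ y, H y)) := by
  refine tendsto_integral_filter_of_dominated_convergence
    (fun y => SchwartzMap.seminorm ℝ 0 0 χ * ‖H y‖) (Eventually.of_forall fun ε => ?_)
    (Eventually.of_forall fun ε => ae_of_all _ fun y => ?_) (hH.norm.const_mul _)
    (ae_of_all _ fun y => ?_)
  · exact (χ.continuous.comp (continuous_const_smul ε)).aestronglyMeasurable.smul
      hH.aestronglyMeasurable
  · rw [norm_smul]
    exact mul_le_mul_of_nonneg_right (SchwartzMap.norm_le_seminorm ℝ χ _) (norm_nonneg _)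
  · have : Tendsto (fun ε : ℝ => χ (ε • y) • H y) (𝓝[>] 0) (𝓝 (χ ((0 : ℝ) • y) • H y)) :=
      (((χ.continuous.comp (continuous_id.smul continuous_const)).smul
        continuous_const).tendsto (0 : ℝ)).mono_left nhdsWithin_le_nhds
    simpa only [zero_smul, hχ, one_smul] using this

/-- Given decay in `z`, a cut-off in `y` alone already makes the double integral absolutely
convergent. Fubini writes it as an iterated integral, and the cut-off is then removed on both sides:
by `tendsto_integral_regularized` and by dominated convergence in `y`. -/
theorem osc_eq_integral_of_decay_snd {K : ℝ} {G : V × V → E} (hG : AmpBdd (normSeminorm ℂ E) K G)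
    {g : V → ℝ} (hg : Integrable g) (hGg : ∀ y z, ‖G (y, z)‖ ≤ g z)
    (hH : Integrable fun y => ∫ z, e y z • G (y, z)) :
    osc G = ∫ y, ∫ z, e y z • G (y, z) := by
  obtain ⟨χ, hχ⟩ := exists_schwartzMap_apply_zero V
  obtain ⟨L, hL⟩ := SchwartzMap.exists_ampBdd χ (ContinuousLinearMap.fst ℝ V V)
  have hi : ∀ ε : ℝ, 0 < ε → Integrable fun w : V × V => χ (ε • w.1) • G w := by
    intro ε hε
    refine ((χ.integrable.norm.comp_smul hε.ne').mul_prod hg).mono'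
      ((χ.continuous.comp (continuous_fst.const_smul ε)).smul
        hG.continuous).aestronglyMeasurable (ae_of_all _ fun w => ?_)
    rw [norm_smul]
    exact mul_le_mul_of_nonneg_left (hGg _ _) (norm_nonneg _)
  have h1 := tendsto_integral_regularized hL (by simpa using hχ) hG 0
    (by simpa only [add_zero] using! hi)
  refine tendsto_nhds_unique h1 ((tendsto_integral_schwartzMap_smul χ hχ hH).congr' ?_)
  filter_upwards [self_mem_nhdsWithin] with ε hε
  have hi' : Integrable fun w : V × V => (χ (ε • w.1) * e w.1 w.2) • G w := by
    refine (hi ε hε).norm.mono' (((χ.continuous.comp (continuous_fst.const_smul ε)).mul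
      continuous_e).smul hG.continuous).aestronglyMeasurable (ae_of_all _ fun w => ?_)
    rw [norm_smul, norm_smul, norm_mul, norm_e, mul_one]
  simp only [add_zero]
  refine Eq.trans ?_ (integral_prod _ hi').symm
  simp only [mul_smul, integral_smul]

theorem osc_eq_integral_of_decay_fst {K : ℝ} {G : V × V → E} (hG : AmpBdd (normSeminorm ℂ E) K G)
    {g : V → ℝ} (hg : Integrable g) (hGg : ∀ y z, ‖G (y, z)‖ ≤ g y)
    (hH : Integrable fun z => ∫ y, e y z • G (y, z)) :
    osc G = ∫ z, ∫ y, e y z • G (y, z) := by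
  obtain ⟨χ, hχ⟩ := exists_schwartzMap_apply_zero V
  obtain ⟨L, hL⟩ := SchwartzMap.exists_ampBdd χ (ContinuousLinearMap.snd ℝ V V)
  have hi : ∀ ε : ℝ, 0 < ε → Integrable fun w : V × V => χ (ε • w.2) • G w := by
    intro ε hε
    refine (hg.mul_prod (χ.integrable.norm.comp_smul hε.ne')).mono'
      ((χ.continuous.comp (continuous_snd.const_smul ε)).smul
        hG.continuous).aestronglyMeasurable (ae_of_all _ fun w => ?_)
    rw [norm_smul, mul_comm]
    exact mul_le_mul_of_nonneg_right (hGg _ _) (norm_nonneg _)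
  have h1 := tendsto_integral_regularized hL (by simpa using hχ) hG 0
    (by simpa only [add_zero] using! hi)
  refine tendsto_nhds_unique h1 ((tendsto_integral_schwartzMap_smul χ hχ hH).congr' ?_)
  filter_upwards [self_mem_nhdsWithin] with ε hε
  have hi' : Integrable fun w : V × V => (χ (ε • w.2) * e w.1 w.2) • G w := by
    refine (hi ε hε).norm.mono' (((χ.continuous.comp (continuous_snd.const_smul ε)).mul
      continuous_e).smul hG.continuous).aestronglyMeasurable (ae_of_all _ fun w => ?_)
    rw [norm_smul, norm_smul, norm_mul, norm_e, mul_one]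
  simp only [add_zero]
  refine Eq.trans ?_ (integral_prod_symm _ hi').symm
  simp only [mul_smul, integral_smul]

end Iterated

end Osc

/-! ### Oscillatory integrals with values in a Fréchet space -/

section OscFrechet

variable {V : Type*} [NormedAddCommGroup V] [InnerProductSpace ℝ V] [FiniteDimensional ℝ V]
  [MeasurableSpace V] [BorelSpace V]
variable {A : Type*} [AddCommGroup A] [Module ℂ A]

/-- `F` is an amplitude with respect to all continuous seminorms. -/
def IsAmplitude [TopologicalSpace A] (F : V × V → A) : Prop :=
  ∀ p : Seminorm ℂ A, Continuous p → ∃ K, AmpBdd p K F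

variable [UniformSpace A] [IsUniformAddGroup A] [PolynormableSpace ℂ A]

theorem AmpBdd.toCompl {p : Seminorm ℂ A} (hp : Continuous p) {K : ℝ} {F : V × V → A}
    (h : AmpBdd p K F) :
    AmpBdd (normSeminorm ℂ (SeminormCompletion p)) K fun w => toCompl p (F w) :=
  ⟨(continuous_toCompl hp).comp h.continuous, fun w => (norm_toCompl p _).trans_le (h.bound w),
    fun j => (h.line j).toCompl hp⟩

variable [CompleteSpace A] [T2Space A] [ContinuousSMul ℂ A]

theorem IsAmplitude.vInt {F : V × V → A} (hF : IsAmplitude F) (χ : 𝓢(V × V, ℂ)) {ε : ℝ}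
    (hε : 0 < ε) : VInt volume fun q : V × V => (χ (ε • q) * e q.1 q.2) • F q := by
  -- The zero seminorm serves only to extract the continuity of `F`.
  obtain ⟨K, hK⟩ := hF 0 continuous_const
  refine VInt.of_bound (((χ.continuous.comp (continuous_const_smul ε)).mul continuous_e).smul
    hK.continuous) fun p hp => ?_
  obtain ⟨K, hK⟩ := hF p hp
  refine ⟨fun q => ‖χ (ε • q)‖ * K, (χ.integrable.norm.comp_smul hε.ne').mul_const K, fun q => ?_⟩
  rw [map_smul_eq_mul, norm_mul, norm_e, mul_one]
  exact mul_le_mul_of_nonneg_left (hK.bound q) (norm_nonneg _)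

theorem IsAmplitude.tendsto_regularized {F : V × V → A} (hF : IsAmplitude F) (χ : 𝓢(V × V, ℂ))
    (hχ : χ 0 = 1) {p : Seminorm ℂ A} (hp : Continuous p) :
    Tendsto (fun ε : ℝ => toCompl p (vIntegral volume
      fun q : V × V => (χ (ε • q) * e q.1 q.2) • F q)) (𝓝[>] 0)
      (𝓝 (osc fun w => toCompl p (F w))) := by
  obtain ⟨K, hK⟩ := hF p hp
  obtain ⟨L, hL⟩ := SchwartzMap.exists_ampBdd χ (ContinuousLinearMap.id ℝ (V × V))
  have h := tendsto_integral_regularized hL hχ (hK.toCompl hp) 0 (fun ε hε => by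
    have := hF.vInt χ hε p hp
    refine this.norm.mono' (((χ.continuous.comp ((continuous_id.add
      continuous_const).const_smul ε))).smul
      (hK.toCompl hp).continuous).aestronglyMeasurable (ae_of_all _ fun q => le_of_eq ?_)
    simp only [map_smul, norm_smul, norm_mul, norm_e, mul_one, add_zero,
      ContinuousLinearMap.id_apply])
  refine h.congr' ?_
  filter_upwards [self_mem_nhdsWithin] with ε hε
  rw [(hF.vInt χ hε).toCompl_vIntegral hp]
  simp only [map_smul, add_zero, ContinuousLinearMap.id_apply]

/-- The values `osc` in the completions are compatible, since bounded maps commute with `osc`; the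
glued point is the limit for every cut-off, because `osc` involves none. -/
theorem IsAmplitude.exists_hasOscIntegral {F : V × V → A} (hF : IsAmplitude F) :
    ∃ v, HasOscIntegral (fun x y => F (x, y)) v ∧
      ∀ p : Seminorm ℂ A, Continuous p → toCompl p v = osc fun w => toCompl p (F w) := by
  obtain ⟨v, hv⟩ := exists_toCompl_eq_of_compatible (fun p => osc fun w => toCompl p (F w))
    (fun p q hp hq hpq g hg => by
      obtain ⟨K, hK⟩ := hF q hq
      rw [← osc_clm (hK.toCompl hq) g]
      simp only [hg])
  refine ⟨v, fun χ hχ => ⟨fun ε => vIntegral volume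
    fun q : V × V => (χ (ε • q) * e q.1 q.2) • F q, fun ε hε => (hF.vInt χ hε).hasVIntegral, ?_⟩, hv⟩
  rw [tendsto_iff_toCompl]
  intro p hp
  rw [hv p hp]
  exact hF.tendsto_regularized χ hχ hp

theorem IsAmplitude.oscIntegrable {F : V × V → A} (hF : IsAmplitude F) :
    OscIntegrable fun x y => F (x, y) :=
  let ⟨v, hv, _⟩ := hF.exists_hasOscIntegral
  ⟨v, hv⟩

theorem HasOscIntegral.unique {F : V → V → A} {v w : A} (hv : HasOscIntegral F v)
    (hw : HasOscIntegral F w) : v = w := by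
  obtain ⟨χ, hχ⟩ := exists_schwartzMap_apply_zero (V × V)
  obtain ⟨I, hI, hIv⟩ := hv χ hχ
  obtain ⟨I', hI', hIw⟩ := hw χ hχ
  refine tendsto_nhds_unique hIv (hIw.congr' ?_)
  filter_upwards [self_mem_nhdsWithin] with ε hε using (hI' ε hε).unique (hI ε hε)

theorem HasOscIntegral.oscIntegral_eq {F : V → V → A} {v : A} (hv : HasOscIntegral F v) :
    oscIntegral F = v := by
  have h : OscIntegrable F := ⟨v, hv⟩
  rw [oscIntegral, dif_pos h]
  exact h.choose_spec.unique hv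

theorem IsAmplitude.toCompl_oscIntegral {F : V × V → A} (hF : IsAmplitude F) {p : Seminorm ℂ A}
    (hp : Continuous p) :
    toCompl p (oscIntegral fun x y => F (x, y)) = osc fun w => toCompl p (F w) := by
  obtain ⟨v, hv, hv'⟩ := hF.exists_hasOscIntegral
  rw [hv.oscIntegral_eq, hv' p hp]

variable (V) in
theorem exists_seminorm_oscIntegral_le {p : Seminorm ℂ A} (hp : Continuous p) :
    ∃ C : ℝ, 0 ≤ C ∧ ∀ (K : ℝ) (F : V × V → A), IsAmplitude F → AmpBdd p K F →
      p (oscIntegral fun x y => F (x, y)) ≤ C * K := by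
  obtain ⟨C, hC0, hC⟩ := exists_norm_osc_le V (SeminormCompletion p)
  refine ⟨C, hC0, fun K F hF hK => ?_⟩
  rw [← norm_toCompl, hF.toCompl_oscIntegral hp]
  exact hC K _ (hK.toCompl hp)

theorem IsAmplitude.oscIntegral_add {F G : V × V → A} (hF : IsAmplitude F) (hG : IsAmplitude G)
    (hFG : IsAmplitude fun w => F w + G w) :
    oscIntegral (fun x y => F (x, y) + G (x, y)) =
      oscIntegral (fun x y => F (x, y)) + oscIntegral fun x y => G (x, y) := by
  refine eq_of_toCompl_eq fun p hp => ?_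
  obtain ⟨K, hK⟩ := hF p hp
  obtain ⟨L, hL⟩ := hG p hp
  rw [map_add, hFG.toCompl_oscIntegral hp, hF.toCompl_oscIntegral hp, hG.toCompl_oscIntegral hp]
  simp only [map_add]
  exact osc_add (hK.toCompl hp) (hL.toCompl hp)

theorem IsAmplitude.oscIntegral_clm {B : Type*} [AddCommGroup B] [Module ℂ B] [UniformSpace B]
    [IsUniformAddGroup B] [PolynormableSpace ℂ B] [CompleteSpace B] [T2Space B]
    [ContinuousSMul ℂ B] {F : V × V → A} (hF : IsAmplitude F) (T : A →L[ℂ] B)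
    (hT : IsAmplitude fun w => T (F w)) :
    oscIntegral (fun x y => T (F (x, y))) = T (oscIntegral fun x y => F (x, y)) := by
  refine eq_of_toCompl_eq fun p hp => ?_
  have hq : Continuous (p.comp T.toLinearMap) := hp.comp T.continuous
  obtain ⟨g, hg⟩ := exists_map_toCompl (p.comp T.toLinearMap) p T.toLinearMap fun a => le_rfl
  have hg' : ∀ a, toCompl p (T a) = g (RieffelCrossed.toCompl _ a) := fun a => (hg a).symm
  obtain ⟨K, hK⟩ := hF _ hq
  rw [hT.toCompl_oscIntegral hp, hg', hF.toCompl_oscIntegral hq, ← osc_clm (hK.toCompl hq) g]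
  simp only [hg']

theorem IsAmplitude.oscIntegral_eq_of_decay_snd {F : V × V → A} (hF : IsAmplitude F)
    (hd : ∀ p : Seminorm ℂ A, Continuous p → ∃ g : V → ℝ, Integrable g ∧
      ∀ y z, p (F (y, z)) ≤ g z)
    (hH : VInt volume fun y => vIntegral volume fun z => e y z • F (y, z)) :
    oscIntegral (fun x y => F (x, y)) =
      vIntegral volume fun y => vIntegral volume fun z => e y z • F (y, z) := by
  have hc : Continuous F := (hF 0 continuous_const).choose_spec.continuous
  have hv : ∀ y, VInt volume fun z => e y z • F (y, z) := fun y =>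
    VInt.of_bound ((continuous_e.comp (Continuous.prodMk_right y)).smul
      (hc.comp (Continuous.prodMk_right y))) fun p hp => by
        obtain ⟨g, hg, hgb⟩ := hd p hp
        exact ⟨g, hg, fun z => by rw [map_smul_eq_mul, norm_e, one_mul]; exact hgb y z⟩
  refine eq_of_toCompl_eq fun p hp => ?_
  obtain ⟨g, hg, hgb⟩ := hd p hp
  obtain ⟨K, hK⟩ := hF p hp
  have hH' := hH p hp
  rw [hF.toCompl_oscIntegral hp, hH.toCompl_vIntegral hp]
  simp only [(hv _).toCompl_vIntegral hp, map_smul] at hH' ⊢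
  exact osc_eq_integral_of_decay_snd (hK.toCompl hp) hg
    (fun y z => (norm_toCompl p _).trans_le (hgb y z)) hH'

theorem IsAmplitude.oscIntegral_eq_of_decay_fst {F : V × V → A} (hF : IsAmplitude F)
    (hd : ∀ p : Seminorm ℂ A, Continuous p → ∃ g : V → ℝ, Integrable g ∧
      ∀ y z, p (F (y, z)) ≤ g y)
    (hH : VInt volume fun z => vIntegral volume fun y => e y z • F (y, z)) :
    oscIntegral (fun x y => F (x, y)) =
      vIntegral volume fun z => vIntegral volume fun y => e y z • F (y, z) := by
  have hc : Continuous F := (hF 0 continuous_const).choose_spec.continuous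
  have hv : ∀ z, VInt volume fun y => e y z • F (y, z) := fun z =>
    VInt.of_bound ((continuous_e.comp (Continuous.prodMk_left z)).smul
      (hc.comp (Continuous.prodMk_left z))) fun p hp => by
        obtain ⟨g, hg, hgb⟩ := hd p hp
        exact ⟨g, hg, fun y => by rw [map_smul_eq_mul, norm_e, one_mul]; exact hgb y z⟩
  refine eq_of_toCompl_eq fun p hp => ?_
  obtain ⟨g, hg, hgb⟩ := hd p hp
  obtain ⟨K, hK⟩ := hF p hp
  have hH' := hH p hp
  rw [hF.toCompl_oscIntegral hp, hH.toCompl_vIntegral hp]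
  simp only [(hv _).toCompl_vIntegral hp, map_smul] at hH' ⊢
  exact osc_eq_integral_of_decay_fst (hK.toCompl hp) hg
    (fun y z => (norm_toCompl p _).trans_le (hgb y z)) hH'

end OscFrechet

/-! ### Recognizing Schwartz functions -/

section Schwartz

variable {V : Type*} [NormedAddCommGroup V] [InnerProductSpace ℝ V]
variable {A : Type*} [AddCommGroup A] [Module ℂ A] [TopologicalSpace A]

/-- Induction over the list of directions. The typical class is the image of all Schwartz functions
under some operation, so only one derivative ever has to be computed. -/
theorem isSchwartz_of_class [T2Space A] {𝒞 : Set (V → A)} (hc : ∀ f ∈ 𝒞, Continuous f)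
    (hb : ∀ f ∈ 𝒞, ∀ (k : ℕ) (p : Seminorm ℂ A), Continuous p →
      ∃ C : ℝ, ∀ x, ‖x‖ ^ k * p (f x) ≤ C)
    (hd : ∀ f ∈ 𝒞, ∀ v, ∃ g ∈ 𝒞, ∀ x, HasDirDeriv f (g x) x v) {f : V → A} (hf : f ∈ 𝒞) :
    IsSchwartz f := by
  have hdir : ∀ f ∈ 𝒞, ∀ v, dirDeriv v f ∈ 𝒞 ∧ ∀ x, HasDirDeriv f (dirDeriv v f x) x v := by
    intro f hf v
    obtain ⟨g, hg, hfg⟩ := hd f hf v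
    have : dirDeriv v f = g := funext fun x => (hfg x).dirDeriv_eq
    rw [this]
    exact ⟨hg, hfg⟩
  have hmem : ∀ l : List V, iterDirDeriv l f ∈ 𝒞 := by
    intro l
    induction l with
    | nil => exact hf
    | cons v l ih => exact (hdir _ ih v).1
  exact ⟨fun l => hc _ (hmem l), fun l x v => (hdir _ (hmem l) v).2 x, fun l => hb _ (hmem l)⟩

/-- The product of `f` with the linear function `⟪v, ·⟫`. -/
def coordMul (v : V) (f : V → A) (x : V) : A := ((inner ℝ v x : ℝ) : ℂ) • f x

theorem hasLineDer_coordMul [ContinuousSMul ℂ A] [IsTopologicalAddGroup A] {f : V → A} {d : A}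
    {x u : V} (v : V) (h : HasLineDer f d x u) :
    HasLineDer (coordMul v f) (coordMul v (fun _ => d) x + ((inner ℝ v u : ℝ) : ℂ) • f x) x u := by
  have h1 : HasLineDer (fun x => ((inner ℝ v x : ℝ) : ℂ)) ((inner ℝ v u : ℝ) : ℂ) x u := by
    refine Tendsto.congr' ?_ tendsto_const_nhds
    filter_upwards [self_mem_nhdsWithin] with t ht
    rw [inner_add_right, inner_smul_right, Complex.ofReal_add, add_sub_cancel_left,
      Complex.ofReal_mul, smul_eq_mul, inv_mul_cancel_left₀ (Complex.ofReal_ne_zero.mpr ht)]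
  rw [add_comm]
  exact h1.bilin (LinearMap.lsmul ℂ A) continuous_smul h

variable [T2Space A] [IsTopologicalAddGroup A] [ContinuousSMul ℂ A]

/-- Stability under coordinate multiplications upgrades boundedness to rapid decay, as powers of the
norm are dominated by powers of the coordinates. The span accommodates the sums and scalars that
product rules and integrations by parts create. -/
theorem isSchwartz_of_span [FiniteDimensional ℝ V] {𝒢 : Set (V → A)} (hc : ∀ f ∈ 𝒢, Continuous f)
    (hb : ∀ f ∈ 𝒢, ∀ p : Seminorm ℂ A, Continuous p → ∃ C : ℝ, ∀ x, p (f x) ≤ C)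
    (hd : ∀ f ∈ 𝒢, ∀ v, ∃ g ∈ Submodule.span ℂ 𝒢, ∀ x, HasDirDeriv f (g x) x v)
    (hm : ∀ f ∈ 𝒢, ∀ v, coordMul v f ∈ Submodule.span ℂ 𝒢) {f : V → A}
    (hf : f ∈ Submodule.span ℂ 𝒢) : IsSchwartz f := by
  have hb' : ∀ f ∈ Submodule.span ℂ 𝒢, ∀ p : Seminorm ℂ A, Continuous p →
      ∃ C : ℝ, ∀ x, p (f x) ≤ C := by
    intro f hf p hp
    induction hf using Submodule.span_induction with
    | mem f hf => exact hb f hf p hp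
    | zero => exact ⟨0, fun x => by simp⟩
    | add f g _ _ hf hg =>
      obtain ⟨C, hC⟩ := hf
      obtain ⟨D, hD⟩ := hg
      exact ⟨C + D, fun x => (map_add_le_add p _ _).trans (add_le_add (hC x) (hD x))⟩
    | smul c f _ hf =>
      obtain ⟨C, hC⟩ := hf
      exact ⟨‖c‖ * C, fun x => by
        rw [Pi.smul_apply, map_smul_eq_mul]
        exact mul_le_mul_of_nonneg_left (hC x) (norm_nonneg c)⟩
  have hm' : ∀ f ∈ Submodule.span ℂ 𝒢, ∀ v, coordMul v f ∈ Submodule.span ℂ 𝒢 := by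
    intro f hf v
    induction hf using Submodule.span_induction with
    | mem f hf => exact hm f hf v
    | zero =>
      convert Submodule.zero_mem _
      funext x
      simp [coordMul]
    | add f g _ _ hf hg =>
      convert Submodule.add_mem _ hf hg using 1
      funext x
      simp [coordMul]
    | smul c f _ hf =>
      convert Submodule.smul_mem _ c hf using 1
      funext x
      simp [coordMul, smul_comm c]
  refine isSchwartz_of_class (𝒞 := Submodule.span ℂ 𝒢) ?_ ?_ ?_ hf
  · intro f hf
    induction hf using Submodule.span_induction with
    | mem f hf => exact hc f hf
    | zero => exact continuous_const
    | add f g _ _ hf hg => exact hf.add hg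
    | smul c f _ hf => exact hf.const_smul c
  · intro f hf k p hp
    have hpow : ∀ v : V, ∀ n : ℕ, ∃ C : ℝ, ∀ x, |inner ℝ x v| ^ n * p (f x) ≤ C := by
      intro v n
      suffices h : ∃ g ∈ Submodule.span ℂ 𝒢, ∀ x, p (g x) = |inner ℝ x v| ^ n * p (f x) by
        obtain ⟨g, hg, h⟩ := h
        obtain ⟨C, hC⟩ := hb' g hg p hp
        exact ⟨C, fun x => (h x).symm.trans_le (hC x)⟩
      induction n with
      | zero => exact ⟨f, hf, fun x => by simp⟩
      | succ n ih =>
        obtain ⟨g, hg, h⟩ := ih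
        refine ⟨coordMul v g, hm' g hg v, fun x => ?_⟩
        rw [coordMul, map_smul_eq_mul, h, Complex.norm_real, Real.norm_eq_abs, real_inner_comm]
        ring
    obtain ⟨B, hB⟩ := hb' f hf p hp
    -- The exponent `k + 1`, rather than `k`, fits the form of the power mean inequality.
    choose C hC using fun i => hpow (stdOrthonormalBasis ℝ V i) (k + 1)
    refine ⟨(Fintype.card (Fin (Module.finrank ℝ V)) + 1) ^ k * (B + ∑ i, C i), fun x => ?_⟩
    have h1 : ‖x‖ ^ k ≤ (1 + ‖x‖) ^ (k + 1) :=
      (pow_le_pow_left₀ (norm_nonneg _) (by linarith) k).trans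
        (pow_le_pow_right₀ (by linarith [norm_nonneg x]) (Nat.le_succ k))
    calc ‖x‖ ^ k * p (f x) ≤ (1 + ‖x‖) ^ (k + 1) * p (f x) :=
          mul_le_mul_of_nonneg_right h1 (apply_nonneg p _)
      _ ≤ ((Fintype.card (Fin (Module.finrank ℝ V)) + 1) ^ k *
            (1 + ∑ i, |inner ℝ x (stdOrthonormalBasis ℝ V i)| ^ (k + 1))) * p (f x) :=
          mul_le_mul_of_nonneg_right (one_add_pow_le_of_le_sum (norm_nonneg _)
            (fun _ => abs_nonneg _) (norm_le_sum_abs_inner x) k) (apply_nonneg p _)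
      _ = (Fintype.card (Fin (Module.finrank ℝ V)) + 1) ^ k * (p (f x) +
            ∑ i, |inner ℝ x (stdOrthonormalBasis ℝ V i)| ^ (k + 1) * p (f x)) := by
          rw [← Finset.sum_mul]; ring
      _ ≤ _ := mul_le_mul_of_nonneg_left (add_le_add (hB x)
          (Finset.sum_le_sum fun i _ => hC i x)) (by positivity)
  · intro f hf v
    induction hf using Submodule.span_induction with
    | mem f hf => exact hd f hf v
    | zero => exact ⟨0, Submodule.zero_mem _, fun x => hasDirDeriv_zero x v⟩
    | add f g _ _ hf hg =>
      obtain ⟨f', hf', hff⟩ := hf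
      obtain ⟨g', hg', hgg⟩ := hg
      exact ⟨f' + g', Submodule.add_mem _ hf' hg', fun x => (hff x).add (hgg x)⟩
    | smul c f _ hf =>
      obtain ⟨f', hf', hff⟩ := hf
      exact ⟨c • f', Submodule.smul_mem _ c hf', fun x => (hff x).const_smul c⟩

/-- The last entry of the list is the derivative taken first; this exposes the innermost derivative,
as needed for derivatives of Schwartz functions and for commutator arguments. -/
theorem iterDirDeriv_append (l : List V) (v : V) (f : V → A) :
    iterDirDeriv (l ++ [v]) f = iterDirDeriv l (dirDeriv v f) := by
  induction l with
  | nil => rfl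
  | cons u l ih => simp only [List.cons_append, iterDirDeriv, ih]

theorem IsSchwartz.continuous_self {f : V → A} (hf : IsSchwartz f) : Continuous f :=
  hf.continuous []

theorem IsSchwartz.hasLineDer {f : V → A} (hf : IsSchwartz f) (x v : V) :
    HasLineDer f (dirDeriv v f x) x v :=
  hf.hasDirDeriv [] x v

theorem IsSchwartz.dirDeriv {f : V → A} (hf : IsSchwartz f) (v : V) :
    IsSchwartz (dirDeriv v f) where
  continuous l := by rw [← iterDirDeriv_append]; exact hf.continuous _
  hasDirDeriv l x u := by
    rw [← iterDirDeriv_append, ← iterDirDeriv_append]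
    exact hf.hasDirDeriv (l ++ [v]) x u
  decay l := by rw [← iterDirDeriv_append]; exact hf.decay _

theorem IsSchwartz.decay_self {f : V → A} (hf : IsSchwartz f) (k : ℕ) {p : Seminorm ℂ A}
    (hp : Continuous p) : ∃ C : ℝ, ∀ x, ‖x‖ ^ k * p (f x) ≤ C :=
  hf.decay [] k p hp

theorem IsSchwartz.bounded {f : V → A} (hf : IsSchwartz f) {p : Seminorm ℂ A}
    (hp : Continuous p) : ∃ C : ℝ, 0 ≤ C ∧ ∀ x, p (f x) ≤ C := by
  obtain ⟨C, hC⟩ := hf.decay_self 0 hp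
  have hC' : ∀ x, p (f x) ≤ C := fun x => by simpa using hC x
  exact ⟨C, (apply_nonneg p _).trans (hC' 0), hC'⟩

theorem IsSchwartz.coordMul {f : V → A} (hf : IsSchwartz f) (v : V) :
    IsSchwartz (coordMul v f) := by
  -- The product rule leaves the term `⟪v, u⟫ f`, so the class must allow an additional Schwartz
  -- summand `g`.
  refine isSchwartz_of_class (𝒞 := {h | ∃ f g : V → A, IsSchwartz f ∧ IsSchwartz g ∧
    h = RieffelCrossed.coordMul v f + g}) ?_ ?_ ?_ ⟨f, 0, hf, .zero, (add_zero _).symm⟩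
  · rintro _ ⟨f, g, hf, hg, rfl⟩
    exact ((Complex.continuous_ofReal.comp (continuous_const.inner continuous_id)).smul
      hf.continuous_self).add hg.continuous_self
  · rintro _ ⟨f, g, hf, hg, rfl⟩ k p hp
    obtain ⟨C, hC⟩ := hf.decay_self (k + 1) hp
    obtain ⟨D, hD⟩ := hg.decay_self k hp
    refine ⟨‖v‖ * C + D, fun x => ?_⟩
    calc ‖x‖ ^ k * p (((inner ℝ v x : ℝ) : ℂ) • f x + g x)
        ≤ ‖x‖ ^ k * (‖v‖ * ‖x‖ * p (f x) + p (g x)) := by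
          refine mul_le_mul_of_nonneg_left ((map_add_le_add p _ _).trans
            (add_le_add_left ?_ _)) (by positivity)
          rw [map_smul_eq_mul, Complex.norm_real]
          exact mul_le_mul_of_nonneg_right (norm_inner_le_norm v x) (apply_nonneg p _)
      _ = ‖v‖ * (‖x‖ ^ (k + 1) * p (f x)) + ‖x‖ ^ k * p (g x) := by ring
      _ ≤ _ := add_le_add (mul_le_mul_of_nonneg_left (hC x) (norm_nonneg v)) (hD x)
  · rintro _ ⟨f, g, hf, hg, rfl⟩ u
    refine ⟨_, ⟨RieffelCrossed.dirDeriv u f, ((inner ℝ v u : ℝ) : ℂ) • f +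
      RieffelCrossed.dirDeriv u g, hf.dirDeriv u, (hf.smul _).add (hg.dirDeriv u), rfl⟩, fun x => ?_⟩
    have := (hasLineDer_coordMul v (hf.hasLineDer x u)).add (hg.hasLineDer x u)
    rw [add_assoc] at this
    exact this

theorem IsSchwartz.clm {B : Type*} [AddCommGroup B] [Module ℂ B] [TopologicalSpace B] [T2Space B]
    {f : V → A} (hf : IsSchwartz f) (T : A →L[ℂ] B) : IsSchwartz fun x => T (f x) := by
  refine isSchwartz_of_class (𝒞 := {h | ∃ f : V → A, IsSchwartz f ∧ h = fun x => T (f x)})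
    ?_ ?_ ?_ ⟨f, hf, rfl⟩
  · rintro _ ⟨f, hf, rfl⟩
    exact T.continuous.comp hf.continuous_self
  · rintro _ ⟨f, hf, rfl⟩ k p hp
    exact hf.decay_self k (p := p.comp T.toLinearMap) (hp.comp T.continuous)
  · rintro _ ⟨f, hf, rfl⟩ u
    exact ⟨_, ⟨_, hf.dirDeriv u, rfl⟩, fun x => (hf.hasLineDer x u).clm T⟩

theorem IsSchwartz.comp_sub {f : V → A} (hf : IsSchwartz f) (c : V) :
    IsSchwartz fun x => f (x - c) := by
  refine isSchwartz_of_class (𝒞 := {h | ∃ f : V → A, IsSchwartz f ∧ h = fun x => f (x - c)})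
    ?_ ?_ ?_ ⟨f, hf, rfl⟩
  · rintro _ ⟨f, hf, rfl⟩
    exact hf.continuous_self.comp (continuous_id.sub continuous_const)
  · rintro _ ⟨f, hf, rfl⟩ k p hp
    obtain ⟨B, hB0, hB⟩ := hf.bounded hp
    obtain ⟨C, hC⟩ := hf.decay_self k hp
    refine ⟨2 ^ k * (C + ‖c‖ ^ k * B), fun x => ?_⟩
    have h1 : ‖x‖ ^ k ≤ 2 ^ k * (‖x - c‖ ^ k + ‖c‖ ^ k) := by
      have h2 : ‖x‖ ≤ ‖x - c‖ + ‖c‖ := by simpa using norm_add_le (x - c) c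
      refine (pow_le_pow_left₀ (norm_nonneg _) h2 k).trans ?_
      refine (add_pow_le (norm_nonneg _) (norm_nonneg _) k).trans ?_
      exact mul_le_mul_of_nonneg_right (pow_le_pow_right₀ one_le_two (Nat.sub_le k 1))
        (by positivity)
    calc ‖x‖ ^ k * p (f (x - c)) ≤ 2 ^ k * (‖x - c‖ ^ k + ‖c‖ ^ k) * p (f (x - c)) :=
          mul_le_mul_of_nonneg_right h1 (apply_nonneg p _)
      _ = 2 ^ k * (‖x - c‖ ^ k * p (f (x - c)) + ‖c‖ ^ k * p (f (x - c))) := by ring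
      _ ≤ _ := mul_le_mul_of_nonneg_left (add_le_add (hC _)
          (mul_le_mul_of_nonneg_left (hB _) (by positivity))) (by positivity)
  · rintro _ ⟨f, hf, rfl⟩ u
    refine ⟨_, ⟨_, hf.dirDeriv u, rfl⟩, fun x => ?_⟩
    have := HasLineDer.comp_add_right (x := x) (-c) (by
      simpa only [← sub_eq_add_neg] using hf.hasLineDer (x - c) u)
    simpa only [← sub_eq_add_neg] using! this

section Integrable

variable [FiniteDimensional ℝ V]

variable (V) in
/-- The exponent of an integrable weight on `V`. -/
def decayOrder : ℕ := Module.finrank ℝ V + 1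

theorem decay_le_of_bounds {p : Seminorm ℂ A} {a : A} {x : V} {B C : ℝ} (hB : p a ≤ B)
    (hC : ‖x‖ ^ decayOrder V * p a ≤ C) :
    p a ≤ 2 ^ decayOrder V * (B + C) * (1 + ‖x‖) ^ (-(decayOrder V : ℝ)) := by
  rw [Real.rpow_neg (by positivity), Real.rpow_natCast, ← div_eq_mul_inv,
    le_div_iff₀ (by positivity)]
  have h1 : (1 + ‖x‖) ^ decayOrder V ≤ 2 ^ decayOrder V * (1 + ‖x‖ ^ decayOrder V) := by
    refine (add_pow_le zero_le_one (norm_nonneg _) _).trans ?_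
    rw [one_pow]
    exact mul_le_mul_of_nonneg_right (pow_le_pow_right₀ one_le_two (Nat.sub_le _ 1))
      (by positivity)
  calc p a * (1 + ‖x‖) ^ decayOrder V ≤ p a * (2 ^ decayOrder V * (1 + ‖x‖ ^ decayOrder V)) :=
        mul_le_mul_of_nonneg_left h1 (apply_nonneg p _)
    _ = 2 ^ decayOrder V * (p a + ‖x‖ ^ decayOrder V * p a) := by ring
    _ ≤ _ := mul_le_mul_of_nonneg_left (add_le_add hB hC) (by positivity)

variable [MeasurableSpace V] [BorelSpace V]

variable (V) in
theorem integrable_decayOrder : Integrable fun x : V => (1 + ‖x‖) ^ (-(decayOrder V : ℝ)) :=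
  integrable_one_add_norm (by rw [decayOrder]; exact_mod_cast Nat.lt_succ_self _)

theorem IsSchwartz.integrable_seminorm {f : V → A} (hf : IsSchwartz f) {p : Seminorm ℂ A}
    (hp : Continuous p) : Integrable fun x => p (f x) := by
  obtain ⟨B, -, hB⟩ := hf.bounded hp
  obtain ⟨C, hC⟩ := hf.decay_self (decayOrder V) hp
  refine ((integrable_decayOrder V).const_mul (2 ^ decayOrder V * (B + C))).mono'
    (hp.comp hf.continuous_self).aestronglyMeasurable (ae_of_all _ fun x => ?_)
  rw [Real.norm_eq_abs, abs_of_nonneg (apply_nonneg p _)]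
  exact decay_le_of_bounds (hB x) (hC x)

end Integrable

end Schwartz

/-! ### Bounded bilinear operations -/

section Bilin

variable {A : Type*} [AddCommGroup A] [Module ℂ A] [TopologicalSpace A]

/-- A bilinear operation which is bounded with respect to the continuous seminorms. -/
def SeminormBdd (m : A →ₗ[ℂ] A →ₗ[ℂ] A) : Prop :=
  ∀ p : Seminorm ℂ A, Continuous p →
    ∃ q : Seminorm ℂ A, Continuous q ∧ ∀ a b, p (m a b) ≤ q a * q b

theorem continuous_seminorm_sup {p q : Seminorm ℂ A} (hp : Continuous p) (hq : Continuous q) :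
    Continuous (p ⊔ q : Seminorm ℂ A) :=
  Continuous.sup hp hq

theorem continuous_seminorm_add {p q : Seminorm ℂ A} (hp : Continuous p) (hq : Continuous q) :
    Continuous (p + q : Seminorm ℂ A) :=
  Continuous.add hp hq

theorem continuous_seminorm_smul {p : Seminorm ℂ A} (hp : Continuous p) (c : NNReal) :
    Continuous (c • p : Seminorm ℂ A) := by
  have : (⇑(c • p : Seminorm ℂ A)) = fun a => (c : ℝ) * p a := rfl
  rw [this]
  exact continuous_const.mul hp

theorem continuous_seminorm_finset_sup {ι : Type*} (s : Finset ι) {p : ι → Seminorm ℂ A}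
    (hp : ∀ i, Continuous (p i)) : Continuous (s.sup p : Seminorm ℂ A) :=
  Finset.sup_induction (p := fun q : Seminorm ℂ A => Continuous q) continuous_const
    (fun _ h _ h' => continuous_seminorm_sup h h') fun i _ => hp i

theorem SeminormBdd.of_const {m : A →ₗ[ℂ] A →ₗ[ℂ] A} (h : ∀ p : Seminorm ℂ A, Continuous p →
    ∃ (q : Seminorm ℂ A) (C : ℝ), Continuous q ∧ ∀ a b, p (m a b) ≤ C * (q a * q b)) :
    SeminormBdd m := by
  intro p hp
  obtain ⟨q, C, hq, hC⟩ := h p hp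
  -- The constant has to be absorbed into both copies of `q`, which requires `C ≤ c ^ 2`; this
  -- follows from `1 ≤ c` and `C ≤ c`.
  set c : NNReal := ⟨max 1 C, le_max_of_le_left zero_le_one⟩
  have hc1 : (1 : ℝ) ≤ c := le_max_left 1 C
  have hcC : C ≤ (c : ℝ) := le_max_right 1 C
  refine ⟨c • q, continuous_seminorm_smul hq c, fun a b => (hC a b).trans ?_⟩
  have hnn : 0 ≤ q a * q b := mul_nonneg (apply_nonneg q a) (apply_nonneg q b)
  calc C * (q a * q b) ≤ c * (q a * q b) := mul_le_mul_of_nonneg_right hcC hnn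
    _ ≤ c * (c * (q a * q b)) :=
        mul_le_mul_of_nonneg_left (le_mul_of_one_le_left hnn hc1) (NNReal.coe_nonneg c)
    _ = (c * q a) * (c * q b) := by ring

variable [IsTopologicalAddGroup A] [PolynormableSpace ℂ A]

/-- Continuity at the origin bounds `p (m a b)` on a ball, and homogeneity does the rest.
Normalizing by `q + δ` and letting `δ → 0` covers vectors on which `q` vanishes. -/
theorem seminormBdd_of_continuous {m : A →ₗ[ℂ] A →ₗ[ℂ] A}
    (hm : Continuous fun q : A × A => m q.1 q.2) : SeminormBdd m := by
  intro p hp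
  have h0 : {q : A × A | p (m q.1 q.2) < 1} ∈ 𝓝 (0, 0) := by
    refine (hp.comp hm).continuousAt.preimage_mem_nhds (Iio_mem_nhds ?_)
    simp
  rw [nhds_prod_eq, mem_prod_iff] at h0
  obtain ⟨s, hs, t, ht, hst⟩ := h0
  obtain ⟨⟨I, r⟩, hr, hI⟩ :=
    (PolynormableSpace.withSeminorms ℂ A).hasBasis_zero_ball.mem_iff.mp (inter_mem hs ht)
  set q₀ : Seminorm ℂ A := I.sup fun p : {p : Seminorm ℂ A // Continuous p} => p.1
  have hq₀ : Continuous q₀ := continuous_seminorm_finset_sup I fun p => p.2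
  have hr : 0 < r := hr
  let c : NNReal := ⟨r⁻¹, (inv_pos.mpr hr).le⟩
  set q : Seminorm ℂ A := c • q₀
  have hqa : ∀ a, q a = r⁻¹ * q₀ a := fun a => rfl
  have hq1 : ∀ a b, q a < 1 → q b < 1 → p (m a b) ≤ 1 := by
    intro a b ha hb
    have hmem : ∀ a, q a < 1 → a ∈ s ∩ t := fun a ha => hI (by
      rw [Seminorm.mem_ball_zero]
      rw [hqa, inv_mul_lt_one₀ hr] at ha
      exact ha)
    exact (hst (show ((a, b) : A × A) ∈ s ×ˢ t from ⟨(hmem a ha).1, (hmem b hb).2⟩)).le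
  refine ⟨q, continuous_seminorm_smul hq₀ _, fun a b => ?_⟩
  have key : ∀ δ : ℝ, 0 < δ → p (m a b) ≤ (q a + δ) * (q b + δ) := by
    intro δ hδ
    have hs : ∀ c : A, 0 < q c + δ := fun c => add_pos_of_nonneg_of_pos (apply_nonneg q c) hδ
    have hlt : ∀ c : A, q ((((q c + δ)⁻¹ : ℝ) : ℂ) • c) < 1 := by
      intro c
      rw [map_smul_eq_mul, Complex.norm_real, Real.norm_eq_abs, abs_of_pos (inv_pos.mpr (hs c)),
        inv_mul_lt_one₀ (hs c)]
      linarith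
    have := hq1 _ _ (hlt a) (hlt b)
    rw [LinearMap.map_smul, LinearMap.map_smul, LinearMap.smul_apply, map_smul_eq_mul,
      map_smul_eq_mul, Complex.norm_real, Complex.norm_real, Real.norm_eq_abs, Real.norm_eq_abs,
      abs_of_pos (inv_pos.mpr (hs a)), abs_of_pos (inv_pos.mpr (hs b))] at this
    have h2 := (hs a)
    have h3 := (hs b)
    field_simp at this
    linarith
  have hlim : Tendsto (fun δ : ℝ => (q a + δ) * (q b + δ)) (𝓝[>] 0)
      (𝓝 ((q a + 0) * (q b + 0))) :=
    ((continuous_const.add continuous_id).mul (continuous_const.add continuous_id)).tendsto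
      (0 : ℝ) |>.mono_left nhdsWithin_le_nhds
  rw [add_zero, add_zero] at hlim
  refine ge_of_tendsto hlim ?_
  filter_upwards [self_mem_nhdsWithin] with δ hδ using key δ hδ

theorem SeminormBdd.continuous {m : A →ₗ[ℂ] A →ₗ[ℂ] A} (hm : SeminormBdd m) :
    Continuous fun q : A × A => m q.1 q.2 := by
  rw [continuous_iff_continuousAt]
  rintro ⟨a, b⟩
  refine tendsto_iff_seminorm.mpr fun p hp => ?_
  obtain ⟨q, hq, hm⟩ := hm p hp
  have ha : Tendsto (fun x : A × A => q (x.1 - a)) (𝓝 (a, b)) (𝓝 0) := by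
    have : Continuous fun x : A × A => q (x.1 - a) :=
      hq.comp (continuous_fst.sub continuous_const)
    simpa using this.tendsto (a, b)
  have hb : Tendsto (fun x : A × A => q (x.2 - b)) (𝓝 (a, b)) (𝓝 0) := by
    have : Continuous fun x : A × A => q (x.2 - b) :=
      hq.comp (continuous_snd.sub continuous_const)
    simpa using this.tendsto (a, b)
  have hlim := ((ha.mul hb).add (ha.mul_const (q b))).add (hb.const_mul (q a))
  simp only [mul_zero, zero_mul, add_zero] at hlim
  refine squeeze_zero (fun x => apply_nonneg p _) (fun x => ?_) hlim
  have : m x.1 x.2 - m a b = m (x.1 - a) (x.2 - b) + m (x.1 - a) b + m a (x.2 - b) := by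
    simp only [map_sub, LinearMap.sub_apply]
    abel
  rw [this]
  exact (map_add_le_add p _ _).trans (add_le_add ((map_add_le_add p _ _).trans
    (add_le_add (hm _ _) (hm _ _))) (hm _ _))

end Bilin

/-! ### Smooth isometric actions -/

section Action

variable {V : Type*} [NormedAddCommGroup V] [InnerProductSpace ℝ V]
variable {A : Type*} [NonUnitalRing A] [Module ℂ A] [TopologicalSpace A]

namespace SmoothIsometricAction

theorem polynormableSpace (α : SmoothIsometricAction V A) : PolynormableSpace ℂ A :=
  let ⟨_, hp, _⟩ := α.isometric
  hp.toPolynormableSpace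

variable [IsTopologicalAddGroup A] [PolynormableSpace ℂ A]

/-- A multiple of a finite supremum of the defining seminorms dominates `p`, and invariance passes
to suprema and multiples. Through this lemma every later estimate can discard the group elements. -/
theorem exists_invariant (α : SmoothIsometricAction V A) {p : Seminorm ℂ A} (hp : Continuous p) :
    ∃ q : Seminorm ℂ A, Continuous q ∧ (∀ a, p a ≤ q a) ∧ ∀ x a, q (α.act x a) = q a := by
  obtain ⟨P, hP, hinv⟩ := α.isometric
  obtain ⟨s, C, -, hC⟩ := Seminorm.bound_of_continuous hP p hp
  have : ∀ s : Finset ℕ, Continuous (s.sup P : Seminorm ℂ A) ∧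
      ∀ x a, (s.sup P : Seminorm ℂ A) (α.act x a) = (s.sup P : Seminorm ℂ A) a := fun s =>
    Finset.sup_induction
      (p := fun q : Seminorm ℂ A => Continuous q ∧ ∀ x a, q (α.act x a) = q a)
      ⟨continuous_const, fun x a => rfl⟩
      (fun q hq r hr => ⟨continuous_seminorm_sup hq.1 hr.1, fun x a => by
        rw [Seminorm.sup_apply, Seminorm.sup_apply, hq.2, hr.2]⟩)
      fun i _ => ⟨hP.continuous_seminorm i, hinv i⟩
  exact ⟨C • s.sup P, continuous_seminorm_smul (this s).1 C, hC, fun x a => by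
    rw [smul_apply, smul_apply, (this s).2]⟩

/-- The automorphism `α_x` as a continuous linear map. -/
def actL (α : SmoothIsometricAction V A) (x : V) : A →L[ℂ] A where
  toFun := α.act x
  map_add' := map_add _
  map_smul' := map_smul _
  cont := by
    let T : A →ₗ[ℂ] A :=
      { toFun := α.act x, map_add' := map_add _, map_smul' := map_smul _ }
    refine WithSeminorms.continuous_of_continuous_comp
      (PolynormableSpace.withSeminorms ℂ A) T fun p => ?_
    obtain ⟨q, hq, hpq, hinv⟩ := α.exists_invariant p.2
    exact Seminorm.continuous_of_le hq fun a => (hpq (α.act x a)).trans (hinv x a).le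

theorem actL_apply (α : SmoothIsometricAction V A) (x : V) (a : A) : α.actL x a = α.act x a := rfl

variable [ContinuousSMul ℂ A]

theorem continuous_orbit (α : SmoothIsometricAction V A) (a : A) :
    Continuous fun x => α.act x a :=
  have : ContinuousSMul ℝ A := IsScalarTower.continuousSMul ℂ
  (α.differentiable a).continuous

theorem continuous_act (α : SmoothIsometricAction V A) :
    Continuous fun q : V × A => α.act q.1 q.2 := by
  rw [continuous_iff_continuousAt]
  rintro ⟨x, a⟩
  refine tendsto_iff_seminorm.mpr fun p hp => ?_
  obtain ⟨q, hq, hpq, hinv⟩ := α.exists_invariant hp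
  have h1 : Continuous fun y : V × A => q (y.2 - a) + q (α.act y.1 a - α.act x a) :=
    (hq.comp (continuous_snd.sub continuous_const)).add
      (hq.comp (((α.continuous_orbit a).comp continuous_fst).sub continuous_const))
  have h2 := h1.tendsto (x, a)
  simp only [sub_self, map_zero, add_zero] at h2
  refine squeeze_zero (fun _ => apply_nonneg p _) (fun y => ?_) h2
  have : α.act y.1 y.2 - α.act x a = α.act y.1 (y.2 - a) + (α.act y.1 a - α.act x a) := by
    rw [map_sub]; abel
  rw [this]
  refine (hpq _).trans ((map_add_le_add q _ _).trans ?_)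
  rw [hinv]

/-- The generator of the action in the direction `v`. -/
def gen (α : SmoothIsometricAction V A) (v : V) : A →L[ℂ] A := (α.bounded_deriv v).choose

/-- The difference quotient is `α_{Lx}` of the quotient for the orbit of `g(x)`, plus `α_{Lx+tLu}`
of the quotient of `g`; the second term converges by joint continuity of the action. -/
theorem hasLineDer_act (α : SmoothIsometricAction V A) {W : Type*} [AddCommGroup W] [Module ℝ W]
    (L : W →ₗ[ℝ] V) {g : W → A} {d : A} {x u : W} (hg : HasLineDer g d x u) :
    HasLineDer (fun w => α.act (L w) (g w)) (α.act (L x) (α.gen (L u) (g x) + d)) x u := by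
  have h1 : Tendsto (fun t : ℝ => L x + t • L u) (𝓝[≠] 0) (𝓝 (L x)) := by
    have : Continuous fun t : ℝ => L x + t • L u := by fun_prop
    simpa using (this.tendsto (0 : ℝ)).mono_left nhdsWithin_le_nhds
  have h2 := (α.continuous_act.tendsto (L x, d)).comp (h1.prodMk_nhds hg)
  have h3 := ((α.bounded_deriv (L u)).choose_spec (g x))
  have h4 := ((α.actL (L x)).continuous.tendsto _).comp h3
  rw [map_add]
  refine (h4.add h2).congr fun t => ?_
  simp only [Function.comp, actL_apply, map_smul, map_sub, ← α.act_add, map_add, α.act_zero,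
    zero_add, ← smul_add]
  congr 1
  abel

variable [T2Space A]

theorem isSchwartz_act (α : SmoothIsometricAction V A) {g : V → A} (hg : IsSchwartz g)
    (L : V →ₗ[ℝ] V) (hL : Continuous L) : IsSchwartz fun x => α.act (L x) (g x) := by
  refine isSchwartz_of_class (𝒞 := {h | ∃ g : V → A, IsSchwartz g ∧
    h = fun x => α.act (L x) (g x)}) ?_ ?_ ?_ ⟨g, hg, rfl⟩
  · rintro _ ⟨g, hg, rfl⟩
    exact α.continuous_act.comp (hL.prodMk hg.continuous_self)
  · rintro _ ⟨g, hg, rfl⟩ k p hp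
    obtain ⟨q, hq, hpq, hinv⟩ := α.exists_invariant hp
    obtain ⟨C, hC⟩ := hg.decay_self k hq
    refine ⟨C, fun x => le_trans (mul_le_mul_of_nonneg_left ?_ (by positivity)) (hC x)⟩
    exact (hpq _).trans (hinv _ _).le
  · rintro _ ⟨g, hg, rfl⟩ v
    exact ⟨_, ⟨_, (hg.clm (α.gen (L v))).add (hg.dirDeriv v), rfl⟩, fun x =>
      α.hasLineDer_act L (hg.hasLineDer x v)⟩

/-- Derivatives of an orbit map are orbit maps of images of `a` under powers of a generator. The
bound is a continuous seminorm of `a`, not just a constant depending on `a`; this later yields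
continuity of the deformed product. -/
theorem exists_lineBdd_act (α : SmoothIsometricAction V A) {W : Type*} [NormedAddCommGroup W]
    [NormedSpace ℝ W] (L : W →L[ℝ] V) (u : W) (n : ℕ) {p : Seminorm ℂ A} (hp : Continuous p) :
    ∃ q : Seminorm ℂ A, Continuous q ∧
      ∀ a, LineBdd p u n (fun _ => q a) fun w => α.act (L w) a := by
  obtain ⟨r, hr, hpr, hinv⟩ := α.exists_invariant hp
  have h0 : ∀ a, Continuous (fun w => α.act (L w) a) ∧ ∀ w, p (α.act (L w) a) ≤ r a := fun a =>
    ⟨(α.continuous_orbit a).comp L.continuous, fun w => (hpr _).trans (hinv _ _).le⟩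
  induction n with
  | zero => exact ⟨r, hr, h0⟩
  | succ n ih =>
    obtain ⟨q, hq, h⟩ := ih
    refine ⟨r ⊔ q.comp (α.gen (L u)).toLinearMap,
      continuous_seminorm_sup hr (hq.comp (α.gen (L u)).continuous), fun a => ?_⟩
    refine ⟨⟨(h0 a).1, fun w => ((h0 a).2 w).trans le_sup_left⟩,
      fun w => α.act (L w) (α.gen (L u) a), fun w => ?_, (h _).mono fun w => ?_⟩
    · have := α.hasLineDer_act L.toLinearMap (HasLineDer.const a w u)
      rwa [add_zero] at this
    · exact (le_sup_right : (q.comp (α.gen (L u)).toLinearMap) a ≤ _)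

end SmoothIsometricAction

end Action

/-! ### The Fourier transform on `S(V; A)` -/

section Fourier

variable {V : Type*} [NormedAddCommGroup V] [InnerProductSpace ℝ V] [FiniteDimensional ℝ V]
  [MeasurableSpace V] [BorelSpace V]
variable {A : Type*} [AddCommGroup A] [Module ℂ A] [UniformSpace A] [IsUniformAddGroup A]
  [ContinuousSMul ℂ A] [PolynormableSpace ℂ A] [CompleteSpace A] [T2Space A]

/-- Integration by parts against the constant `1`. Applied to functions containing a character, it
trades coordinate multiplications for derivatives. -/
theorem vIntegral_eq_zero_of_hasLineDer {H H' : V → A} {v : V} (hH : VInt volume H)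
    (hH' : VInt volume H') (h : ∀ x, HasLineDer H (H' x) x v) : vIntegral volume H' = 0 := by
  refine eq_of_toCompl_eq fun p hp => ?_
  rw [hH'.toCompl_vIntegral hp, map_zero]
  have key := integral_bilinear_hasLineDerivAt_right_eq_neg_left_of_integrable
    (μ := (volume : Measure V)) (f := fun _ => (1 : ℂ)) (f' := fun _ => 0)
    (g := fun x => toCompl p (H x)) (g' := fun x => toCompl p (H' x)) (v := v)
    (B := ContinuousLinearMap.lsmul ℝ ℂ) (by simp) (by simpa using hH' p hp)
    (by simpa using hH p hp)
    (fun x _ => hasDerivAt_const (0 : ℝ) (1 : ℂ))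
    (fun x _ => hasLineDer_iff_toCompl.mp (h x) p hp)
  simpa using key

theorem continuous_e_left (y : V) : Continuous fun x : V => e x y :=
  continuous_e.comp (continuous_id.prodMk continuous_const)

theorem continuous_e_right (x : V) : Continuous fun y : V => e x y :=
  continuous_e.comp (continuous_const.prodMk continuous_id)

theorem hasLineDer_e_smul {f : V → A} {d : A} {x u : V} (y : V) (hf : HasLineDer f d x u) :
    HasLineDer (fun x => e x y • f x)
      (e x y • (((2 * Real.pi * Complex.I * (inner ℝ y u : ℝ)) : ℂ) • f x + d)) x u := by
  have h1 : HasLineDer (fun x => e x y)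
      (2 * Real.pi * Complex.I * (inner ℝ y u : ℝ) * e x y) x u := by
    refine hasLineDer_iff_hasLineDerivAt.mpr ?_
    have := hasLineDerivAt_fourierChar (innerSL ℝ y) x u
    simp only [innerSL_apply_apply] at this
    simpa only [e, real_inner_comm y] using this
  have := HasLineDer.bilin (LinearMap.lsmul ℂ A) continuous_smul h1 hf
  rw [smul_add, smul_smul, mul_comm (e x y)]
  exact this

theorem IsSchwartz.vInt_smul {f : V → A} (hf : IsSchwartz f) {c : V → ℂ} (hc : Continuous c)
    (h : ∀ x, ‖c x‖ = 1) : VInt volume fun x => c x • f x :=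
  VInt.of_bound (hc.smul hf.continuous_self) fun p hp =>
    ⟨_, hf.integrable_seminorm hp, fun x => by rw [map_smul_eq_mul, h, one_mul]⟩

theorem IsSchwartz.vInt {f : V → A} (hf : IsSchwartz f) : VInt volume f := by
  simpa using hf.vInt_smul continuous_const fun _ : V => norm_one (α := ℂ)

theorem IsSchwartz.vInt_fourier {f : V → A} (hf : IsSchwartz f) (y : V) :
    VInt volume fun x => e (-x) y • f x :=
  hf.vInt_smul ((continuous_e_left y).comp continuous_neg) fun _ => norm_e _ _

theorem IsSchwartz.seminorm_fourier_le {f : V → A} (hf : IsSchwartz f) {p : Seminorm ℂ A}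
    (hp : Continuous p) (y : V) : p (fourier f y) ≤ ∫ x, p (f x) := by
  refine ((hf.vInt_fourier y).seminorm_vIntegral_le hp).trans_eq ?_
  simp only [map_smul_eq_mul, norm_e, one_mul]

theorem IsSchwartz.continuous_fourier {f : V → A} (hf : IsSchwartz f) : Continuous (fourier f) :=
  continuous_vIntegral (fun y => hf.vInt_fourier y)
    (fun x => (continuous_e_right (-x)).smul continuous_const) fun p hp =>
    ⟨_, hf.integrable_seminorm hp, fun y x => by rw [map_smul_eq_mul, norm_e, one_mul]⟩

theorem fourier_smul {f : V → A} (hf : IsSchwartz f) (c : ℂ) :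
    fourier (c • f) = c • fourier f := by
  funext y
  rw [Pi.smul_apply, fourier, fourier, ← (hf.vInt_fourier y).vIntegral_smul]
  simp only [Pi.smul_apply, smul_comm c]

theorem fourier_add {f g : V → A} (hf : IsSchwartz f) (hg : IsSchwartz g) :
    fourier (f + g) = fourier f + fourier g := by
  funext y
  rw [Pi.add_apply, fourier, fourier, fourier,
    ← (hf.vInt_fourier y).vIntegral_add (hg.vInt_fourier y)]
  simp only [Pi.add_apply, smul_add]

theorem hasLineDer_fourier {f : V → A} (hf : IsSchwartz f) (y v : V) :
    HasLineDer (fourier f)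
      (((-(2 * Real.pi * Complex.I) : ℂ) • fourier (coordMul v f)) y) y v := by
  have hd : ∀ (y : V) (x : V), HasLineDer (fun y => e (-x) y • f x)
      (e (-x) y • ((-(2 * Real.pi * Complex.I) : ℂ) • coordMul v f) x) y v := by
    intro y x
    have := hasLineDer_e_smul (-x) (HasLineDer.const (f x) y v)
    rw [inner_neg_left, real_inner_comm, add_zero] at this
    simp only [e_comm _ (-x)] at this
    convert this using 2
    simp only [Pi.smul_apply, coordMul, smul_smul]
    congr 1
    push_cast
    ring
  rw [← fourier_smul (hf.coordMul v)]
  have hs := (hf.coordMul v).smul (-(2 * Real.pi * Complex.I) : ℂ)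
  exact hasLineDer_vIntegral (fun y => hf.vInt_fourier y) (fun y => hs.vInt_fourier y) hd
    (fun p hp => ⟨_, hs.integrable_seminorm hp, fun y x => by
      rw [map_smul_eq_mul, norm_e, one_mul]⟩) y

theorem fourier_dirDeriv {f : V → A} (hf : IsSchwartz f) (v : V) :
    fourier (dirDeriv v f) = (2 * Real.pi * Complex.I : ℂ) • coordMul v (fourier f) := by
  funext y
  have hd : ∀ x, HasLineDer (fun x => e (-x) y • f x)
      (e (-x) y • dirDeriv v f x +
        (-(2 * Real.pi * Complex.I * (inner ℝ v y : ℝ)) : ℂ) • e (-x) y • f x) x v := by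
    intro x
    have := hasLineDer_e_smul (-y) (hf.hasLineDer x v)
    rw [inner_neg_left, real_inner_comm] at this
    simp only [e_neg_right] at this
    convert this using 1
    simp only [smul_add, smul_smul]
    rw [add_comm]
    congr 2
    push_cast
    ring
  have h0 := vIntegral_eq_zero_of_hasLineDer (hf.vInt_fourier y)
    (((hf.dirDeriv v).vInt_fourier y).add ((hf.vInt_fourier y).smul _)) hd
  rw [((hf.dirDeriv v).vInt_fourier y).vIntegral_add ((hf.vInt_fourier y).smul _),
    (hf.vInt_fourier y).vIntegral_smul, neg_smul, add_neg_eq_zero] at h0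
  rw [fourier, h0, Pi.smul_apply, coordMul, smul_smul]
  rfl

theorem coordMul_fourier {f : V → A} (hf : IsSchwartz f) (v : V) :
    coordMul v (fourier f) = (2 * Real.pi * Complex.I : ℂ)⁻¹ • fourier (dirDeriv v f) := by
  rw [fourier_dirDeriv hf, smul_smul, inv_mul_cancel₀ Complex.two_pi_I_ne_zero, one_smul]

theorem IsSchwartz.fourier {f : V → A} (hf : IsSchwartz f) : IsSchwartz (fourier f) := by
  refine isSchwartz_of_span (𝒢 := {h | ∃ f : V → A, IsSchwartz f ∧
    h = RieffelCrossed.fourier f}) ?_ ?_ ?_ ?_ (Submodule.subset_span ⟨f, hf, rfl⟩)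
  · rintro _ ⟨f, hf, rfl⟩
    exact hf.continuous_fourier
  · rintro _ ⟨f, hf, rfl⟩ p hp
    exact ⟨_, hf.seminorm_fourier_le hp⟩
  · rintro _ ⟨f, hf, rfl⟩ v
    exact ⟨_, Submodule.smul_mem _ _ (Submodule.subset_span ⟨_, hf.coordMul v, rfl⟩),
      fun y => hasLineDer_fourier hf y v⟩
  · rintro _ ⟨f, hf, rfl⟩ v
    rw [coordMul_fourier hf]
    exact Submodule.smul_mem _ _ (Submodule.subset_span ⟨_, hf.dirDeriv v, rfl⟩)

theorem IsSchwartz.comp_neg {f : V → A} (hf : IsSchwartz f) : IsSchwartz fun x => f (-x) := by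
  refine isSchwartz_of_class (𝒞 := {h | ∃ f : V → A, IsSchwartz f ∧
    h = fun x => f (-x)}) ?_ ?_ ?_ ⟨f, hf, rfl⟩
  · rintro _ ⟨f, hf, rfl⟩
    exact hf.continuous_self.comp continuous_neg
  · rintro _ ⟨f, hf, rfl⟩ k p hp
    obtain ⟨C, hC⟩ := hf.decay_self k hp
    exact ⟨C, fun x => by simpa using hC (-x)⟩
  · rintro _ ⟨f, hf, rfl⟩ v
    refine ⟨_, ⟨_, (hf.dirDeriv (-v)), rfl⟩, fun x => ?_⟩
    have := HasLineDer.comp_linear (f := f) (u := v) (x := x) (-LinearMap.id) 0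
      (by simpa using hf.hasLineDer (-x) (-v))
    simpa using! this
/-- The inverse Fourier transform `x ↦ ∫ f(y) e(x · y) dy`. -/
def fourierInv (f : V → A) (x : V) : A := vIntegral volume fun y => e x y • f y

theorem fourierInv_eq_fourier_neg (f : V → A) (x : V) : fourierInv f x = fourier f (-x) := by
  simp only [fourierInv, fourier, e_neg_right, neg_neg, e_comm x]

theorem IsSchwartz.fourierInv {f : V → A} (hf : IsSchwartz f) : IsSchwartz (fourierInv f) := by
  have : RieffelCrossed.fourierInv f = fun x => RieffelCrossed.fourier f (-x) :=
    funext (fourierInv_eq_fourier_neg f)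
  rw [this]
  exact hf.fourier.comp_neg

theorem IsSchwartz.vInt_fourierInv {f : V → A} (hf : IsSchwartz f) (x : V) :
    VInt volume fun y => e x y • f y :=
  hf.vInt_smul (continuous_e_right x) fun _ => norm_e _ _

theorem toCompl_fourier {f : V → A} (hf : IsSchwartz f) {p : Seminorm ℂ A} (hp : Continuous p) :
    (fun y => toCompl p (fourier f y)) = FourierTransform.fourier fun x => toCompl p (f x) := by
  funext y
  rw [fourier, (hf.vInt_fourier y).toCompl_vIntegral hp, Real.fourier_eq]
  simp only [map_smul, e, inner_neg_left, Circle.smul_def]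

theorem toCompl_fourierInv {f : V → A} (hf : IsSchwartz f) {p : Seminorm ℂ A}
    (hp : Continuous p) : (fun y => toCompl p (fourierInv f y)) =
      FourierTransformInv.fourierInv fun x => toCompl p (f x) := by
  funext y
  rw [fourierInv, (hf.vInt_fourierInv y).toCompl_vIntegral hp, Real.fourierInv_eq]
  simp only [map_smul, e, real_inner_comm y, Circle.smul_def]

theorem fourierInv_fourier {f : V → A} (hf : IsSchwartz f) : fourierInv (fourier f) = f := by
  funext x
  refine eq_of_toCompl_eq fun p hp => ?_
  have h1 := congrFun (toCompl_fourierInv hf.fourier hp) x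
  have h2 : Integrable (fun y => toCompl p (fourier f y)) := hf.fourier.vInt p hp
  rw [toCompl_fourier hf hp] at h1
  rw [toCompl_fourier hf hp] at h2
  exact h1.trans (congrFun (((continuous_toCompl hp).comp hf.continuous_self).fourierInv_fourier_eq
    (hf.vInt p hp) h2) x)

theorem fourier_fourierInv {f : V → A} (hf : IsSchwartz f) : fourier (fourierInv f) = f := by
  funext x
  refine eq_of_toCompl_eq fun p hp => ?_
  have h1 := congrFun (toCompl_fourier hf.fourierInv hp) x
  have h2 : Integrable (fun y => toCompl p (fourier f y)) := hf.fourier.vInt p hp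
  rw [toCompl_fourierInv hf hp] at h1
  rw [toCompl_fourier hf hp] at h2
  exact h1.trans (congrFun (((continuous_toCompl hp).comp hf.continuous_self).fourier_fourierInv_eq
    (hf.vInt p hp) h2) x)

theorem fourier_injective {f g : V → A} (hf : IsSchwartz f) (hg : IsSchwartz g)
    (h : fourier f = fourier g) : f = g := by
  rw [← fourierInv_fourier hf, h, fourierInv_fourier hg]

end Fourier

/-! ### Continuous operators on `S(V; A)` -/

section Operators

variable {V : Type*} [NormedAddCommGroup V] [InnerProductSpace ℝ V]
variable {A : Type*} [AddCommGroup A] [Module ℂ A] [TopologicalSpace A] [T2Space A]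
  [IsTopologicalAddGroup A] [ContinuousSMul ℂ A]

theorem withSeminorms_schwartzFn : WithSeminorms (schwartzSeminormFamily V A) := ⟨rfl⟩

instance : IsTopologicalAddGroup (SchwartzFn V A) :=
  withSeminorms_schwartzFn.topologicalAddGroup

instance : ContinuousSMul ℂ (SchwartzFn V A) :=
  withSeminorms_schwartzFn.continuousSMul

namespace SchwartzFn

@[ext]
theorem ext {f g : SchwartzFn V A} (h : ∀ x, f x = g x) : f = g := Subtype.ext (funext h)

theorem continuous_schwartzSeminorm (p : {p : Seminorm ℂ A // Continuous p}) (k : ℕ)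
    (l : List V) : Continuous (schwartzSeminorm p k l) :=
  withSeminorms_schwartzFn.continuous_seminorm (p, k, l)

theorem le_schwartzSeminorm (p : {p : Seminorm ℂ A // Continuous p}) (k : ℕ) (l : List V)
    (f : SchwartzFn V A) (x : V) :
    ‖x‖ ^ k * p.1 (iterDirDeriv l f x) ≤ schwartzSeminorm p k l f := by
  obtain ⟨C, hC⟩ := f.2.decay l k p.1 p.2
  exact le_ciSup (f := fun x : V => ‖x‖ ^ k * p.1 (iterDirDeriv l f x))
    ⟨C, by rintro _ ⟨y, rfl⟩; exact hC y⟩ x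

theorem schwartzSeminorm_le {p : {p : Seminorm ℂ A // Continuous p}} {k : ℕ} {l : List V}
    {f : SchwartzFn V A} {C : ℝ} (h : ∀ x, ‖x‖ ^ k * p.1 (iterDirDeriv l f x) ≤ C) :
    schwartzSeminorm p k l f ≤ C :=
  ciSup_le h

variable (V A) in
theorem continuous_of_bound (T : SchwartzFn V A →ₗ[ℂ] SchwartzFn V A)
    (h : ∀ (p : {p : Seminorm ℂ A // Continuous p}) (k : ℕ) (l : List V),
      ∃ Q : Seminorm ℂ (SchwartzFn V A), Continuous Q ∧ ∀ f, schwartzSeminorm p k l (T f) ≤ Q f) :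
    Continuous T := by
  refine withSeminorms_schwartzFn.continuous_of_continuous_comp T fun i => ?_
  obtain ⟨Q, hQ, h⟩ := h i.1 i.2.1 i.2.2
  exact Seminorm.continuous_of_le hQ h

/-- The derivative in the direction `u` as an operator on `S(V; A)`. -/
def derivL (u : V) : SchwartzFn V A →L[ℂ] SchwartzFn V A where
  toFun f := ⟨dirDeriv u f, f.2.dirDeriv u⟩
  map_add' f g := Subtype.ext (f.2.iterDirDeriv_add g.2 [u])
  map_smul' c f := Subtype.ext (f.2.iterDirDeriv_smul c [u])
  cont := continuous_of_bound V A
    { toFun := fun f => ⟨dirDeriv u f, f.2.dirDeriv u⟩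
      map_add' := fun f g => Subtype.ext (f.2.iterDirDeriv_add g.2 [u])
      map_smul' := fun c f => Subtype.ext (f.2.iterDirDeriv_smul c [u]) } fun p k l =>
    ⟨_, continuous_schwartzSeminorm p k (l ++ [u]), fun f => schwartzSeminorm_le fun x => by
      have := le_schwartzSeminorm p k (l ++ [u]) f x
      rwa [iterDirDeriv_append] at this⟩

theorem coe_derivL (u : V) (f : SchwartzFn V A) : (derivL u f : V → A) = dirDeriv u f := rfl

/-- A linear operator on `S(V; A)` is continuous if it is bounded in the sup-norms and its
commutators with the derivatives can be expressed through itself. -/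
theorem continuous_of_commutator (T : SchwartzFn V A →ₗ[ℂ] SchwartzFn V A)
    (hbase : ∀ (p : {p : Seminorm ℂ A // Continuous p}) (k : ℕ),
      ∃ Q : Seminorm ℂ (SchwartzFn V A), Continuous Q ∧ ∀ f x, ‖x‖ ^ k * p.1 (T f x) ≤ Q f)
    (hstep : ∀ u : V, ∃ S R : SchwartzFn V A →L[ℂ] SchwartzFn V A,
      ∀ f x, HasLineDer (T f) (T (S f) x + R f x) x u) : Continuous T := by
  refine continuous_of_bound V A T fun p k l => ?_
  -- Reverse induction removes the innermost derivative, which the commutator relation replaces by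
  -- the operators `S` and `R` acting on `f`.
  induction l using List.reverseRecOn with
  | nil =>
    obtain ⟨Q, hQ, h⟩ := hbase p k
    exact ⟨Q, hQ, fun f => schwartzSeminorm_le (h f)⟩
  | append_singleton l u ih =>
    obtain ⟨S, R, h⟩ := hstep u
    obtain ⟨Q, hQ, hT⟩ := ih
    refine ⟨Q.comp S.toLinearMap + (schwartzSeminorm p k l).comp R.toLinearMap,
      (hQ.comp S.continuous).add ((continuous_schwartzSeminorm p k l).comp R.continuous),
      fun f => ?_⟩
    have hd : derivL u (T f) = T (S f) + R f := SchwartzFn.ext fun x =>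
      ((T f).2.hasLineDer x u).unique (h f x)
    have h1 : schwartzSeminorm p k (l ++ [u]) (T f) = schwartzSeminorm p k l (derivL u (T f)) := by
      refine le_antisymm (schwartzSeminorm_le fun x => ?_) (schwartzSeminorm_le fun x => ?_)
      · rw [iterDirDeriv_append]
        exact le_schwartzSeminorm p k l (derivL u (T f)) x
      · have := le_schwartzSeminorm p k (l ++ [u]) (T f) x
        rwa [iterDirDeriv_append] at this
    rw [h1, hd]
    exact (map_add_le_add _ _ _).trans (add_le_add (hT _) le_rfl)

/-- Composition with a continuous linear map as an operator on `S(V; A)`. -/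
def compL (D : A →L[ℂ] A) : SchwartzFn V A →L[ℂ] SchwartzFn V A :=
  let T : SchwartzFn V A →ₗ[ℂ] SchwartzFn V A :=
    { toFun := fun f => ⟨fun x => D (f x), f.2.clm D⟩
      map_add' := fun f g => SchwartzFn.ext fun x => map_add D (f x) (g x)
      map_smul' := fun c f => SchwartzFn.ext fun x => D.map_smul c (f x) }
  { T with
    cont := continuous_of_commutator T
      (fun p k => ⟨_, continuous_schwartzSeminorm
        ⟨p.1.comp D.toLinearMap, p.2.comp D.continuous⟩ k [], fun f x =>
          le_schwartzSeminorm ⟨p.1.comp D.toLinearMap, p.2.comp D.continuous⟩ k [] f x⟩)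
      fun u => ⟨derivL u, 0, fun f x => by
        have := (f.2.hasLineDer x u).clm D
        rwa [← add_zero (D _)] at this⟩ }

/-- Multiplication by the linear function `⟪v, x⟫` as an operator on `S(V; A)`. -/
def coordMulL (v : V) : SchwartzFn V A →L[ℂ] SchwartzFn V A :=
  let T : SchwartzFn V A →ₗ[ℂ] SchwartzFn V A :=
    { toFun := fun f => ⟨coordMul v f, f.2.coordMul v⟩
      map_add' := fun f g => SchwartzFn.ext fun x => smul_add _ (f x) (g x)
      map_smul' := fun c f => SchwartzFn.ext fun x => smul_comm _ c (f x) }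
  { T with
    cont := continuous_of_commutator T
      (fun p k => ⟨‖v‖₊ • schwartzSeminorm p (k + 1) [],
        continuous_seminorm_smul (continuous_schwartzSeminorm p (k + 1) []) _, fun f x => by
          have h1 := le_schwartzSeminorm p (k + 1) [] f x
          have h2 : |inner ℝ v x| ≤ ‖v‖ * ‖x‖ := abs_real_inner_le_norm v x
          calc ‖x‖ ^ k * p.1 (coordMul v f x) = ‖x‖ ^ k * (|inner ℝ v x| * p.1 (f x)) := by
                rw [coordMul, map_smul_eq_mul, Complex.norm_real, Real.norm_eq_abs]
            _ ≤ ‖x‖ ^ k * ((‖v‖ * ‖x‖) * p.1 (f x)) := by gcongr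
            _ = ‖v‖ * (‖x‖ ^ (k + 1) * p.1 (f x)) := by ring
            _ ≤ _ := mul_le_mul_of_nonneg_left h1 (norm_nonneg v)⟩)
      fun u => ⟨derivL u, ((inner ℝ v u : ℝ) : ℂ) • ContinuousLinearMap.id ℂ (SchwartzFn V A), fun f x =>
        hasLineDer_coordMul v (f.2.hasLineDer x u)⟩ }

end SchwartzFn

end Operators

/-! ### Continuity of the Fourier transform on `S(V; A)` -/

section FourierOperators

variable {V : Type*} [NormedAddCommGroup V] [InnerProductSpace ℝ V] [FiniteDimensional ℝ V]
  [MeasurableSpace V] [BorelSpace V]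
variable {A : Type*} [AddCommGroup A] [Module ℂ A] [UniformSpace A] [IsUniformAddGroup A]
  [ContinuousSMul ℂ A] [PolynormableSpace ℂ A] [CompleteSpace A] [T2Space A]

namespace SchwartzFn

theorem exists_integral_seminorm_le {p : Seminorm ℂ A} (hp : Continuous p) :
    ∃ Q : Seminorm ℂ (SchwartzFn V A), Continuous Q ∧ ∀ f, ∫ x, p (f x) ≤ Q f := by
  set p' : {p : Seminorm ℂ A // Continuous p} := ⟨p, hp⟩
  set I : ℝ := ∫ x : V, (1 + ‖x‖) ^ (-(decayOrder V : ℝ))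
  have hI : 0 ≤ 2 ^ decayOrder V * I :=
    mul_nonneg (by positivity) (integral_nonneg fun x => by positivity)
  let c : NNReal := ⟨_, hI⟩
  refine ⟨c • (schwartzSeminorm p' 0 [] + schwartzSeminorm p' (decayOrder V) []),
    continuous_seminorm_smul (continuous_seminorm_add (continuous_schwartzSeminorm _ _ _)
      (continuous_schwartzSeminorm _ _ _)) _, fun f => ?_⟩
  calc ∫ x, p (f x) ≤ ∫ x : V, 2 ^ decayOrder V * (schwartzSeminorm p' 0 [] f +
        schwartzSeminorm p' (decayOrder V) [] f) * (1 + ‖x‖) ^ (-(decayOrder V : ℝ)) := by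
        refine integral_mono (f.2.integrable_seminorm hp)
          ((integrable_decayOrder V).const_mul _) fun x => decay_le_of_bounds ?_ ?_
        · simpa using! le_schwartzSeminorm p' 0 [] f x
        · exact le_schwartzSeminorm p' (decayOrder V) [] f x
    _ = 2 ^ decayOrder V * I * (schwartzSeminorm p' 0 [] f +
        schwartzSeminorm p' (decayOrder V) [] f) := by
        rw [integral_const_mul]; ring

/-- Each factor `⟪y, v⟫` is exchanged for a derivative of `f` along `v`, so `Q` is composed with
`derivL v` at every step; the factor `|2πi| ≥ 1` is dropped. -/
theorem exists_pow_inner_mul_fourier_le {p : Seminorm ℂ A} (hp : Continuous p) (v : V) (n : ℕ) :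
    ∃ Q : Seminorm ℂ (SchwartzFn V A), Continuous Q ∧
      ∀ (f : SchwartzFn V A) y, |inner ℝ y v| ^ n * p (fourier f y) ≤ Q f := by
  induction n with
  | zero =>
    obtain ⟨Q, hQ, h⟩ := exists_integral_seminorm_le (V := V) hp
    exact ⟨Q, hQ, fun f y => by simpa using (f.2.seminorm_fourier_le hp y).trans (h f)⟩
  | succ n ih =>
    obtain ⟨Q, hQ, h⟩ := ih
    refine ⟨Q.comp (derivL v).toLinearMap, hQ.comp (derivL v).continuous, fun f y => ?_⟩
    have h1 := h (derivL v f) y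
    rw [coe_derivL, fourier_dirDeriv f.2, Pi.smul_apply, coordMul, map_smul_eq_mul,
      map_smul_eq_mul, Complex.norm_real, Real.norm_eq_abs, real_inner_comm y v] at h1
    refine le_trans ?_ h1
    have h2 : (1 : ℝ) ≤ ‖(2 * Real.pi * Complex.I : ℂ)‖ := by
      simp only [norm_mul, Complex.norm_I, mul_one, Complex.norm_real, Real.norm_eq_abs,
        Complex.norm_ofNat, abs_of_pos Real.pi_pos]
      linarith [Real.pi_gt_three]
    rw [pow_succ, mul_assoc]
    refine mul_le_mul_of_nonneg_left (le_mul_of_one_le_left ?_ h2) (pow_nonneg (abs_nonneg _) n)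
    exact mul_nonneg (abs_nonneg _) (apply_nonneg p _)

theorem exists_pow_norm_mul_fourier_le {p : Seminorm ℂ A} (hp : Continuous p) (k : ℕ) :
    ∃ Q : Seminorm ℂ (SchwartzFn V A), Continuous Q ∧
      ∀ (f : SchwartzFn V A) y, ‖y‖ ^ k * p (fourier f y) ≤ Q f := by
  -- Exponent `0` gives the plain sup bound; the direction is a dummy.
  obtain ⟨Q₀, hQ₀, h₀⟩ := exists_pow_inner_mul_fourier_le hp (0 : V) 0
  choose Q hQ h using fun i =>
    exists_pow_inner_mul_fourier_le hp (stdOrthonormalBasis ℝ V i) (k + 1)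
  have hs : ∀ s : Finset (Fin (Module.finrank ℝ V)), Continuous (fun f => (∑ i ∈ s, Q i) f) ∧
      ∀ f, (∑ i ∈ s, Q i) f = ∑ i ∈ s, Q i f := by
    intro s
    induction s using Finset.cons_induction with
    | empty => exact ⟨continuous_const, fun f => rfl⟩
    | cons i s hi ih =>
      simp only [Finset.sum_cons]
      exact ⟨continuous_seminorm_add (hQ i) ih.1, fun f => by rw [add_apply, ih.2]⟩
  set c : NNReal := (Fintype.card (Fin (Module.finrank ℝ V)) + 1) ^ k
  refine ⟨c • (Q₀ + ∑ i, Q i), continuous_seminorm_smul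
    (continuous_seminorm_add hQ₀ (hs _).1) _, fun f x => ?_⟩
  have hQ0 : p (fourier f x) ≤ Q₀ f := by simpa using h₀ f x
  have h1 : ‖x‖ ^ k ≤ (1 + ‖x‖) ^ (k + 1) :=
    (pow_le_pow_left₀ (norm_nonneg _) (by linarith) k).trans
      (pow_le_pow_right₀ (by linarith [norm_nonneg x]) (Nat.le_succ k))
  calc ‖x‖ ^ k * p (fourier f x) ≤ (1 + ‖x‖) ^ (k + 1) * p (fourier f x) :=
        mul_le_mul_of_nonneg_right h1 (apply_nonneg p _)
    _ ≤ ((Fintype.card (Fin (Module.finrank ℝ V)) + 1) ^ k *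
          (1 + ∑ i, |inner ℝ x (stdOrthonormalBasis ℝ V i)| ^ (k + 1))) * p (fourier f x) :=
        mul_le_mul_of_nonneg_right (one_add_pow_le_of_le_sum (norm_nonneg _)
          (fun _ => abs_nonneg _) (norm_le_sum_abs_inner x) k) (apply_nonneg p _)
    _ = (Fintype.card (Fin (Module.finrank ℝ V)) + 1) ^ k * (p (fourier f x) +
          ∑ i, |inner ℝ x (stdOrthonormalBasis ℝ V i)| ^ (k + 1) * p (fourier f x)) := by
        rw [← Finset.sum_mul]; ring
    _ ≤ (Fintype.card (Fin (Module.finrank ℝ V)) + 1) ^ k * (Q₀ f + ∑ i, Q i f) :=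
        mul_le_mul_of_nonneg_left (add_le_add hQ0
          (Finset.sum_le_sum fun i _ => h i f x)) (by positivity)
    _ = (c • (Q₀ + ∑ i, Q i)) f := by
        rw [smul_apply, add_apply, (hs _).2, NNReal.smul_def, smul_eq_mul]
        simp [c]

/-- The Fourier transform as an operator on `S(V; A)`. -/
def fourierL : SchwartzFn V A →L[ℂ] SchwartzFn V A :=
  let T : SchwartzFn V A →ₗ[ℂ] SchwartzFn V A :=
    { toFun := fun f => ⟨fourier f, f.2.fourier⟩
      map_add' := fun f g => Subtype.ext (fourier_add f.2 g.2)
      map_smul' := fun c f => Subtype.ext (fourier_smul f.2 c) }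
  { T with
    cont := continuous_of_commutator T
      (fun p k => exists_pow_norm_mul_fourier_le p.2 k)
      fun u => ⟨(-(2 * Real.pi * Complex.I) : ℂ) • coordMulL u, 0, fun f y => by
        have := hasLineDer_fourier f.2 y u
        rwa [← fourier_smul (f.2.coordMul u), ← add_zero (fourier _ y)] at this⟩ }

theorem hasLineDer_comp_neg {f : V → A} (hf : IsSchwartz f) (x u : V) :
    HasLineDer (fun x => f (-x)) (-dirDeriv u f (-x)) x u := by
  have h1 := HasLineDer.smul_direction (hf.hasLineDer (-x) u) (c := -1) (by norm_num)
  have h2 := HasLineDer.comp_linear (f := f) (u := u) (x := x)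
    (d := (((-1 : ℝ) : ℂ) • dirDeriv u f (-x))) (-LinearMap.id) 0 (by simpa using h1)
  simpa using! h2

/-- The reflection `f ↦ f(-x)` as an operator on `S(V; A)`. -/
def negL : SchwartzFn V A →L[ℂ] SchwartzFn V A :=
  let T : SchwartzFn V A →ₗ[ℂ] SchwartzFn V A :=
    { toFun := fun f => ⟨fun x => f (-x), f.2.comp_neg⟩
      map_add' := fun f g => rfl
      map_smul' := fun c f => rfl }
  { T with
    cont := continuous_of_commutator T
      (fun p k => ⟨_, continuous_schwartzSeminorm p k [], fun f x => by
        have := le_schwartzSeminorm p k [] f (-x)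
        rwa [norm_neg] at this⟩)
      fun u => ⟨-derivL u, 0, fun f x => by
        have := hasLineDer_comp_neg f.2 x u
        rwa [← add_zero (-_)] at this⟩ }

/-- The inverse Fourier transform as an operator on `S(V; A)`. -/
def fourierInvL : SchwartzFn V A →L[ℂ] SchwartzFn V A := negL ∘L fourierL

theorem coe_fourierInvL (f : SchwartzFn V A) : (fourierInvL f : V → A) = fourierInv f :=
  (funext (fourierInv_eq_fourier_neg (f : V → A))).symm

end SchwartzFn

end FourierOperators

/-! ### The operator `Θ_J` and its inverse -/

section Theta

variable {V : Type*} [NormedAddCommGroup V] [InnerProductSpace ℝ V] [FiniteDimensional ℝ V]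
  [MeasurableSpace V] [BorelSpace V]
variable {A : Type*} [NonUnitalRing A] [Module ℂ A] [UniformSpace A] [IsUniformAddGroup A]
  [ContinuousSMul ℂ A] [PolynormableSpace ℂ A] [CompleteSpace A] [T2Space A]

theorem isSchwartz_act_fourier (α : SmoothIsometricAction V A) (L : V →ₗ[ℝ] V) {f : V → A}
    (hf : IsSchwartz f) : IsSchwartz fun y => α.act (L y) (fourier f y) :=
  α.isSchwartz_act hf.fourier L L.continuous_of_finiteDimensional

theorem isSchwartz_theta (α : SmoothIsometricAction V A) (J : V →ₗ[ℝ] V) {f : V → A}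
    (hf : IsSchwartz f) : IsSchwartz (theta α J f) :=
  (isSchwartz_act_fourier α J hf).fourierInv

/-- On the Fourier side `Θ_J` is pointwise application of `α_{Jy}`; properties of `Θ_J` are read off
from this and the injectivity of the Fourier transform. -/
theorem fourier_theta (α : SmoothIsometricAction V A) (J : V →ₗ[ℝ] V) {f : V → A}
    (hf : IsSchwartz f) : fourier (theta α J f) = fun y => α.act (J y) (fourier f y) :=
  fourier_fourierInv (isSchwartz_act_fourier α J hf)

theorem theta_neg_theta (α : SmoothIsometricAction V A) (J : V →ₗ[ℝ] V) {f : V → A}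
    (hf : IsSchwartz f) : theta α (-J) (theta α J f) = f := by
  refine fourier_injective (isSchwartz_theta α _ (isSchwartz_theta α J hf)) hf ?_
  funext y
  rw [fourier_theta α _ (isSchwartz_theta α J hf), fourier_theta α _ hf]
  dsimp only
  rw [← α.act_add, LinearMap.neg_apply, neg_add_cancel, α.act_zero]

namespace SchwartzFn

/-- The operator `f ↦ (x ↦ α_{Lx}(f x))` on `S(V; A)`. -/
def actL (α : SmoothIsometricAction V A) (L : V →ₗ[ℝ] V) : SchwartzFn V A →L[ℂ] SchwartzFn V A :=
  let T : SchwartzFn V A →ₗ[ℂ] SchwartzFn V A :=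
    { toFun := fun f => ⟨_, α.isSchwartz_act f.2 L L.continuous_of_finiteDimensional⟩
      map_add' := fun f g => SchwartzFn.ext fun x => map_add (α.act (L x)) (f x) (g x)
      map_smul' := fun c f => SchwartzFn.ext fun x => map_smul (α.act (L x)) c (f x) }
  { T with
    cont := continuous_of_commutator T
      (fun p k => by
        obtain ⟨q, hq, hpq, hinv⟩ := α.exists_invariant p.2
        refine ⟨_, continuous_schwartzSeminorm ⟨q, hq⟩ k [], fun f x => le_trans ?_
          (le_schwartzSeminorm ⟨q, hq⟩ k [] f x)⟩
        exact mul_le_mul_of_nonneg_left ((hpq _).trans (hinv _ _).le) (by positivity))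
      fun u => ⟨compL (α.gen (L u)) + derivL u, 0, fun f x => by
        have := α.hasLineDer_act L (f.2.hasLineDer x u)
        rwa [← add_zero (α.act _ _)] at this⟩ }

/-- The operator `Θ_J` on `S(V; A)`. -/
def thetaL (α : SmoothIsometricAction V A) (J : V →ₗ[ℝ] V) : SchwartzFn V A →L[ℂ] SchwartzFn V A :=
  fourierInvL ∘L actL α J ∘L fourierL

theorem coe_thetaL (α : SmoothIsometricAction V A) (J : V →ₗ[ℝ] V) (f : SchwartzFn V A) :
    (thetaL α J f : V → A) = theta α J f :=
  coe_fourierInvL (actL α J (fourierL f))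

theorem thetaL_neg_thetaL (α : SmoothIsometricAction V A) (J : V →ₗ[ℝ] V) (f : SchwartzFn V A) :
    thetaL α (-J) (thetaL α J f) = f := by
  refine Subtype.ext ?_
  refine (coe_thetaL α (-J) _).trans ?_
  rw [coe_thetaL]
  exact theta_neg_theta α J f.2

/-- The operator `Θ_J` as a linear homeomorphism of `S(V; A)`. -/
def thetaEquiv (α : SmoothIsometricAction V A) (J : V →ₗ[ℝ] V) :
    SchwartzFn V A ≃L[ℂ] SchwartzFn V A :=
  ContinuousLinearEquiv.equivOfInverse (thetaL α J) (thetaL α (-J)) (thetaL_neg_thetaL α J)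
    fun f => by simpa using thetaL_neg_thetaL α (-J) f

theorem coe_thetaEquiv (α : SmoothIsometricAction V A) (J : V →ₗ[ℝ] V) (f : SchwartzFn V A) :
    (thetaEquiv α J f : V → A) = theta α J f :=
  coe_thetaL α J f

theorem coe_thetaEquiv_symm (α : SmoothIsometricAction V A) (J : V →ₗ[ℝ] V)
    (f : SchwartzFn V A) : ((thetaEquiv α J).symm f : V → A) = theta α (-J) f :=
  coe_thetaL α (-J) f

end SchwartzFn

end Theta

/-! ### Amplitudes built from the action and from Schwartz functions -/

section Amplitudes

variable {V : Type*} [NormedAddCommGroup V] [InnerProductSpace ℝ V] [FiniteDimensional ℝ V]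
  [MeasurableSpace V] [BorelSpace V]

section TVS

variable {A : Type*} [AddCommGroup A] [Module ℂ A] [UniformSpace A] [IsUniformAddGroup A]
  [ContinuousSMul ℂ A] [PolynormableSpace ℂ A]

theorem SeminormBdd.exists_clm {m : A →ₗ[ℂ] A →ₗ[ℂ] A} (hm : SeminormBdd m) (a : A) :
    ∃ T : A →L[ℂ] A, ∀ b, T b = m a b :=
  ⟨⟨m a, hm.continuous.comp (continuous_const.prodMk continuous_id)⟩, fun _ => rfl⟩

theorem SeminormBdd.exists_clm_flip {m : A →ₗ[ℂ] A →ₗ[ℂ] A} (hm : SeminormBdd m) (b : A) :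
    ∃ T : A →L[ℂ] A, ∀ a, T a = m a b :=
  ⟨⟨m.flip b, hm.continuous.comp (continuous_id.prodMk continuous_const)⟩, fun _ => rfl⟩

theorem AmpBdd.nonneg {p : Seminorm ℂ A} {K : ℝ} {F : V × V → A} (hF : AmpBdd p K F) : 0 ≤ K :=
  (apply_nonneg p _).trans (hF.bound 0)

theorem AmpBdd.bilin {p q r : Seminorm ℂ A} {m : A →ₗ[ℂ] A →ₗ[ℂ] A}
    (hm : Continuous fun q : A × A => m q.1 q.2) (hpqr : ∀ a b, r (m a b) ≤ p a * q b)
    {K L : ℝ} {F G : V × V → A} (hF : AmpBdd p K F) (hG : AmpBdd q L G) :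
    AmpBdd r (2 ^ phaseOrder V * (K * L)) fun w => m (F w) (G w) where
  continuous := hm.comp (hF.continuous.prodMk hG.continuous)
  bound w := by
    have h1 : r (m (F w) (G w)) ≤ K * L := (hpqr _ _).trans
      (mul_le_mul (hF.bound w) (hG.bound w) (apply_nonneg q _) hF.nonneg)
    exact h1.trans (le_mul_of_one_le_left (mul_nonneg hF.nonneg hG.nonneg)
      (one_le_pow₀ one_le_two))
  line j := LineBdd.bilin m hm hpqr (hF.line j) (hG.line j)

theorem IsAmplitude.bilin {m : A →ₗ[ℂ] A →ₗ[ℂ] A} (hm : SeminormBdd m) {F G : V × V → A}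
    (hF : IsAmplitude F) (hG : IsAmplitude G) : IsAmplitude fun w => m (F w) (G w) := by
  intro p hp
  obtain ⟨q, hq, hpq⟩ := hm p hp
  obtain ⟨K, hK⟩ := hF q hq
  obtain ⟨L, hL⟩ := hG q hq
  exact ⟨_, hK.bilin hm.continuous hpq hL⟩

theorem IsSchwartz.exists_lineBdd [T2Space A] {f : V → A} (hf : IsSchwartz f) (u : V) (n : ℕ)
    {p : Seminorm ℂ A} (hp : Continuous p) : ∃ C, LineBdd p u n (fun _ => C) f := by
  induction n generalizing f with
  | zero =>
    obtain ⟨C, -, hC⟩ := hf.bounded hp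
    exact ⟨C, hf.continuous_self, hC⟩
  | succ n ih =>
    obtain ⟨C, -, hC⟩ := hf.bounded hp
    obtain ⟨D, hD⟩ := ih (hf.dirDeriv u)
    exact ⟨max C D, ⟨hf.continuous_self, fun x => (hC x).trans (le_max_left _ _)⟩,
      RieffelCrossed.dirDeriv u f, fun x => hf.hasLineDer x u, hD.mono fun _ => le_max_right _ _⟩

theorem IsSchwartz.isAmplitude [T2Space A] {f : V → A} (hf : IsSchwartz f) (L : V × V →L[ℝ] V)
    (c : V) : IsAmplitude fun w : V × V => f (L w + c) := by
  intro p hp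
  refine AmpBdd.exists_of_line (hf.continuous_self.comp (L.continuous.add continuous_const)) ?_ ?_
  · obtain ⟨C, -, hC⟩ := hf.bounded hp
    exact ⟨C, fun w => hC _⟩
  · intro j
    obtain ⟨C, hC⟩ := hf.exists_lineBdd (L (phaseDir j)) (phaseOrder V) hp
    exact ⟨C, hC.comp_affine L c⟩

variable [CompleteSpace A] [T2Space A]

theorem VInt.comp_sub_left {f : V → A} (hf : VInt volume f) (x : V) :
    VInt volume fun y => f (x - y) := fun p hp => (hf p hp).comp_sub_left x

theorem VInt.vIntegral_comp_sub_left {f : V → A} (hf : VInt volume f) (x : V) :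
    vIntegral volume (fun y => f (x - y)) = vIntegral volume f := by
  refine eq_of_toCompl_eq fun p hp => ?_
  rw [(hf.comp_sub_left x).toCompl_vIntegral hp, hf.toCompl_vIntegral hp]
  exact integral_sub_left_eq_self (fun y => toCompl p (f y)) volume x

theorem vIntegral_e_smul_sub {ξ : V → A} (hξ : IsSchwartz ξ) (x y : V) :
    vIntegral volume (fun z => e y z • ξ (x - z)) = e x y • fourier ξ y := by
  rw [fourier, ← (hξ.vInt_fourier y).vIntegral_smul,
    ← ((hξ.vInt_fourier y).smul (e x y)).vIntegral_comp_sub_left x]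
  congr 1
  funext z
  rw [smul_smul, ← e_add_left, e_comm y z]
  congr 2
  abel

theorem fourier_leftTranslate {ξ : V → A} (hξ : IsSchwartz ξ) (z y : V) :
    fourier (leftTranslate z ξ) y = e (-z) y • fourier ξ y := by
  have h1 : VInt volume fun x => e (-x) y • leftTranslate z ξ x := (hξ.comp_sub z).vInt_fourier y
  rw [fourier, ← h1.vIntegral_comp_sub_left 0, ← vIntegral_e_smul_sub hξ]
  simp only [leftTranslate, zero_sub, neg_neg, neg_sub_left]
  congr 1
  funext x
  rw [e_comm, add_comm z x]

end TVS

section Action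

variable {A : Type*} [NonUnitalRing A] [Module ℂ A] [UniformSpace A] [IsUniformAddGroup A]
  [ContinuousSMul ℂ A] [PolynormableSpace ℂ A] [T2Space A]

namespace SmoothIsometricAction

theorem exists_ampBdd_act (α : SmoothIsometricAction V A) (L : V × V →L[ℝ] V)
    {p : Seminorm ℂ A} (hp : Continuous p) :
    ∃ q : Seminorm ℂ A, Continuous q ∧ ∀ a, AmpBdd p (q a) fun w => α.act (L w) a := by
  obtain ⟨r, hr, hpr, hinv⟩ := α.exists_invariant hp
  choose q hq h using fun j => α.exists_lineBdd_act L (phaseDir (V := V) j) (phaseOrder V) hp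
  refine ⟨r ⊔ Finset.univ.sup q, continuous_seminorm_sup hr (continuous_seminorm_finset_sup _ hq),
    fun a => ⟨(α.continuous_orbit a).comp L.continuous, fun w => ?_, fun j => ?_⟩⟩
  · exact ((hpr _).trans (hinv _ _).le).trans le_sup_left
  · refine (h j a).mono fun _ => le_trans ?_ (le_sup_right : (Finset.univ.sup q) a ≤ _)
    exact (Finset.le_sup (f := q) (Finset.mem_univ j) : q j ≤ _) a

theorem isAmplitude_act (α : SmoothIsometricAction V A) (L : V × V →L[ℝ] V) (a : A) :
    IsAmplitude fun w => α.act (L w) a := fun _ hp =>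
  let ⟨q, _, h⟩ := α.exists_ampBdd_act L hp
  ⟨q a, h a⟩

theorem act_comm (α : SmoothIsometricAction V A) (x y : V) (a : A) :
    α.act x (α.act y a) = α.act y (α.act x a) := by
  rw [← α.act_add, ← α.act_add, add_comm]

theorem hasLineDer_orbit (α : SmoothIsometricAction V A) (a : A) (x u : V) :
    HasLineDer (fun x => α.act x a) (α.act x (α.gen u a)) x u := by
  have := α.hasLineDer_act LinearMap.id (HasLineDer.const a x u)
  rwa [add_zero] at this

end SmoothIsometricAction

variable [CompleteSpace A] [IsScalarTower ℂ A A] [SMulCommClass ℂ A A]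
  [ContinuousMul A]

variable (A) in
theorem seminormBdd_mul : SeminormBdd (LinearMap.mul ℂ A) :=
  seminormBdd_of_continuous continuous_mul

variable (α : SmoothIsometricAction V A) (J : V →ₗ[ℝ] V)

theorem isAmplitude_rieffelMul (a b : A) :
    IsAmplitude fun w : V × V => α.act (J w.1) a * α.act w.2 b :=
  (α.isAmplitude_act (J.toContinuousLinearMap ∘L ContinuousLinearMap.fst ℝ V V) a).bilin
    (seminormBdd_mul A) (α.isAmplitude_act (ContinuousLinearMap.snd ℝ V V) b)

theorem rieffelMul_add_left (a a' b : A) :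
    rieffelMul α J (a + a') b = rieffelMul α J a b + rieffelMul α J a' b := by
  have h := isAmplitude_rieffelMul α J (a + a') b
  simp only [map_add, add_mul] at h
  simp only [rieffelMul, map_add, add_mul]
  exact (isAmplitude_rieffelMul α J a b).oscIntegral_add (isAmplitude_rieffelMul α J a' b) h

theorem rieffelMul_add_right (a b b' : A) :
    rieffelMul α J a (b + b') = rieffelMul α J a b + rieffelMul α J a b' := by
  have h := isAmplitude_rieffelMul α J a (b + b')
  simp only [map_add, mul_add] at h
  simp only [rieffelMul, map_add, mul_add]
  exact (isAmplitude_rieffelMul α J a b).oscIntegral_add (isAmplitude_rieffelMul α J a b') h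

theorem rieffelMul_smul_left (c : ℂ) (a b : A) :
    rieffelMul α J (c • a) b = c • rieffelMul α J a b := by
  have h := isAmplitude_rieffelMul α J (c • a) b
  simp only [map_smul, smul_mul_assoc] at h
  simp only [rieffelMul, map_smul, smul_mul_assoc]
  exact (isAmplitude_rieffelMul α J a b).oscIntegral_clm (c • ContinuousLinearMap.id ℂ A) h

theorem rieffelMul_smul_right (c : ℂ) (a b : A) :
    rieffelMul α J a (c • b) = c • rieffelMul α J a b := by
  have h := isAmplitude_rieffelMul α J a (c • b)
  simp only [map_smul, mul_smul_comm] at h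
  simp only [rieffelMul, map_smul, mul_smul_comm]
  exact (isAmplitude_rieffelMul α J a b).oscIntegral_clm (c • ContinuousLinearMap.id ℂ A) h

/-- Rieffel's deformed product as a bilinear map. -/
def rieffelMulL : A →ₗ[ℂ] A →ₗ[ℂ] A :=
  LinearMap.mk₂ ℂ (rieffelMul α J) (rieffelMul_add_left α J) (rieffelMul_smul_left α J)
    (rieffelMul_add_right α J) (rieffelMul_smul_right α J)

theorem rieffelMulL_apply (a b : A) : rieffelMulL α J a b = rieffelMul α J a b := rfl

/-- The estimate for oscillatory integrals is linear in the amplitude constant, here a product of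
seminorms of `a` and `b`. Hence `×_J` is as good as the product of `A`, and results for a general
bounded `m` cover both crossed products. -/
theorem seminormBdd_rieffelMulL : SeminormBdd (rieffelMulL α J) := by
  refine SeminormBdd.of_const fun p hp => ?_
  obtain ⟨C, hC, hp'⟩ := exists_seminorm_oscIntegral_le V hp
  obtain ⟨q, hq, hpq⟩ := seminormBdd_mul A p hp
  obtain ⟨r, hr, hqr⟩ := α.exists_ampBdd_act
    (J.toContinuousLinearMap ∘L ContinuousLinearMap.fst ℝ V V) hq
  obtain ⟨s, hs, hqs⟩ := α.exists_ampBdd_act (ContinuousLinearMap.snd ℝ V V) hq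
  refine ⟨r ⊔ s, C * 2 ^ phaseOrder V, continuous_seminorm_sup hr hs, fun a b => ?_⟩
  refine (hp' _ _ (isAmplitude_rieffelMul α J a b)
    ((hqr a).bilin (seminormBdd_mul A).continuous hpq (hqs b))).trans ?_
  rw [mul_assoc]
  gcongr
  · exact (le_sup_left : r a ≤ _)
  · exact (le_sup_right : s b ≤ _)

/-- Since `V` is commutative, `α_w` commutes with the automorphisms in the integrand; it is
multiplicative for the original product and passes through the oscillatory integral. -/
theorem rieffelMul_act (w : V) (a b : A) :
    rieffelMul α J (α.act w a) (α.act w b) = α.act w (rieffelMul α J a b) := by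
  have h := isAmplitude_rieffelMul α J (α.act w a) (α.act w b)
  simp only [α.act_comm _ w, ← map_mul] at h
  simp only [rieffelMul, α.act_comm _ w, ← map_mul]
  exact (isAmplitude_rieffelMul α J a b).oscIntegral_clm (α.actL w) h

end Action

end Amplitudes

/-! ### Crossed products -/

section Crossed

variable {V : Type*} [NormedAddCommGroup V] [InnerProductSpace ℝ V] [FiniteDimensional ℝ V]
  [MeasurableSpace V] [BorelSpace V]
variable {A : Type*} [NonUnitalRing A] [Module ℂ A] [UniformSpace A] [IsUniformAddGroup A]
  [ContinuousSMul ℂ A] [PolynormableSpace ℂ A] [CompleteSpace A] [T2Space A]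
variable (α : SmoothIsometricAction V A) {m : A →ₗ[ℂ] A →ₗ[ℂ] A}

theorem exists_crossedMul_bound (hm : SeminormBdd m) {f g : V → A} (hf : IsSchwartz f)
    (hg : IsSchwartz g) {p : Seminorm ℂ A} (hp : Continuous p) :
    ∃ h : V → ℝ, Integrable h ∧ ∀ x y, p (m (f y) (α.act y (g (x - y)))) ≤ h y := by
  obtain ⟨q, hq, hpq⟩ := hm p hp
  obtain ⟨r, hr, hqr, hinv⟩ := α.exists_invariant hq
  obtain ⟨C, -, hC⟩ := hg.bounded hr
  refine ⟨_, (hf.integrable_seminorm hq).mul_const C, fun x y => (hpq _ _).trans ?_⟩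
  exact mul_le_mul_of_nonneg_left (((hqr _).trans (hinv _ _).le).trans (hC _)) (apply_nonneg q _)

theorem continuous_crossedMul_integrand (hm : SeminormBdd m) {f g : V → A} (hf : IsSchwartz f)
    (hg : IsSchwartz g) :
    Continuous fun q : V × V => m (f q.2) (α.act q.2 (g (q.1 - q.2))) :=
  hm.continuous.comp ((hf.continuous_self.comp continuous_snd).prodMk
    (α.continuous_act.comp (continuous_snd.prodMk
      (hg.continuous_self.comp (continuous_fst.sub continuous_snd)))))

theorem vInt_crossedMul (hm : SeminormBdd m) {f g : V → A} (hf : IsSchwartz f)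
    (hg : IsSchwartz g) (x : V) : VInt volume fun y => m (f y) (α.act y (g (x - y))) :=
  VInt.of_bound ((continuous_crossedMul_integrand α hm hf hg).comp
    (continuous_const.prodMk continuous_id)) fun _ hp =>
    let ⟨h, hi, hh⟩ := exists_crossedMul_bound α hm hf hg hp
    ⟨h, hi, hh x⟩

theorem coordMul_crossedMul (hm : SeminormBdd m) {f g : V → A} (hf : IsSchwartz f)
    (hg : IsSchwartz g) (v : V) : coordMul v (crossedMul (fun a b => m a b) α f g) =
      crossedMul (fun a b => m a b) α (coordMul v f) g +
        crossedMul (fun a b => m a b) α f (coordMul v g) := by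
  funext x
  rw [Pi.add_apply, coordMul, crossedMul, crossedMul, crossedMul,
    ← (vInt_crossedMul α hm hf hg x).vIntegral_smul,
    ← (vInt_crossedMul α hm (hf.coordMul v) hg x).vIntegral_add
      (vInt_crossedMul α hm hf (hg.coordMul v) x)]
  congr 1
  funext y
  simp only [coordMul, map_smul, LinearMap.smul_apply, ← add_smul, inner_sub_right]
  congr 1
  push_cast
  ring

/-- Derivatives in `x` fall on `g` alone, and `⟪v, x⟫ = ⟪v, y⟫ + ⟪v, x - y⟫` distributes a
coordinate multiplication over the two factors. -/
theorem isSchwartz_crossedMul (hm : SeminormBdd m) {f g : V → A} (hf : IsSchwartz f)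
    (hg : IsSchwartz g) : IsSchwartz (crossedMul (fun a b => m a b) α f g) := by
  refine isSchwartz_of_span (𝒢 := {h | ∃ f g : V → A, IsSchwartz f ∧ IsSchwartz g ∧
    h = crossedMul (fun a b => m a b) α f g}) ?_ ?_ ?_ ?_
    (Submodule.subset_span ⟨f, g, hf, hg, rfl⟩)
  · rintro _ ⟨f, g, hf, hg, rfl⟩
    refine continuous_vIntegral (vInt_crossedMul α hm hf hg) (fun y =>
      (continuous_crossedMul_integrand α hm hf hg).comp
        (continuous_id.prodMk continuous_const)) fun p hp => ?_
    exact exists_crossedMul_bound α hm hf hg hp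
  · rintro _ ⟨f, g, hf, hg, rfl⟩ p hp
    obtain ⟨h, hi, hh⟩ := exists_crossedMul_bound α hm hf hg hp
    refine ⟨∫ y, h y, fun x => ?_⟩
    have hv := vInt_crossedMul α hm hf hg x
    exact (hv.seminorm_vIntegral_le hp).trans
      (integral_mono (hv.integrable_seminorm hp) hi (hh x))
  · rintro _ ⟨f, g, hf, hg, rfl⟩ v
    refine ⟨_, Submodule.subset_span ⟨f, _, hf, hg.dirDeriv v, rfl⟩, fun x => ?_⟩
    refine hasLineDer_vIntegral (vInt_crossedMul α hm hf hg)
      (vInt_crossedMul α hm hf (hg.dirDeriv v)) (fun x y => ?_)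
      (fun p hp => exists_crossedMul_bound α hm hf (hg.dirDeriv v) hp) x
    obtain ⟨T, hT⟩ := hm.exists_clm (f y)
    simp only [← hT]
    have h1 := HasLineDer.comp_add_right (-y) (hg.hasLineDer (x + -y) v)
    simp only [← sub_eq_add_neg] at h1
    exact (h1.clm (α.actL y)).clm T
  · rintro _ ⟨f, g, hf, hg, rfl⟩ v
    rw [coordMul_crossedMul α hm hf hg]
    exact Submodule.add_mem _ (Submodule.subset_span ⟨_, _, hf.coordMul v, hg, rfl⟩)
      (Submodule.subset_span ⟨_, _, hf, hg.coordMul v, rfl⟩)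

end Crossed

/-! ### The representations on `S(V; A)` -/

section Representations

variable {V : Type*} [NormedAddCommGroup V] [InnerProductSpace ℝ V] [FiniteDimensional ℝ V]
  [MeasurableSpace V] [BorelSpace V]
variable {A : Type*} [NonUnitalRing A] [Module ℂ A] [UniformSpace A] [IsUniformAddGroup A]
  [ContinuousSMul ℂ A] [PolynormableSpace ℂ A] [CompleteSpace A] [T2Space A]

theorem IsSchwartz.comp_sub_left {f : V → A} (hf : IsSchwartz f) (x : V) :
    IsSchwartz fun z => f (x - z) := by
  simpa using hf.comp_neg.comp_sub x

variable (α : SmoothIsometricAction V A)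

/-- The integrand of the oscillation-free form of the operators `π_J(a)`. -/
def orbitKernel (m : A →ₗ[ℂ] A →ₗ[ℂ] A) (L : V →ₗ[ℝ] V) (a : A) (η : V → A) (x y : V) : A :=
  e x y • m (α.act (L y - x) a) (η y)

variable {m : A →ₗ[ℂ] A →ₗ[ℂ] A} (L : V →ₗ[ℝ] V)

theorem continuous_orbitKernel (hm : SeminormBdd m) (a : A) {η : V → A} (hη : IsSchwartz η) :
    Continuous fun q : V × V => orbitKernel α m L a η q.1 q.2 := by
  have hL : Continuous L := L.continuous_of_finiteDimensional
  exact continuous_e.smul (hm.continuous.comp (((α.continuous_orbit a).comp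
    ((hL.comp continuous_snd).sub continuous_fst)).prodMk
      (hη.continuous_self.comp continuous_snd)))

theorem exists_orbitKernel_bound (hm : SeminormBdd m) (a : A) {η : V → A} (hη : IsSchwartz η)
    {p : Seminorm ℂ A} (hp : Continuous p) :
    ∃ h : V → ℝ, Integrable h ∧ ∀ x y, p (orbitKernel α m L a η x y) ≤ h y := by
  obtain ⟨q, hq, hpq⟩ := hm p hp
  obtain ⟨r, hr, hqr, hinv⟩ := α.exists_invariant hq
  refine ⟨_, (hη.integrable_seminorm hq).const_mul (r a), fun x y => ?_⟩
  rw [orbitKernel, map_smul_eq_mul, norm_e, one_mul]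
  exact (hpq _ _).trans (mul_le_mul_of_nonneg_right ((hqr _).trans (hinv _ _).le)
    (apply_nonneg q _))

theorem vInt_orbitKernel (hm : SeminormBdd m) (a : A) {η : V → A} (hη : IsSchwartz η) (x : V) :
    VInt volume (orbitKernel α m L a η x) :=
  VInt.of_bound ((continuous_orbitKernel α L hm a hη).comp
    (continuous_const.prodMk continuous_id)) fun _ hp =>
    let ⟨h, hi, hh⟩ := exists_orbitKernel_bound α L hm a hη hp
    ⟨h, hi, hh x⟩

theorem hasLineDer_orbitKernel_left (hm : SeminormBdd m) (a : A) (η : V → A) (x y v : V) :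
    HasLineDer (fun x => orbitKernel α m L a η x y)
      ((2 * Real.pi * Complex.I : ℂ) • orbitKernel α m L a (coordMul v η) x y +
        orbitKernel α m L (α.gen (-v) a) η x y) x v := by
  obtain ⟨T, hT⟩ := hm.exists_clm_flip (η y)
  have h1 := HasLineDer.comp_linear (f := fun x => α.act x a) (x := x) (u := v) (-LinearMap.id)
    (L y) (α.hasLineDer_orbit a (-x + L y) (-v))
  have h2 := hasLineDer_e_smul y (h1.clm T)
  simp only [LinearMap.neg_apply, LinearMap.id_apply, neg_add_eq_sub, hT] at h2
  refine (congrArg (fun d => HasLineDer (fun x => orbitKernel α m L a η x y) d x v) ?_).mpr h2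
  rw [orbitKernel, orbitKernel, coordMul, smul_add, map_smul, real_inner_comm v y]
  simp only [smul_smul]
  congr 2
  ring

theorem hasLineDer_orbitKernel_right (hm : SeminormBdd m) (a : A) {η : V → A} (hη : IsSchwartz η)
    (x y v : V) : HasLineDer (orbitKernel α m L a η x)
      (((2 * Real.pi * Complex.I * (inner ℝ v x : ℝ)) : ℂ) • orbitKernel α m L a η x y +
        (orbitKernel α m L (α.gen (L v) a) η x y + orbitKernel α m L a (dirDeriv v η) x y))
      y v := by
  have h1 := HasLineDer.comp_linear L (-x) (α.hasLineDer_orbit a (L y + -x) (L v))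
  simp only [← sub_eq_add_neg] at h1
  have h2 := hasLineDer_e_smul x (h1.bilin m hm.continuous (hη.hasLineDer y v))
  simp only [e_comm _ x, smul_add, smul_comm (e x y)] at h2
  simpa only [orbitKernel, real_inner_comm] using! h2

/-- The `y`-derivative of the kernel integrates to zero. Its term from `e(x·y)` is `2πi⟪v, x⟫` times
the kernel; the other two come from the orbit of `a` and from `η`. -/
theorem coordMul_vIntegral_orbitKernel (hm : SeminormBdd m) (a : A) {η : V → A}
    (hη : IsSchwartz η) (v : V) :
    coordMul v (fun x => vIntegral volume (orbitKernel α m L a η x)) =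
      (-(2 * Real.pi * Complex.I : ℂ)⁻¹) •
        ((fun x => vIntegral volume (orbitKernel α m L (α.gen (L v) a) η x)) +
          fun x => vIntegral volume (orbitKernel α m L a (dirDeriv v η) x)) := by
  funext x
  have i0 := vInt_orbitKernel α L hm a hη x
  have i1 := vInt_orbitKernel α L hm (α.gen (L v) a) hη x
  have i2 := vInt_orbitKernel α L hm a (hη.dirDeriv v) x
  have key := vIntegral_eq_zero_of_hasLineDer i0 ((i0.smul _).add (i1.add i2))
    fun y => hasLineDer_orbitKernel_right α L hm a hη x y v
  rw [(i0.smul _).vIntegral_add (i1.add i2), i0.vIntegral_smul, i1.vIntegral_add i2,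
    add_comm, add_eq_zero_iff_eq_neg, ← neg_smul] at key
  simp only [Pi.smul_apply, Pi.add_apply, coordMul]
  rw [key, smul_smul]
  congr 1
  have := Complex.two_pi_I_ne_zero
  field_simp

/-- Both `a` and `η` must vary in the generating family: derivatives and coordinate multiplications
replace `a` by its images under generators, and `η` by coordinate multiples or derivatives. -/
theorem isSchwartz_orbitKernel (hm : SeminormBdd m) (a : A) {η : V → A} (hη : IsSchwartz η) :
    IsSchwartz fun x => vIntegral volume (orbitKernel α m L a η x) := by
  refine isSchwartz_of_span (𝒢 := {h | ∃ (a : A) (η : V → A), IsSchwartz η ∧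
    h = fun x => vIntegral volume (orbitKernel α m L a η x)}) ?_ ?_ ?_ ?_
    (Submodule.subset_span ⟨a, η, hη, rfl⟩)
  · rintro _ ⟨a, η, hη, rfl⟩
    exact continuous_vIntegral (vInt_orbitKernel α L hm a hη) (fun y =>
      (continuous_orbitKernel α L hm a hη).comp (continuous_id.prodMk continuous_const))
      fun p hp => exists_orbitKernel_bound α L hm a hη hp
  · rintro _ ⟨a, η, hη, rfl⟩ p hp
    obtain ⟨h, hi, hh⟩ := exists_orbitKernel_bound α L hm a hη hp
    refine ⟨∫ y, h y, fun x => ?_⟩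
    have hv := vInt_orbitKernel α L hm a hη x
    exact (hv.seminorm_vIntegral_le hp).trans
      (integral_mono (hv.integrable_seminorm hp) hi (hh x))
  · rintro _ ⟨a, η, hη, rfl⟩ v
    have i1 := vInt_orbitKernel α L hm a (hη.coordMul v)
    have i2 := vInt_orbitKernel α L hm (α.gen (-v) a) hη
    refine ⟨_, Submodule.add_mem _ (Submodule.smul_mem _ (2 * Real.pi * Complex.I : ℂ)
      (Submodule.subset_span ⟨a, _, hη.coordMul v, rfl⟩))
      (Submodule.subset_span ⟨α.gen (-v) a, _, hη, rfl⟩), fun x => ?_⟩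
    have key := hasLineDer_vIntegral (vInt_orbitKernel α L hm a hη)
      (fun x => ((i1 x).smul (2 * Real.pi * Complex.I : ℂ)).add (i2 x))
      (fun x y => hasLineDer_orbitKernel_left α L hm a η x y v) (fun p hp => ?_) x
    · rw [((i1 x).smul _).vIntegral_add (i2 x), (i1 x).vIntegral_smul] at key
      exact key
    · obtain ⟨h₁, hi₁, hh₁⟩ := exists_orbitKernel_bound α L hm a (hη.coordMul v) hp
      obtain ⟨h₂, hi₂, hh₂⟩ := exists_orbitKernel_bound α L hm (α.gen (-v) a) hη hp
      refine ⟨_, (hi₁.const_mul ‖(2 * Real.pi * Complex.I : ℂ)‖).add hi₂, fun x y => ?_⟩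
      refine (map_add_le_add p _ _).trans (add_le_add ?_ (hh₂ x y))
      rw [map_smul_eq_mul]
      exact mul_le_mul_of_nonneg_left (hh₁ x y) (norm_nonneg _)
  · rintro _ ⟨a, η, hη, rfl⟩ v
    rw [coordMul_vIntegral_orbitKernel α L hm a hη]
    exact Submodule.smul_mem _ _ (Submodule.add_mem _ (Submodule.subset_span ⟨_, _, hη, rfl⟩)
      (Submodule.subset_span ⟨_, _, hη.dirDeriv v, rfl⟩))

/-- Fubini, then the scalar `e(-z·y)` is moved from `η` to `g`, where its `z`-integral is the
Fourier transform. The case `L = J` serves `π_J(f)`, the case `L = 0` serves `π(f)`. -/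
theorem vIntegral_orbitKernel_swap (hm : SeminormBdd m) {g η : V → A} (hg : IsSchwartz g)
    (hη : IsSchwartz η) (c x : V) :
    VInt volume (fun z => vIntegral volume fun y =>
        e x y • m (α.act (L y + c) (g z)) (e (-z) y • η y)) ∧
      vIntegral volume (fun z => vIntegral volume fun y =>
        e x y • m (α.act (L y + c) (g z)) (e (-z) y • η y)) =
      vIntegral volume fun y => e x y • m (α.act (L y + c) (fourier g y)) (η y) := by
  have hL : Continuous L := L.continuous_of_finiteDimensional
  have hc : Continuous fun q : V × V =>
      e x q.2 • m (α.act (L q.2 + c) (g q.1)) (e (-q.1) q.2 • η q.2) :=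
    ((continuous_e_right x).comp continuous_snd).smul (hm.continuous.comp
      ((α.continuous_act.comp (((hL.comp continuous_snd).add continuous_const).prodMk
        (hg.continuous_self.comp continuous_fst))).prodMk
        ((continuous_e.comp (continuous_fst.neg.prodMk continuous_snd)).smul
          (hη.continuous_self.comp continuous_snd))))
  have hb : ∀ p : Seminorm ℂ A, Continuous p → ∃ h k : V → ℝ, Integrable h ∧ Integrable k ∧
      ∀ q : V × V, p (e x q.2 • m (α.act (L q.2 + c) (g q.1)) (e (-q.1) q.2 • η q.2)) ≤
        h q.1 * k q.2 := by
    intro p hp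
    obtain ⟨q, hq, hpq⟩ := hm p hp
    obtain ⟨r, hr, hqr, hinv⟩ := α.exists_invariant hq
    refine ⟨_, _, hg.integrable_seminorm hr, hη.integrable_seminorm hq, fun w => ?_⟩
    rw [map_smul_eq_mul, norm_e, one_mul]
    refine (hpq _ _).trans (mul_le_mul ((hqr _).trans (hinv _ _).le) ?_ (apply_nonneg q _)
      (apply_nonneg r _))
    rw [map_smul_eq_mul, norm_e, one_mul]
  have h2 : ∀ y, VInt volume (fun z => e x y • m (α.act (L y + c) (g z)) (e (-z) y • η y)) ∧
      vIntegral volume (fun z => e x y • m (α.act (L y + c) (g z)) (e (-z) y • η y)) =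
        e x y • m (α.act (L y + c) (fourier g y)) (η y) := by
    intro y
    obtain ⟨T, hT⟩ := hm.exists_clm_flip (η y)
    have i := (hg.vInt_fourier y).clm (T ∘L α.actL (L y + c))
    have he : (fun z => e x y • m (α.act (L y + c) (g z)) (e (-z) y • η y)) =
        fun z => e x y • (T ∘L α.actL (L y + c)) (e (-z) y • g z) := by
      funext z
      rw [map_smul, map_smul, ContinuousLinearMap.comp_apply, hT, α.actL_apply]
    rw [he]
    refine ⟨i.smul _, ?_⟩
    rw [i.vIntegral_smul, (hg.vInt_fourier y).vIntegral_clm, ContinuousLinearMap.comp_apply, hT,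
      α.actL_apply]
    rfl
  have key := vIntegral_swap (μ := (volume : Measure V)) (ν := (volume : Measure V))
    (F := fun z y => e x y • m (α.act (L y + c) (g z)) (e (-z) y • η y))
    (VInt.of_bound hc fun p hp => by
      obtain ⟨h, k, hh, hk, hb⟩ := hb p hp
      exact ⟨_, hh.mul_prod hk, hb⟩)
    (fun z => VInt.of_bound (hc.comp (continuous_const.prodMk continuous_id)) fun p hp => by
      obtain ⟨h, k, hh, hk, hb⟩ := hb p hp
      exact ⟨_, hk.const_mul (h z), fun y => hb (z, y)⟩)
    fun y => (h2 y).1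
  refine ⟨key.1, key.2.2.trans ?_⟩
  congr 1
  funext y
  exact (h2 y).2

variable [IsScalarTower ℂ A A] [SMulCommClass ℂ A A] [ContinuousMul A]

theorem isAmplitude_piOpJ (J : V →ₗ[ℝ] V) (a : A) {ξ : V → A} (hξ : IsSchwartz ξ) (x : V) :
    IsAmplitude fun w : V × V =>
      leftTranslate (J w.1) (orbitFun α a) x * leftTranslate w.2 ξ x := by
  have h := (α.isAmplitude_act (J.toContinuousLinearMap ∘L ContinuousLinearMap.fst ℝ V V)
    (α.act (-x) a)).bilin (seminormBdd_mul A)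
      (hξ.isAmplitude (-ContinuousLinearMap.snd ℝ V V) x)
  convert h using 2 with w
  rw [LinearMap.mul_apply', leftTranslate, leftTranslate, orbitFun, ← α.act_add]
  congr 2
  · simp [sub_eq_add_neg, add_comm]
  · simp [sub_eq_add_neg, add_comm]

/-- The amplitude decays in `z`, so the `z`-integral may be done first; it turns `ξ(x - z)` into
`e(x·y) ξ̂(y)`. What remains converges absolutely, as `ξ̂` is Schwartz. -/
theorem piOpJ_eq_vIntegral (J : V →ₗ[ℝ] V) (a : A) {ξ : V → A} (hξ : IsSchwartz ξ) (x : V) :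
    piOpJ α J a ξ x =
      vIntegral volume (orbitKernel α (LinearMap.mul ℂ A) J a (fourier ξ) x) := by
  have hin : ∀ y, vIntegral volume (fun z =>
      e y z • (leftTranslate (J y) (orbitFun α a) x * leftTranslate z ξ x)) =
      orbitKernel α (LinearMap.mul ℂ A) J a (fourier ξ) x y := by
    intro y
    obtain ⟨T, hT⟩ := (seminormBdd_mul A).exists_clm (α.act (J y - x) a)
    have i := (hξ.comp_sub_left x).vInt_fourierInv y
    rw [orbitKernel, ← hT, ← map_smul, ← vIntegral_e_smul_sub hξ, ← i.vIntegral_clm]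
    congr 1
    funext z
    rw [map_smul, hT, leftTranslate, orbitFun, neg_sub]
    rfl
  rw [piOpJ, rieffelMulFun]
  refine ((isAmplitude_piOpJ α J a hξ x).oscIntegral_eq_of_decay_snd ?_ ?_).trans ?_
  · intro p hp
    obtain ⟨q, hq, hpq⟩ := seminormBdd_mul A p hp
    obtain ⟨r, hr, hqr, hinv⟩ := α.exists_invariant hq
    refine ⟨_, ((hξ.comp_sub_left x).integrable_seminorm hq).const_mul (r a), fun y z => ?_⟩
    exact (hpq _ _).trans (mul_le_mul_of_nonneg_right ((hqr _).trans (hinv _ _).le)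
      (apply_nonneg q _))
  · simp only [hin]
    exact vInt_orbitKernel α J (seminormBdd_mul A) a hξ.fourier x
  · simp only [hin]
theorem isSchwartz_piOpJ (J : V →ₗ[ℝ] V) (a : A) {ξ : V → A} (hξ : IsSchwartz ξ) :
    IsSchwartz (piOpJ α J a ξ) := by
  rw [show piOpJ α J a ξ = _ from funext (piOpJ_eq_vIntegral α J a hξ)]
  exact isSchwartz_orbitKernel α J (seminormBdd_mul A) a hξ.fourier

/-- With `ξ'(x) = α_x(ξ(x))` the integrand of `π(f)ξ` is `α_{-x}` of the integrand of the crossed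
product `f * ξ'`, so `π(f)ξ` inherits convergence and the Schwartz property from the latter. -/
theorem piOp_leftTranslate (a : A) (ξ : V → A) (x z : V) : piOp α a (leftTranslate z ξ) x =
    α.actL (-x) (a * α.act z (α.act (x - z) (ξ (x - z)))) := by
  rw [α.actL_apply, map_mul, ← α.act_add, ← α.act_add, piOp, orbitFun, leftTranslate]
  rw [show -x + z + (x - z) = 0 by abel, α.act_zero]

theorem vInt_piOp {f ξ : V → A} (hf : IsSchwartz f) (hξ : IsSchwartz ξ) (x : V) :
    VInt volume fun z => piOp α (f z) (leftTranslate z ξ) x := by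
  simp only [piOp_leftTranslate]
  exact (vInt_crossedMul α (seminormBdd_mul A) hf
    (α.isSchwartz_act hξ LinearMap.id continuous_id) x).clm _

theorem isSchwartz_integratedRep_piOp {f ξ : V → A} (hf : IsSchwartz f) (hξ : IsSchwartz ξ) :
    IsSchwartz (integratedRep (piOp α) f ξ) := by
  have hξ' := α.isSchwartz_act hξ LinearMap.id continuous_id
  have h : integratedRep (piOp α) f ξ = fun x => α.act ((-LinearMap.id : V →ₗ[ℝ] V) x)
      (crossedMul (fun a b => a * b) α f (fun x => α.act x (ξ x)) x) := by
    funext x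
    simp only [integratedRep, piOp_leftTranslate]
    exact (vInt_crossedMul α (seminormBdd_mul A) hf hξ' x).vIntegral_clm _
  rw [h]
  exact α.isSchwartz_act (isSchwartz_crossedMul α (seminormBdd_mul A) hf hξ') _
    continuous_neg

theorem piOpJ_leftTranslate (J : V →ₗ[ℝ] V) (a : A) {ξ : V → A} (hξ : IsSchwartz ξ) (x z : V) :
    piOpJ α J a (leftTranslate z ξ) x = vIntegral volume fun y =>
      e x y • LinearMap.mul ℂ A (α.act (J y + -x) a) (e (-z) y • fourier ξ y) := by
  rw [piOpJ_eq_vIntegral α J a (ξ := leftTranslate z ξ) (hξ.comp_sub z)]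
  congr 1
  funext y
  rw [orbitKernel, fourier_leftTranslate hξ, sub_eq_add_neg]

theorem vInt_piOpJ (J : V →ₗ[ℝ] V) {f ξ : V → A} (hf : IsSchwartz f) (hξ : IsSchwartz ξ) (x : V) :
    VInt volume fun z => piOpJ α J (f z) (leftTranslate z ξ) x := by
  have : (fun z => piOpJ α J (f z) (leftTranslate z ξ) x) = _ :=
    funext fun z => piOpJ_leftTranslate α J (f z) hξ x z
  rw [this]
  exact (vIntegral_orbitKernel_swap α J (seminormBdd_mul A) hf hξ.fourier (-x) x).1

theorem piOp_leftTranslate_eq_vIntegral (a : A) {ξ : V → A} (hξ : IsSchwartz ξ) (x z : V) :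
    piOp α a (leftTranslate z ξ) x = vIntegral volume fun y => e x y •
      LinearMap.mul ℂ A (α.act ((0 : V →ₗ[ℝ] V) y + -x) a) (e (-z) y • fourier ξ y) := by
  obtain ⟨T, hT⟩ := (seminormBdd_mul A).exists_clm (α.act (-x) a)
  have h1 : ξ (x - z) = vIntegral volume fun y => e (x - z) y • fourier ξ y :=
    congrFun (fourierInv_fourier hξ).symm _
  rw [piOp, leftTranslate, orbitFun, ← LinearMap.mul_apply' (R := ℂ), ← hT, h1,
    ← (hξ.fourier.vInt_fourierInv _).vIntegral_clm]
  congr 1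
  funext y
  rw [LinearMap.zero_apply, zero_add, sub_eq_add_neg, e_add_left, map_smul, ← hT, map_smul,
    smul_smul]

/-- Both sides equal `∫ e(x·y) α_{Jy-x}(f̂(y)) ξ̂(y) dy`: on the right `J` is zero, and the missing
`α_{Jy}` is supplied by the Fourier transform of `Θ_J(f)`. -/
theorem integratedRep_piOpJ (J : V →ₗ[ℝ] V) {f ξ : V → A} (hf : IsSchwartz f)
    (hξ : IsSchwartz ξ) :
    integratedRep (piOpJ α J) f ξ = integratedRep (piOp α) (theta α J f) ξ := by
  funext x
  simp only [integratedRep, piOpJ_leftTranslate α J _ hξ, piOp_leftTranslate_eq_vIntegral α _ hξ]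
  rw [(vIntegral_orbitKernel_swap α J (seminormBdd_mul A) hf hξ.fourier (-x) x).2,
    (vIntegral_orbitKernel_swap α 0 (seminormBdd_mul A) (isSchwartz_theta α J hf)
      hξ.fourier (-x) x).2, fourier_theta α J hf]
  congr 1
  funext y
  rw [LinearMap.zero_apply, zero_add, ← α.act_add, add_comm]

theorem isSchwartz_integratedRep_piOpJ (J : V →ₗ[ℝ] V) {f ξ : V → A} (hf : IsSchwartz f)
    (hξ : IsSchwartz ξ) : IsSchwartz (integratedRep (piOpJ α J) f ξ) := by
  rw [integratedRep_piOpJ α J hf hξ]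
  exact isSchwartz_integratedRep_piOp α (isSchwartz_theta α J hf) hξ

end Representations

/-! ### Integrals of translated oscillatory integrals -/

section OscTranslate

variable {V : Type*} [NormedAddCommGroup V] [InnerProductSpace ℝ V] [FiniteDimensional ℝ V]
  [MeasurableSpace V] [BorelSpace V]
variable {E : Type*} [NormedAddCommGroup E] [NormedSpace ℂ E]

theorem AmpBdd.integrable_schwartzMap_smul {K : ℝ} {G : V × V → E}
    (hG : AmpBdd (normSeminorm ℂ E) K G) (χ : 𝓢(V × V, ℂ)) (τ : V × V) {ε : ℝ} (hε : 0 < ε) :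
    Integrable fun w => χ (ε • (w + τ)) • G w := by
  have h1 : Integrable fun w : V × V => ‖χ (ε • (w + τ))‖ * K :=
    ((χ.integrable.norm.comp_smul hε.ne').comp_add_right τ).mul_const K
  refine h1.mono' ((χ.continuous.comp ((continuous_id.add continuous_const).const_smul ε)).smul
    hG.continuous).aestronglyMeasurable (ae_of_all _ fun w => ?_)
  rw [norm_smul]
  exact mul_le_mul_of_nonneg_left (hG.bound w) (norm_nonneg _)

variable [CompleteSpace E]

/-- Undoing the translation by `(0, y)` multiplies the phase by `e(w.1, -y)`. The cut-off is centred
at `-(0, y)`, so that it becomes `χ(ε w)`, free of `y`, after the change of variables; Fubini then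
applies for each `ε`. The limit `ε → 0` passes under the `y`-integral because the regularized
integrals are bounded by a multiple of `K y`. -/
theorem integral_osc_translate {H : V → V × V → E} {K : V → ℝ} (hK : Integrable K)
    (hc : Continuous fun q : V × (V × V) => H q.1 q.2)
    (hH : ∀ y, AmpBdd (normSeminorm ℂ E) (K y) fun w => H y (w + (0, y)))
    {K' : ℝ} (hH' : AmpBdd (normSeminorm ℂ E) K' fun w => ∫ y, e w.1 (-y) • H y w) :
    ∫ y, osc (fun w => H y (w + (0, y))) = osc fun w => ∫ y, e w.1 (-y) • H y w := by
  obtain ⟨χ, hχ⟩ := exists_schwartzMap_apply_zero (V × V)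
  obtain ⟨L, hL⟩ := SchwartzMap.exists_ampBdd χ (ContinuousLinearMap.id ℝ (V × V))
  have hL : AmpBdd (normSeminorm ℂ ℂ) L χ := hL
  obtain ⟨C, hC, hbound⟩ := exists_norm_integral_regularized_le V E
  set P : ℝ → V → V × V → E := fun ε y w =>
    (χ (ε • w) * (e w.1 w.2 * e w.1 (-y))) • H y w
  have hI : ∀ (ε : ℝ) (y : V), ∫ w : V × V, (χ (ε • (w + (0, y))) * e w.1 w.2) •
      H y (w + (0, y)) = ∫ w, P ε y w := by
    intro ε y
    rw [← integral_add_right_eq_self (P ε y) ((0, y) : V × V)]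
    congr 1
    funext w
    simp only [P, ← e_add_right, Prod.fst_add, Prod.snd_add, add_zero, add_neg_cancel_right]
  have hP : ∀ ε : ℝ, 0 < ε → Integrable (Function.uncurry (P ε)) (volume.prod volume) := by
    intro ε hε
    have h1 := hK.mul_prod
      ((χ.integrable (μ := (volume : Measure (V × V)))).norm.comp_smul hε.ne')
    refine h1.mono' (Continuous.aestronglyMeasurable ?_) (ae_of_all _ fun q => ?_)
    · refine Continuous.smul ((χ.continuous.comp (continuous_snd.const_smul ε)).mul
        ((continuous_e.comp continuous_snd).mul (continuous_e.comp
          ((continuous_fst.comp continuous_snd).prodMk continuous_fst.neg)))) hc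
    · have h2 := (hH q.1).bound (q.2 - (0, q.1))
      simp only [sub_add_cancel] at h2
      simp only [Function.uncurry, P, norm_smul, norm_mul, norm_e, mul_one]
      rw [mul_comm (K _)]
      exact mul_le_mul_of_nonneg_left h2 (norm_nonneg _)
  have hlim : Tendsto (fun ε : ℝ => ∫ y, ∫ w, P ε y w) (𝓝[>] 0)
      (𝓝 (∫ y, osc fun w => H y (w + (0, y)))) := by
    refine tendsto_integral_filter_of_dominated_convergence (fun y => C * (L * K y)) ?_ ?_
      ((hK.const_mul L).const_mul C) (ae_of_all _ fun y => ?_)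
    · filter_upwards [self_mem_nhdsWithin] with ε hε
      exact (hP ε hε).integral_prod_left.aestronglyMeasurable
    · filter_upwards [Ioc_mem_nhdsGT (zero_lt_one' ℝ)] with ε hε
      refine ae_of_all _ fun y => ?_
      rw [← hI]
      exact hbound hL (hH y) (0, y) ε hε.1 hε.2 ((hH y).integrable_schwartzMap_smul χ _ hε.1)
    · simp only [← hI]
      exact tendsto_integral_regularized hL hχ (hH y) (0, y) fun ε hε =>
        (hH y).integrable_schwartzMap_smul χ _ hε
  refine tendsto_nhds_unique hlim ((tendsto_integral_regularized hL hχ hH' 0 fun ε hε =>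
    hH'.integrable_schwartzMap_smul χ _ hε).congr' ?_)
  filter_upwards [self_mem_nhdsWithin] with ε hε
  rw [integral_integral_swap (hP ε hε)]
  congr 1
  funext w
  simp only [P, ← mul_assoc, add_zero]
  simp only [mul_smul _ (e w.1 (-_)), integral_smul]

end OscTranslate

/-! ### Multiplicativity of `Θ_J` -/

section Multiplicative

variable {V : Type*} [NormedAddCommGroup V] [InnerProductSpace ℝ V] [FiniteDimensional ℝ V]
  [MeasurableSpace V] [BorelSpace V]
variable {A : Type*} [NonUnitalRing A] [Module ℂ A] [UniformSpace A] [IsUniformAddGroup A]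
  [ContinuousSMul ℂ A] [PolynormableSpace ℂ A] [CompleteSpace A] [T2Space A]
variable (α : SmoothIsometricAction V A) {m : A →ₗ[ℂ] A →ₗ[ℂ] A}

theorem vInt_bilin_act (hm : SeminormBdd m) {f : V → A} (hf : IsSchwartz f) (b : A) :
    VInt volume fun y => m (f y) (α.act y b) := by
  refine VInt.of_bound (hm.continuous.comp (hf.continuous_self.prodMk (α.continuous_orbit b)))
    fun p hp => ?_
  obtain ⟨q, hq, hpq⟩ := hm p hp
  obtain ⟨r, hr, hqr, hinv⟩ := α.exists_invariant hq
  refine ⟨_, (hf.integrable_seminorm hq).mul_const (r b), fun y => (hpq _ _).trans ?_⟩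
  exact mul_le_mul_of_nonneg_left ((hqr _).trans (hinv _ _).le) (apply_nonneg q _)

/-- Fubini, then translation of `x` by `y`, which produces the Fourier transform of `g` and the
scalar `e(-y·k)`. The scalar is attached to `f`, to be treated as a modulation. -/
theorem fourier_crossedMul (hm : SeminormBdd m) {f g : V → A} (hf : IsSchwartz f)
    (hg : IsSchwartz g) (k : V) : fourier (crossedMul (fun a b => m a b) α f g) k =
      vIntegral volume fun y => m (e (-y) k • f y) (α.act y (fourier g k)) := by
  have hc : Continuous fun q : V × V =>
      e (-q.1) k • m (f q.2) (α.act q.2 (g (q.1 - q.2))) :=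
    ((continuous_e_left k).comp continuous_fst.neg).smul
      (continuous_crossedMul_integrand α hm hf hg)
  have h2 : ∀ y, VInt volume (fun x => e (-x) k • m (f y) (α.act y (g (x - y)))) ∧
      vIntegral volume (fun x => e (-x) k • m (f y) (α.act y (g (x - y)))) =
        m (e (-y) k • f y) (α.act y (fourier g k)) := by
    intro y
    obtain ⟨T, hT⟩ := hm.exists_clm (f y)
    have hs := hg.comp_sub y
    have i := (hs.vInt_fourier k).clm (T ∘L α.actL y)
    have he : (fun x => e (-x) k • m (f y) (α.act y (g (x - y)))) =
        fun x => (T ∘L α.actL y) (e (-x) k • g (x - y)) := by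
      funext x
      rw [map_smul, ContinuousLinearMap.comp_apply, hT, α.actL_apply]
    rw [he]
    refine ⟨i, (hs.vInt_fourier k).vIntegral_clm _ |>.trans ?_⟩
    have := fourier_leftTranslate hg y k
    rw [fourier] at this
    simp only [leftTranslate] at this
    rw [this, map_smul, ContinuousLinearMap.comp_apply, hT, α.actL_apply, map_smul,
      LinearMap.smul_apply]
  have h1 : ∀ x, VInt volume fun y => e (-x) k • m (f y) (α.act y (g (x - y))) := fun x =>
    (vInt_crossedMul α hm hf hg x).smul _
  have key := vIntegral_swap (μ := (volume : Measure V)) (ν := (volume : Measure V))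
    (F := fun x y => e (-x) k • m (f y) (α.act y (g (x - y))))
    (VInt.of_bound hc fun p hp => by
      obtain ⟨q, hq, hpq⟩ := hm p hp
      obtain ⟨r, hr, hqr, hinv⟩ := α.exists_invariant hq
      refine ⟨_, (hf.integrable_seminorm hq).convolution_integrand (ContinuousLinearMap.mul ℝ ℝ)
        (hg.integrable_seminorm hr), fun w => ?_⟩
      rw [map_smul_eq_mul, norm_e, one_mul]
      exact (hpq _ _).trans (mul_le_mul_of_nonneg_left ((hqr _).trans (hinv _ _).le)
        (apply_nonneg q _))) h1 fun y => (h2 y).1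
  rw [fourier]
  simp only [crossedMul, ← (vInt_crossedMul α hm hf hg _).vIntegral_smul]
  refine key.2.2.trans ?_
  congr 1
  funext y
  exact (h2 y).2

theorem fourierInv_fourier_add {f : V → A} (hf : IsSchwartz f) (k x : V) :
    fourierInv (fun y => fourier f (y + k)) x = e (-x) k • f x := by
  have h1 : VInt volume fun y => e x y • fourier f (y + k) := by
    have := hf.fourier.comp_sub (-k)
    simp only [sub_neg_eq_add] at this
    exact this.vInt_fourierInv x
  rw [fourierInv, ← h1.vIntegral_comp_sub_left (-k)]
  have h2 : f x = vIntegral volume fun y => e x (-y) • fourier f (-y) := by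
    have i := hf.fourier.vInt_fourierInv x
    have h3 := i.vIntegral_comp_sub_left 0
    simp only [zero_sub] at h3
    rw [h3]
    exact (congrFun (fourierInv_fourier hf) x).symm
  have h4 : VInt volume fun y => e x (-y) • fourier f (-y) := by
    have := (hf.fourier.vInt_fourierInv x).comp_sub_left 0
    simpa only [zero_sub] using this
  rw [h2, ← h4.vIntegral_smul]
  congr 1
  funext y
  rw [smul_smul, ← e_neg_right, ← e_add_right, sub_eq_add_neg, neg_add_cancel_comm]

/-- A modulation is the inverse Fourier transform of a translate of `f̂`; no derivatives of the
character are needed. -/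
theorem isSchwartz_modulate {f : V → A} (hf : IsSchwartz f) (k : V) :
    IsSchwartz fun x => e (-x) k • f x := by
  have h1 := hf.fourier.comp_sub (-k)
  simp only [sub_neg_eq_add] at h1
  have h2 := h1.fourierInv
  rwa [show fourierInv _ = _ from funext (fourierInv_fourier_add hf k)] at h2

theorem fourier_modulate {f : V → A} (hf : IsSchwartz f) (k y : V) :
    fourier (fun x => e (-x) k • f x) y = fourier f (y + k) := by
  have h1 := hf.fourier.comp_sub (-k)
  simp only [sub_neg_eq_add] at h1
  rw [← show fourierInv _ = _ from funext (fourierInv_fourier_add hf k), fourier_fourierInv h1]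

theorem fourier_act {f : V → A} (hf : IsSchwartz f) (w : V) :
    fourier (fun x => α.act w (f x)) = fun y => α.act w (fourier f y) := by
  funext y
  have := (hf.vInt_fourier y).vIntegral_clm (α.actL w)
  simpa only [map_smul, α.actL_apply] using! this

/-- On the Fourier side modulation is translation by `k`, and `α_{J(y+k)} = α_{Jy} α_{Jk}` by
linearity of `J`. -/
theorem theta_modulate (J : V →ₗ[ℝ] V) {f : V → A} (hf : IsSchwartz f) (k : V) :
    theta α J (fun x => e (-x) k • α.act (J k) (f x)) = fun x => e (-x) k • theta α J f x := by
  have hf' : IsSchwartz fun x => α.act (J k) (f x) := hf.clm (α.actL (J k))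
  have h1 := isSchwartz_modulate hf' k
  have h2 := isSchwartz_theta α J hf
  refine fourier_injective (isSchwartz_theta α J h1) (isSchwartz_modulate h2 k) ?_
  funext y
  rw [fourier_theta α J h1, fourier_modulate h2]
  dsimp only
  rw [fourier_modulate hf', fourier_theta α J hf, fourier_act α hf]
  dsimp only
  rw [← α.act_add, map_add]

variable [IsScalarTower ℂ A A] [SMulCommClass ℂ A A] [ContinuousMul A]

/-- Both sides equal the oscillatory integral of `α_{Jx}(f̂(x)) α_z(b)`. For the right side, this
amplitude decays in `x`, and integrating over `x` first gives `Θ_J(f)(z) α_z(b)`. For the left side,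
the substitution `z ↦ z - y` and the `y`-integral create `f̂(x)`; this exchange is
`integral_osc_translate`. -/
theorem vIntegral_rieffelMul_act (J : V →ₗ[ℝ] V) {f : V → A} (hf : IsSchwartz f) (b : A) :
    vIntegral volume (fun y => rieffelMul α J (f y) (α.act y b)) =
      vIntegral volume fun z => theta α J f z * α.act z b := by
  have hm := seminormBdd_mul A
  have hJ : Continuous J := J.continuous_of_finiteDimensional
  have hk := isSchwartz_act_fourier α J hf
  set F : V × V → A := fun w => α.act (J w.1) (fourier f w.1) * α.act w.2 b with hF_def
  have hF : IsAmplitude F := by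
    have := (hk.isAmplitude (ContinuousLinearMap.fst ℝ V V) 0).bilin hm
      (α.isAmplitude_act (ContinuousLinearMap.snd ℝ V V) b)
    simpa using! this
  have hin : ∀ z, vIntegral volume (fun x => e x z • F (x, z)) = theta α J f z * α.act z b := by
    intro z
    obtain ⟨T, hT⟩ := hm.exists_clm_flip (α.act z b)
    have := (hk.vInt_fourierInv z).vIntegral_clm T
    refine Eq.trans ?_ (this.trans (hT _))
    congr 1
    funext x
    rw [map_smul, hT, e_comm]
    rfl
  have hθ := isSchwartz_theta α J hf
  have hR : oscIntegral (fun x z => F (x, z)) =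
      vIntegral volume fun z => theta α J f z * α.act z b := by
    refine (hF.oscIntegral_eq_of_decay_fst ?_ ?_).trans ?_
    · intro p hp
      obtain ⟨q, hq, hpq⟩ := hm p hp
      obtain ⟨r, hr, hqr, hinv⟩ := α.exists_invariant hq
      exact ⟨_, (hk.integrable_seminorm hq).mul_const (r b), fun x z => (hpq _ _).trans
        (mul_le_mul_of_nonneg_left ((hqr _).trans (hinv _ _).le) (apply_nonneg q _))⟩
    · simp only [hin]
      exact vInt_bilin_act α hm hθ b
    · simp only [hin]
  rw [← hR]
  refine eq_of_toCompl_eq fun p hp => ?_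
  have hvi : VInt volume fun y => rieffelMul α J (f y) (α.act y b) :=
    vInt_bilin_act α (seminormBdd_rieffelMulL α J) hf b
  rw [hvi.toCompl_vIntegral hp, hF.toCompl_oscIntegral hp]
  set H : V → V × V → SeminormCompletion p := fun y w =>
    toCompl p (α.act (J w.1) (f y) * α.act w.2 b) with hH_def
  -- Because `α_z α_y = α_{z+y}`, the integrand of the deformed product is `H y` translated by `(0,
  -- y)`.
  have hH1 : ∀ y, toCompl p (rieffelMul α J (f y) (α.act y b)) =
      osc fun w => H y (w + (0, y)) := by
    intro y
    rw [rieffelMul, (isAmplitude_rieffelMul α J (f y) (α.act y b)).toCompl_oscIntegral hp]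
    simp only [hH_def, Prod.fst_add, Prod.snd_add, add_zero, α.act_add]
  have hH2 : ∀ w, toCompl p (F w) = ∫ y, e w.1 (-y) • H y w := by
    intro w
    obtain ⟨T, hT⟩ := hm.exists_clm_flip (α.act w.2 b)
    have i := (hf.vInt_fourier w.1).clm (T ∘L α.actL (J w.1))
    have h1 := (hf.vInt_fourier w.1).vIntegral_clm (T ∘L α.actL (J w.1))
    have h2 := i.toCompl_vIntegral hp
    rw [h1, ContinuousLinearMap.comp_apply, hT, α.actL_apply] at h2
    refine h2.trans ?_
    congr 1
    funext y
    rw [map_smul, map_smul, ContinuousLinearMap.comp_apply, hT, α.actL_apply, e_comm w.1]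
    rfl
  simp only [hH1, hH2]
  obtain ⟨q, hq, hpq⟩ := hm p hp
  obtain ⟨r, hr, hqr⟩ := α.exists_ampBdd_act
    (J.toContinuousLinearMap ∘L ContinuousLinearMap.fst ℝ V V) hq
  obtain ⟨s, hs, hqs⟩ := α.exists_ampBdd_act (ContinuousLinearMap.snd ℝ V V) hq
  -- The invariant `t` bounds the constant of the orbit of `α_y(b)` by `t b` for all `y`, so the
  -- majorant depends on `y` through `r (f y)` only and is integrable.
  obtain ⟨t, ht, hst, hinv⟩ := α.exists_invariant hs
  obtain ⟨K', hK'⟩ := hF p hp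
  refine integral_osc_translate (K := fun y => 2 ^ phaseOrder V * (r (f y) * t b))
    (((hf.integrable_seminorm hr).mul_const _).const_mul _) ?_ (fun y => ?_) (K' := K') ?_
  · exact (continuous_toCompl hp).comp (((α.continuous_act.comp ((hJ.comp (continuous_fst.comp
      continuous_snd)).prodMk (hf.continuous_self.comp continuous_fst)))).mul
        ((α.continuous_orbit b).comp (continuous_snd.comp continuous_snd)))
  · have h1 := (((hqr (f y)).bilin hm.continuous hpq (hqs (α.act y b))).toCompl hp)
    have h2 : (fun w => H y (w + (0, y))) = fun w : V × V => toCompl p (LinearMap.mul ℂ A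
        (α.act ((J.toContinuousLinearMap ∘L ContinuousLinearMap.fst ℝ V V) w) (f y))
        (α.act (ContinuousLinearMap.snd ℝ V V w) (α.act y b))) := by
      funext w
      simp only [hH_def, Prod.fst_add, Prod.snd_add, add_zero, α.act_add]
      rfl
    rw [h2]
    have h3 : 2 ^ phaseOrder V * (r (f y) * s (α.act y b)) ≤
        2 ^ phaseOrder V * (r (f y) * t b) :=
      mul_le_mul_of_nonneg_left (mul_le_mul_of_nonneg_left ((hst _).trans (hinv _ _).le)
        (apply_nonneg r _)) (by positivity)
    exact ⟨h1.continuous, fun w => (h1.bound w).trans h3, fun j => (h1.line j).mono fun _ => h3⟩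
  · simpa only [hH2] using hK'.toCompl hp

/-- Fourier transforms are compared at `k`. On the left stands `α_{Jk}` of an integral of deformed
products; since `α_{Jk}` respects `×_J`, it acts on both factors. The preceding integral identity,
applied to the modulation of `α_{Jk} ∘ f` and to `b = α_{Jk}(ĝ(k))`, which is the transform of
`Θ_J(g)` at `k`, gives the right side. -/
theorem theta_crossedMul (J : V →ₗ[ℝ] V) {f g : V → A} (hf : IsSchwartz f) (hg : IsSchwartz g) :
    theta α J (crossedMul (rieffelMul α J) α f g) =
      crossedMul (fun a b => a * b) α (theta α J f) (theta α J g) := by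
  have hm := seminormBdd_rieffelMulL α J
  have hc : IsSchwartz (crossedMul (rieffelMul α J) α f g) := isSchwartz_crossedMul α hm hf hg
  have hθf := isSchwartz_theta α J hf
  have hθg := isSchwartz_theta α J hg
  refine fourier_injective (isSchwartz_theta α J hc)
    (isSchwartz_crossedMul α (seminormBdd_mul A) hθf hθg) ?_
  funext k
  have h1 := fourier_crossedMul α hm hf hg k
  have h2 := fourier_crossedMul α (seminormBdd_mul A) hθf hθg k
  have i1 := vInt_bilin_act α hm (isSchwartz_modulate hf k) (fourier g k)
  have h3 := vIntegral_rieffelMul_act α J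
    (isSchwartz_modulate (f := fun x => α.act (J k) (f x)) (hf.clm (α.actL (J k))) k)
    (α.act (J k) (fourier g k))
  rw [theta_modulate α J hf] at h3
  rw [fourier_theta α J hc]
  refine (congrArg (α.act (J k)) h1).trans (Eq.trans ?_ (h3.trans (Eq.trans ?_ h2.symm)))
  · refine (i1.vIntegral_clm (α.actL (J k))).symm.trans ?_
    congr 1
    funext y
    rw [α.actL_apply, rieffelMulL_apply, ← rieffelMul_act, map_smul, α.act_comm (J k) y]
  · rw [fourier_theta α J hg]
    rfl

end Multiplicative

end RieffelCrossed

end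

/-! ### The theorem -/

open RieffelCrossed in
theorem theorem1
    {V : Type*} [NormedAddCommGroup V] [InnerProductSpace ℝ V] [FiniteDimensional ℝ V]
    [MeasurableSpace V] [BorelSpace V]
    -- `A` is a Fréchet algebra
    {A : Type*} [NonUnitalRing A] [Module ℂ A] [IsScalarTower ℂ A A] [SMulCommClass ℂ A A]
    [UniformSpace A] [IsUniformAddGroup A] [ContinuousSMul ℂ A] [ContinuousMul A]
    [LocallyConvexSpace ℝ A] [FirstCountableTopology A] [CompleteSpace A] [T2Space A]
    (α : SmoothIsometricAction V A)
    (J : V →ₗ[ℝ] V) (hJ : ∀ x y : V, inner ℝ (J x) y = -inner ℝ x (J y)) :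
    -- the product of `A_J` is well defined
    (∀ a b : A, OscIntegrable (fun x y => α.act (J x) a * α.act y b)) ∧
    -- the product of `V ⋉_α A` is well defined on `S(V; A)`
    (∀ f g : SchwartzFn V A,
      (∀ x, VIntegrable volume (fun y => f y * α.act y (g (x - y)))) ∧
      IsSchwartz (crossedMul (fun a b => a * b) α f g)) ∧
    -- the product of `V ⋉_{α^J} A_J` is well defined on `S(V; A)`
    (∀ f g : SchwartzFn V A,
      (∀ x, VIntegrable volume (fun y => rieffelMul α J (f y) (α.act y (g (x - y))))) ∧
      IsSchwartz (crossedMul (rieffelMul α J) α f g)) ∧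
    -- the operators `π(f)` are well defined on `S(V; A)`
    (∀ f ξ : SchwartzFn V A,
      (∀ x, VIntegrable volume (fun z => piOp α (f z) (leftTranslate z ξ) x)) ∧
      IsSchwartz (integratedRep (piOp α) f ξ)) ∧
    -- the operators `π_J(a)` and `π_J(f)` are well defined on `S(V; A)`
    (∀ (a : A) (ξ : SchwartzFn V A),
      (∀ x, OscIntegrable
        (fun y z => leftTranslate (J y) (orbitFun α a) x * leftTranslate z ξ x)) ∧
      IsSchwartz (piOpJ α J a ξ)) ∧
    (∀ f ξ : SchwartzFn V A,
      (∀ x, VIntegrable volume (fun z => piOpJ α J (f z) (leftTranslate z ξ) x)) ∧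
      IsSchwartz (integratedRep (piOpJ α J) f ξ)) ∧
    -- the operator `Θ_J` is well defined on `S(V; A)`
    (∀ f : SchwartzFn V A,
      (∀ y, VIntegrable volume (fun x => e (-x) y • f x)) ∧
      (∀ x, VIntegrable volume (fun y => e x y • α.act (J y) (fourier f y))) ∧
      IsSchwartz (theta α J f)) ∧
    -- `π_J(f) = π(Θ_J(f))`
    (∀ f ξ : SchwartzFn V A,
      integratedRep (piOpJ α J) f ξ = integratedRep (piOp α) (theta α J f) ξ) ∧
    -- `Θ_J`, with inverse `Θ_{-J}`, is an isomorphism of `V ⋉_{α^J} A_J` onto `V ⋉_α A`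
    ∃ Φ : SchwartzFn V A ≃L[ℂ] SchwartzFn V A,
      (∀ f, (Φ f : V → A) = theta α J f) ∧
      (∀ f, (Φ.symm f : V → A) = theta α (-J) f) ∧
      ∀ f g h : SchwartzFn V A, (h : V → A) = crossedMul (rieffelMul α J) α f g →
        (Φ h : V → A) = crossedMul (fun a b => a * b) α (Φ f) (Φ g) := by
  -- The invariant seminorms of the action supply the polynormable structure on which the preceding
  -- theory rests.
  have := α.polynormableSpace
  have hmul := seminormBdd_mul A
  have hmulJ := seminormBdd_rieffelMulL α J
  refine ⟨fun a b => (isAmplitude_rieffelMul α J a b).oscIntegrable,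
    fun f g => ⟨fun x => (vInt_crossedMul α hmul f.2 g.2 x).vIntegrable,
      isSchwartz_crossedMul α hmul f.2 g.2⟩,
    fun f g => ⟨fun x => (vInt_crossedMul α hmulJ f.2 g.2 x).vIntegrable,
      isSchwartz_crossedMul α hmulJ f.2 g.2⟩,
    fun f ξ => ⟨fun x => (vInt_piOp α f.2 ξ.2 x).vIntegrable,
      isSchwartz_integratedRep_piOp α f.2 ξ.2⟩,
    fun a ξ => ⟨fun x => (isAmplitude_piOpJ α J a ξ.2 x).oscIntegrable,
      isSchwartz_piOpJ α J a ξ.2⟩,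
    fun f ξ => ⟨fun x => (vInt_piOpJ α J f.2 ξ.2 x).vIntegrable,
      isSchwartz_integratedRep_piOpJ α J f.2 ξ.2⟩,
    fun f => ⟨fun y => (f.2.vInt_fourier y).vIntegrable,
      fun x => ((isSchwartz_act_fourier α J f.2).vInt_fourierInv x).vIntegrable,
      isSchwartz_theta α J f.2⟩,
    fun f ξ => integratedRep_piOpJ α J f.2 ξ.2,
    SchwartzFn.thetaEquiv α J, SchwartzFn.coe_thetaEquiv α J, SchwartzFn.coe_thetaEquiv_symm α J,
    fun f g h hh => ?_⟩
  rw [SchwartzFn.coe_thetaEquiv, SchwartzFn.coe_thetaEquiv, SchwartzFn.coe_thetaEquiv, hh]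
  exact theta_crossedMul α J f.2 g.2
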